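/- A fullerene is a 3-valent polyhedron (given by its skeleton, a simple 3-connected 3-valent plane graph) all of whose faces are pentagons or hexagons. A zigzag of a 3-valent plane graph is a closed circuit of edges obtained by turning alternately left and right at the successive vertices, its direction being ignored; it is simple if it traverses no edge twice. The symmetry group of a fullerene is the group of automorphisms of its skeleton, regarded as a point group (a finite subgroup of $O(3)$): there is an isomorphism between the two groups under which orientation-preserving automorphisms correspond to isometries of determinant $1$, orientation-reversing automorphisms correspond to isometries of determinant $-1$, and an automorphism maps some vertex, edge or face to itself if and only if the corresponding isometry fixes a nonzero vector. Theorem. For every even integer $h\ge 2$ there exists a fullerene with $n=18h-8$ vertices that has two distinct simple zigzags with exactly $h$ common edges, and whose symmetry group is - $T_d$ (the full symmetry group of the regular tetrahedron) if $h=2$; - $D_{2\mathrm h}$ if $h\ge 4$ and $h/2$ is even; - $D_{2\mathrm d}$ if $h\ge 4$ and $h/2$ is odd. Here $T_d$, $D_{2\mathrm h}$, $D_{2\mathrm d}$ are the usual (Schoenflies) point groups; the subscripts $\mathrm h,\mathrm d$ are not numbers. Both $D_{2\mathrm h}$ and $D_{2\mathrm d}$ are generated by a rotation $r$ of order two about an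 axis $\Delta$, the reflection in a plane $P$ containing $\Delta$, and a rotation by $\pi$ about an axis orthogonal to $\Delta$, which lies in $P$ for $D_{2\mathrm h}$ and halfway between $P$ and the plane through $\Delta$ orthogonal to $P$ for $D_{2\mathrm d}$. -/

import Mathlib

/-- A rotation system on a simple graph: a permutation of the darts (oriented edges) which cyclically
permutes, for every vertex `v`, the darts starting at `v`. The dart `rot d` is the successor of `d`
in the counterclockwise order around the starting vertex of `d`. For connected graphs, rotation
systems are the same as cellular drawings on closed oriented surfaces, up to homeomorphism. -/
structure RotationSystem {V : Type*} (G : SimpleGraph V) where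
  rot : Equiv.Perm G.Dart
  rot_fst : ∀ d, (rot d).fst = d.fst
  rot_cyclic : ∀ d d' : G.Dart, d.fst = d'.fst → rot.SameCycle d d'

/-- A graph is 3-connected if it has at least four vertices and stays connected whenever
at most two vertices are deleted. -/
def IsThreeConnected {V : Type*} (G : SimpleGraph V) : Prop :=
  4 ≤ Nat.card V ∧ ∀ s : Finset V, s.card ≤ 2 → (G.induce {v | v ∉ s}).Connected

namespace RotationSystem

variable {V : Type*} {G : SimpleGraph V} (R : RotationSystem G)

/-! ### Faces -/

/-- The next dart along the boundary of the face to the left of a dart: at the end of `d`,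
take the neighbour, in clockwise order, of the reversed dart. -/
def faceNext : Equiv.Perm G.Dart :=
  (SimpleGraph.Dart.symm_involutive.toPerm SimpleGraph.Dart.symm).trans R.rot.symm

/-- The faces are the orbits of `faceNext`. -/
def Face : Type _ := Quotient (Equiv.Perm.SameCycle.setoid R.faceNext)

/-- The face to the left of a dart. -/
def faceOf (d : G.Dart) : R.Face := Quotient.mk (Equiv.Perm.SameCycle.setoid R.faceNext) d

/-- The number of sides of a face. -/
noncomputable def Face.sides {R : RotationSystem G} (F : R.Face) : ℕ :=
  {d : G.Dart | R.faceOf d = F}.ncard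

/-- The set of edges on the boundary of a face. -/
def Face.edges {R : RotationSystem G} (F : R.Face) : Set (Sym2 V) :=
  {e | ∃ d : G.Dart, R.faceOf d = F ∧ d.edge = e}

/-- The rotation system of a connected finite graph describes a drawing on the sphere
(equivalently, a plane graph) iff Euler's formula `|V| - |E| + |F| = 2` holds. -/
def IsPlane : Prop :=
  Finite V ∧ G.Connected ∧ Nat.card V + Nat.card R.Face = G.edgeSet.ncard + 2

/-- A fullerene, given by its plane skeleton: a plane 3-connected graph (the skeleton of a
polyhedron), all of whose vertices have degree three and all of whose faces are pentagons or
hexagons. -/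
def IsFullerene : Prop :=
  R.IsPlane ∧ IsThreeConnected G ∧ (∀ v, (G.neighborSet v).ncard = 3) ∧
    ∀ F : R.Face, F.sides = 5 ∨ F.sides = 6

/-! ### Zigzags -/

/-- One step along a zigzag. The state `(d, true)` means that the dart `d` is being traversed and
that the next turn is to the left; `(d, false)` that the next turn is to the right. Left and right
turns alternate. -/
def zigzagNext (x : G.Dart × Bool) : G.Dart × Bool :=
  if x.2 then (R.rot.symm x.1.symm, false) else (R.rot x.1.symm, true)

/-- The same traversal of an edge by the same zigzag, traced in the opposite direction. (If the
zigzag turns left from `d` into `d'`, then it turns right at the end of `d'`; traced backwards, it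
turns right at the end of the reversal of `d'`. So reversing the direction does not change the
kind of the turn that follows an edge.) -/
def zigzagRev (x : G.Dart × Bool) : G.Dart × Bool := (x.1.symm, x.2)

/-- Two states are equivalent if they lie on the same zigzag, the direction in which the zigzag is
traced being ignored. -/
def zigzagSetoid : Setoid (G.Dart × Bool) :=
  Relation.EqvGen.setoid fun x y => y = R.zigzagNext x ∨ y = zigzagRev x

/-- The (unoriented) zigzags. -/
def Zigzag : Type _ := Quotient R.zigzagSetoid

/-- The zigzag through a state. -/
def zigzagOf (x : G.Dart × Bool) : R.Zigzag := Quotient.mk R.zigzagSetoid x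

/-- The set of edges covered by a zigzag. -/
def Zigzag.edges {R : RotationSystem G} (Z : R.Zigzag) : Set (Sym2 V) :=
  {e | ∃ x : G.Dart × Bool, R.zigzagOf x = Z ∧ x.1.edge = e}

/-- A zigzag is simple if it has no self-intersection, that is, it traverses no edge twice (the
two states `x` and `zigzagRev x` describe the same traversal). -/
def Zigzag.IsSimple {R : RotationSystem G} (Z : R.Zigzag) : Prop :=
  ∀ x y : G.Dart × Bool, R.zigzagOf x = Z → R.zigzagOf y = Z → x.1.edge = y.1.edge →
    y = x ∨ y = zigzagRev x

/-! ### Symmetry -/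

/-- The automorphism `f` of the graph preserves the orientation of the sphere. -/
def PreservesOrientation (f : G ≃g G) : Prop :=
  ∀ d : G.Dart, f.toHom.mapDart (R.rot d) = R.rot (f.toHom.mapDart d)

/-- The automorphism `f` of the graph extends to an orientation-reversing map of the sphere. -/
def ReversesOrientation (f : G ≃g G) : Prop :=
  ∀ d : G.Dart, f.toHom.mapDart (R.rot d) = R.rot.symm (f.toHom.mapDart d)

/-- The automorphism `f` maps some vertex, edge or face to itself. Topologically: the map of the
sphere induced by `f` has a fixed point. -/
def FixesCell (f : G ≃g G) : Prop :=
  (∃ v, f v = v) ∨ (∃ e ∈ G.edgeSet, Sym2.map f e = e) ∨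
    ∃ F : R.Face, Sym2.map f '' F.edges = F.edges

/-- The plane graph has the point group `P` (a subgroup of `O(3)`) as its symmetry group: the
group of all automorphisms of the graph is identified with `P` in such a way that its
orientation-preserving elements are the rotations in `P`, its orientation-reversing elements are
the elements of determinant `-1` of `P`, and an automorphism fixes a point of the sphere iff the
isometry corresponding to it does. For skeletons of polyhedra this determines `P` up to
conjugation in `O(3)`. -/
def HasPointGroup (P : Subgroup (Matrix.orthogonalGroup (Fin 3) ℝ)) : Prop :=
  ∃ ρ : (G ≃g G) ≃* P, ∀ f : G ≃g G,
    (R.PreservesOrientation f ↔ (ρ f : Matrix (Fin 3) (Fin 3) ℝ).det = 1) ∧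
    (R.ReversesOrientation f ↔ (ρ f : Matrix (Fin 3) (Fin 3) ℝ).det = -1) ∧
    (R.FixesCell f ↔
      ∃ x : Fin 3 → ℝ, x ≠ 0 ∧ Matrix.mulVec (ρ f : Matrix (Fin 3) (Fin 3) ℝ) x = x)

end RotationSystem

/-! ### The point groups -/

namespace PointGroup

/-- The rotation of order two about the third coordinate axis. -/
def rotZ : Matrix.orthogonalGroup (Fin 3) ℝ :=
  ⟨!![-1, 0, 0; 0, -1, 0; 0, 0, 1], by
    rw [Matrix.mem_orthogonalGroup_iff]
    ext i j; fin_cases i <;> fin_cases j <;> simp [Matrix.mul_apply, Fin.sum_univ_three]⟩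

/-- The reflection in the plane spanned by the first and third coordinate axes, which contains
the axis of `rotZ`. -/
def mirror : Matrix.orthogonalGroup (Fin 3) ℝ :=
  ⟨!![1, 0, 0; 0, -1, 0; 0, 0, 1], by
    rw [Matrix.mem_orthogonalGroup_iff]
    ext i j; fin_cases i <;> fin_cases j <;> simp [Matrix.mul_apply, Fin.sum_univ_three]⟩

/-- The rotation by `π` about the first coordinate axis; it is orthogonal to the axis of `rotZ`
and contained in the plane of `mirror`. -/
def rotX : Matrix.orthogonalGroup (Fin 3) ℝ :=
  ⟨!![1, 0, 0; 0, -1, 0; 0, 0, -1], by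
    rw [Matrix.mem_orthogonalGroup_iff]
    ext i j; fin_cases i <;> fin_cases j <;> simp [Matrix.mul_apply, Fin.sum_univ_three]⟩

/-- The rotation by `π` about the line spanned by `(1, 1, 0)`; it is orthogonal to the axis of
`rotZ` and lies halfway between the two mirror planes of the group generated by `rotZ` and
`mirror`. -/
def rotXY : Matrix.orthogonalGroup (Fin 3) ℝ :=
  ⟨!![0, 1, 0; 1, 0, 0; 0, 0, -1], by
    rw [Matrix.mem_orthogonalGroup_iff]
    ext i j; fin_cases i <;> fin_cases j <;> simp [Matrix.mul_apply, Fin.sum_univ_three]⟩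

/-- The point group `D_{2h}`. -/
def D2h : Subgroup (Matrix.orthogonalGroup (Fin 3) ℝ) :=
  Subgroup.closure {rotZ, mirror, rotX}

/-- The point group `D_{2d}`. -/
def D2d : Subgroup (Matrix.orthogonalGroup (Fin 3) ℝ) :=
  Subgroup.closure {rotZ, mirror, rotXY}

/-- The vertices of a regular tetrahedron centred at the origin. -/
def tetrahedron : Set (Fin 3 → ℝ) :=
  {![1, 1, 1], ![1, -1, -1], ![-1, 1, -1], ![-1, -1, 1]}

/-- The point group `T_d`: the full symmetry group of the regular tetrahedron. -/
def Td : Subgroup (Matrix.orthogonalGroup (Fin 3) ℝ) where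
  carrier := {A | Matrix.mulVec (A : Matrix (Fin 3) (Fin 3) ℝ) '' tetrahedron = tetrahedron}
  one_mem' := by simp
  mul_mem' := by
    intro A B hA hB
    simp only [Set.mem_ofPred_eq] at *
    conv_rhs => rw [← hA, ← hB, Set.image_image]
    simp [Matrix.mulVec_mulVec]
  inv_mem' := by
    intro A hA
    simp only [Set.mem_ofPred_eq] at *
    conv_lhs => rw [← hA, Set.image_image]
    simp [Matrix.mulVec_mulVec]

end PointGroup

/-! Write h = 2m + 2. The fullerene is a capped tube made of 3m + 3 stacked rings. An inner ring has
twelve vertices, joined alternately to the ring above and to the ring below, so that two consecutive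
inner rings bound six hexagons. In an end ring six vertices would have their third edge pointing out
of the tube. Four of them are suppressed and the remaining two, which are opposite, are joined by a
chord. Each suppression turns a hexagon into a pentagon, and the chord cuts the remaining octagon
into two pentagons, so each cap has six pentagons. There are 8 + 12(3m + 1) + 8 = 18h - 8 vertices,
and counting faces by distinguished vertices (`card_face`) gives Euler's formula. For
3-connectedness (`linked_of_ne`): a ring minus one vertex is a path, and consecutive rings are
joined by six disjoint edges.

Positions are counted from a starting point that moves along with the layers. In these coordinates a
zigzag alternating between vertical and ring edges climbs between positions 3 and 4, crosses the top
chord, descends between 10 and 9 and closes through the bottom chord (`zigzagOf_eq_iff`). It is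
simple because vertical edges always precede one kind of turn and ring edges the other. A mirror
image of the tube carries it to a second zigzag, winding in the opposite sense. The two drift apart
by two positions per layer and share only vertical edges: both chords and, on each of the two
branches, one edge for every third layer in between, altogether 1 + (m + 1) + m = h (`common_edges`,
`exists_crossing`).

Each cap has a half-turn about the tube axis and two mirror planes. The top cap is the bottom one
turned over and twisted by 3m + 3 columns, where twelve columns make a full turn. Modulo half-turns
the twist is trivial for odd m, which gives D_2h, and a right angle for even m, which gives D_2d. To
see that there are no further automorphisms, consider the vertices on three pentagons. For m ≥ 1
there are two at each end, too far apart for the pairs to be mixed, so up to a known symmetry an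
automorphism fixes both bottom ones. It is then the identity or a mirror, because fixing a ring
forces fixing the next one (`eq_one_or_mirror`, `sym_surjective`). For m = 0 the four such vertices
behave like the vertices of a tetrahedron and all their permutations extend (`permAut_surjective`).

The isometries are explicit matrices. The elements without a fixed vector are the nontrivial rotary
reflections: exchange of the ends with a nonzero turn, respectively the 4-cycles. These are exactly
the automorphisms that fix no cell (`fixesCell_sym_iff`, `fixesCell_permAut_iff`). -/

namespace CappedTube

/-- A position is even if the vertical edge at it points upwards. -/
def isUp (y : ZMod 12) : Bool := y.val % 2 == 0

/-- The positions that occur in a layer; `b` and `t` tell whether the layer is the bottom or the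
top one. -/
def present (b t : Bool) (y : ZMod 12) : Bool :=
  !(b && (y == 1 || y == 5 || y == 7 || y == 11)) && !(t && (y == 0 || y == 2 || y == 6 || y == 8))

/-- Missing positions are never adjacent, so a step along the ring skips at most one of them. -/
def rightPos (b t : Bool) (y : ZMod 12) : ZMod 12 :=
  if present b t (y + 1) then y + 1 else y + 2

def leftPos (b t : Bool) (y : ZMod 12) : ZMod 12 :=
  if present b t (y - 1) then y - 1 else y - 2

/-- The starting point moves by one position per layer, hence `y - 1` one layer up and `y + 1` one
layer down. At the ends the edge is the chord of the cap: `y ↦ -y` exchanges 3 and 9, and `y ↦ 2 -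
y` exchanges 4 and 10. -/
def vertPos (b t : Bool) (y : ZMod 12) : ZMod 12 :=
  if isUp y then (if t then 2 - y else y - 1) else (if b then -y else y + 1)

/-- In the bottom layer the truncated difference `0 - 1 = 0` keeps the chord in its layer; at the
top this needs a case of its own. -/
def vertLayer (m j : ℕ) (y : ZMod 12) : ℕ :=
  if isUp y then (if j == 3 * m + 2 then j else j + 1) else j - 1

/-- The vertices of a tube with `3 * m + 3` layers, numbered from the bottom. All layers have
twelve vertices, except the bottom and the top one, which have eight. The positions in a layer are
counted from a starting point which moves by half a hexagon from each layer to the next. -/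
def Vertex (m : ℕ) : Type :=
  {p : ℕ × ZMod 12 // p.1 ≤ 3 * m + 2 ∧ present (p.1 == 0) (p.1 == 3 * m + 2) p.2 = true}

variable {m : ℕ}

instance : DecidableEq (Vertex m) :=
  inferInstanceAs (DecidableEq {p : ℕ × ZMod 12 // p.1 ≤ 3 * m + 2 ∧
    present (p.1 == 0) (p.1 == 3 * m + 2) p.2 = true})

/-! ### Vertices, their three neighbours and the cyclic order around them -/

namespace Vertex

def layer (v : Vertex m) : ℕ := v.1.1

def pos (v : Vertex m) : ZMod 12 := v.1.2

def bot (v : Vertex m) : Bool := v.layer == 0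

def top (v : Vertex m) : Bool := v.layer == 3 * m + 2

theorem layer_le (v : Vertex m) : v.layer ≤ 3 * m + 2 := v.2.1

theorem present_pos (v : Vertex m) : present v.bot v.top v.pos = true := v.2.2

theorem ext {v w : Vertex m} (h1 : v.layer = w.layer) (h2 : v.pos = w.pos) : v = w :=
  Subtype.ext (Prod.ext h1 h2)

theorem ext_iff {v w : Vertex m} : v = w ↔ v.layer = w.layer ∧ v.pos = w.pos :=
  ⟨fun h => h ▸ ⟨rfl, rfl⟩, fun h => ext h.1 h.2⟩

/-- Facts about positions are decided over all flags `b`, `t` and all of `ZMod 12`; this is the one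
constraint on the flags that such statements need. -/
theorem not_bot_top (v : Vertex m) : (v.bot && v.top) = false := by
  simp only [bot, top]
  by_cases h : v.layer = 0 <;> simp [h]

theorem present_rightPos : ∀ b t y, (b && t) = false → present b t y = true →
    present b t (rightPos b t y) = true := by decide

theorem present_leftPos : ∀ b t y, (b && t) = false → present b t y = true →
    present b t (leftPos b t y) = true := by decide

def right (v : Vertex m) : Vertex m :=
  ⟨(v.layer, rightPos v.bot v.top v.pos), v.layer_le,
    present_rightPos _ _ _ v.not_bot_top v.present_pos⟩

def left (v : Vertex m) : Vertex m :=
  ⟨(v.layer, leftPos v.bot v.top v.pos), v.layer_le,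
    present_leftPos _ _ _ v.not_bot_top v.present_pos⟩

theorem present_of_odd : ∀ t y, isUp y = false → present false t y = true := by decide

theorem present_of_isUp : ∀ b y, isUp y = true → present b false y = true := by decide

theorem isUp_sub_one : ∀ y, isUp (y - 1) = !isUp y := by decide

theorem isUp_add_one : ∀ y, isUp (y + 1) = !isUp y := by decide

theorem isUp_neg : ∀ y, isUp (-y) = isUp y := by decide

theorem isUp_two_sub : ∀ y, isUp (2 - y) = isUp y := by decide

theorem present_chord_top : ∀ b y, (b && true) = false → isUp y = true →
    present b true y = true → present b true (2 - y) = true := by decide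

theorem present_chord_bot : ∀ t y, (true && t) = false → isUp y = false →
    present true t y = true → present true t (-y) = true := by decide

theorem present_vert (v : Vertex m) :
    vertLayer m v.layer v.pos ≤ 3 * m + 2 ∧
      present (vertLayer m v.layer v.pos == 0) (vertLayer m v.layer v.pos == 3 * m + 2)
        (vertPos v.bot v.top v.pos) = true := by
  have h1 := v.present_pos
  have h2 := v.not_bot_top
  have h3 := v.layer_le
  unfold vertLayer vertPos
  cases hu : isUp v.pos
  · cases hb : v.bot
    · have hb' : v.layer ≠ 0 := by simpa [bot] using hb
      have : (v.layer - 1 == 3 * m + 2) = false := by simp; omega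
      simp only [Bool.false_eq_true, if_false, this]
      exact ⟨by omega, present_of_isUp _ _ (by simp [isUp_add_one, hu])⟩
    · have hb' : v.layer = 0 := by simpa [bot] using hb
      have e : (v.layer == 3 * m + 2) = v.top := rfl
      simp only [Bool.false_eq_true, if_false, if_true, hb']
      rw [hb] at h1 h2
      refine ⟨by omega, ?_⟩
      have e2 : (0 - 1 == 3 * m + 2) = v.top := by simp [top, hb']
      rw [e2]
      exact present_chord_bot _ _ h2 hu h1
  · cases ht : v.top
    · have ht' : v.layer ≠ 3 * m + 2 := by simpa [top] using ht
      have e : (v.layer == 3 * m + 2) = false := ht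
      simp only [Bool.false_eq_true, if_false, if_true, e]
      exact ⟨by omega, present_of_odd _ _ (by simp [isUp_sub_one, hu])⟩
    · have e : (v.layer == 3 * m + 2) = true := ht
      simp only [if_true, e]
      rw [ht] at h1 h2
      exact ⟨h3, present_chord_top _ _ h2 hu h1⟩

def vert (v : Vertex m) : Vertex m :=
  ⟨(vertLayer m v.layer v.pos, vertPos v.bot v.top v.pos), v.present_vert⟩

@[simp] theorem layer_right (v : Vertex m) : v.right.layer = v.layer := rfl
@[simp] theorem layer_left (v : Vertex m) : v.left.layer = v.layer := rfl
theorem pos_right (v : Vertex m) : v.right.pos = rightPos v.bot v.top v.pos := rfl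
theorem pos_left (v : Vertex m) : v.left.pos = leftPos v.bot v.top v.pos := rfl
@[simp] theorem bot_right (v : Vertex m) : v.right.bot = v.bot := rfl
@[simp] theorem bot_left (v : Vertex m) : v.left.bot = v.bot := rfl
@[simp] theorem top_right (v : Vertex m) : v.right.top = v.top := rfl
@[simp] theorem top_left (v : Vertex m) : v.left.top = v.top := rfl
theorem layer_vert (v : Vertex m) : v.vert.layer = vertLayer m v.layer v.pos := rfl
theorem pos_vert (v : Vertex m) : v.vert.pos = vertPos v.bot v.top v.pos := rfl

theorem bot_iff (v : Vertex m) : v.bot = true ↔ v.layer = 0 := by simp [bot]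
theorem top_iff (v : Vertex m) : v.top = true ↔ v.layer = 3 * m + 2 := by simp [top]

/-- The four kinds of vertices, according to the other end of the vertical edge. -/
theorem vert_cases (v : Vertex m) :
    (isUp v.pos = true ∧ v.top = false ∧ v.vert.layer = v.layer + 1 ∧ v.vert.pos = v.pos - 1 ∧
      v.vert.bot = false) ∨
    (isUp v.pos = false ∧ v.bot = false ∧ v.layer = v.vert.layer + 1 ∧ v.vert.pos = v.pos + 1 ∧
      v.vert.top = false) ∨
    (isUp v.pos = true ∧ v.top = true ∧ v.bot = false ∧ v.vert.layer = v.layer ∧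
      v.vert.pos = 2 - v.pos ∧ v.vert.bot = false ∧ v.vert.top = true ∧
      (v.pos = 4 ∨ v.pos = 10)) ∨
    (isUp v.pos = false ∧ v.bot = true ∧ v.top = false ∧ v.vert.layer = v.layer ∧
      v.vert.pos = - v.pos ∧ v.vert.bot = true ∧ v.vert.top = false ∧
      (v.pos = 3 ∨ v.pos = 9)) := by
  have h1 := v.present_pos
  have h2 := v.not_bot_top
  have h3 := v.layer_le
  have hv := v.vert.layer_le
  have e1 := v.layer_vert
  have e2 := v.pos_vert
  unfold vertLayer at e1
  unfold vertPos at e2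
  have T := v.top_iff
  have B := v.bot_iff
  have T' := v.vert.top_iff
  have B' := v.vert.bot_iff
  have k1 : ∀ y, isUp y = true → present false true y = true → (y = 4 ∨ y = 10) := by decide
  have k2 : ∀ y, isUp y = false → present true false y = true → (y = 3 ∨ y = 9) := by decide
  cases hu : isUp v.pos
  · cases hb : v.bot
    · right; left
      simp only [hu, hb, Bool.false_eq_true, if_false] at e1 e2
      have : v.layer ≠ 0 := fun h => by simp [B.2 h] at hb
      refine ⟨rfl, rfl, by omega, e2, ?_⟩
      rw [Bool.eq_false_iff]
      intro h
      have := T'.1 h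
      omega
    · right; right; right
      have ht : v.top = false := by simpa [hb] using h2
      simp only [hu, hb, Bool.false_eq_true, if_false, if_true] at e1 e2
      have h0 := B.1 hb
      have h4 : v.vert.layer = v.layer := by omega
      refine ⟨rfl, rfl, ht, h4, e2, ?_, ?_, ?_⟩
      · simp [bot, h4, h0]
      · simp [top, h4, h0]
      · rw [hb, ht] at h1; exact k2 _ hu h1
  · cases ht : v.top
    · left
      have e : (v.layer == 3 * m + 2) = false := ht
      simp only [hu, ht, e, Bool.false_eq_true, if_false, if_true] at e1 e2
      exact ⟨rfl, rfl, e1, e2, by simp [bot, e1]⟩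
    · right; right; left
      have hb : v.bot = false := by simpa [ht] using h2
      have e : (v.layer == 3 * m + 2) = true := ht
      simp only [hu, ht, e, if_true] at e1 e2
      refine ⟨rfl, rfl, hb, e1, e2, ?_, ?_, ?_⟩
      · simpa [bot, e1] using hb
      · simpa [top, e1] using ht
      · rw [hb, ht] at h1; exact k1 _ hu h1

theorem left_rightPos : ∀ b t y, (b && t) = false → present b t y = true →
    leftPos b t (rightPos b t y) = y := by decide

theorem right_leftPos : ∀ b t y, (b && t) = false → present b t y = true →
    rightPos b t (leftPos b t y) = y := by decide

theorem rightPos_ne : ∀ b t y, (b && t) = false → present b t y = true →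
    rightPos b t y ≠ y ∧ leftPos b t y ≠ y ∧ leftPos b t y ≠ rightPos b t y := by decide

@[simp] theorem left_right (v : Vertex m) : v.right.left = v :=
  ext rfl (left_rightPos _ _ _ v.not_bot_top v.present_pos)

@[simp] theorem right_left (v : Vertex m) : v.left.right = v :=
  ext rfl (right_leftPos _ _ _ v.not_bot_top v.present_pos)

@[simp] theorem vert_vert (v : Vertex m) : v.vert.vert = v := by
  rcases v.vert_cases with h | h | h | h <;> rcases v.vert.vert_cases with h' | h' | h' | h' <;>
    simp only [h, isUp_sub_one, isUp_add_one, isUp_neg, isUp_two_sub, Bool.not_true,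
      Bool.not_false, Bool.false_eq_true, reduceCtorEq, false_and, and_false, true_and] at h'
  · exact ext (by omega) (by rw [h'.2.1]; ring)
  · exact ext (by omega) (by rw [h'.2.1]; ring)
  · exact ext (by omega) (by rw [h'.2.1]; ring)
  · exact ext (by omega) (by rw [h'.2.1]; ring)

theorem right_ne (v : Vertex m) : v.right ≠ v := fun h =>
  (rightPos_ne _ _ _ v.not_bot_top v.present_pos).1 (congrArg pos h)

theorem left_ne (v : Vertex m) : v.left ≠ v := fun h =>
  (rightPos_ne _ _ _ v.not_bot_top v.present_pos).2.1 (congrArg pos h)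

theorem left_ne_right (v : Vertex m) : v.left ≠ v.right := fun h =>
  (rightPos_ne _ _ _ v.not_bot_top v.present_pos).2.2 (congrArg pos h)

theorem chord_ne_top : ∀ y : ZMod 12, y = 4 ∨ y = 10 →
    2 - y ≠ y ∧ 2 - y ≠ leftPos false true y ∧ 2 - y ≠ rightPos false true y := by decide

theorem chord_ne_bot : ∀ y : ZMod 12, y = 3 ∨ y = 9 →
    - y ≠ y ∧ -y ≠ leftPos true false y ∧ -y ≠ rightPos true false y := by decide

theorem vert_ne_all (v : Vertex m) : v.vert ≠ v ∧ v.vert ≠ v.left ∧ v.vert ≠ v.right := by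
  simp only [ne_eq, ext_iff, layer_left, layer_right, pos_left, pos_right]
  rcases v.vert_cases with h | h | ⟨-, h2, h3, h4, h5, -, -, h6⟩ | ⟨-, h3, h2, h4, h5, -, -, h6⟩
  · refine ⟨?_, ?_, ?_⟩ <;> omega
  · refine ⟨?_, ?_, ?_⟩ <;> omega
  · rw [h4, h5, h2, h3]; simpa using chord_ne_top _ h6
  · rw [h4, h5, h2, h3]; simpa using chord_ne_bot _ h6

theorem vert_ne (v : Vertex m) : v.vert ≠ v := v.vert_ne_all.1
theorem vert_ne_left (v : Vertex m) : v.vert ≠ v.left := v.vert_ne_all.2.1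
theorem vert_ne_right (v : Vertex m) : v.vert ≠ v.right := v.vert_ne_all.2.2

/-- The neighbour of `v` which follows the neighbour `w` in counterclockwise order. -/
def next (v w : Vertex m) : Vertex m :=
  if w = v.right then (if isUp v.pos then v.vert else v.left)
  else if w = v.left then (if isUp v.pos then v.right else v.vert)
  else (if isUp v.pos then v.left else v.right)

/-- The neighbour of `v` which follows the neighbour `w` in clockwise order. -/
def prev (v w : Vertex m) : Vertex m :=
  if w = v.right then (if isUp v.pos then v.left else v.vert)
  else if w = v.left then (if isUp v.pos then v.vert else v.right)
  else (if isUp v.pos then v.right else v.left)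

theorem next_right (v : Vertex m) : v.next v.right = if isUp v.pos then v.vert else v.left := by
  simp [next]
theorem next_left (v : Vertex m) : v.next v.left = if isUp v.pos then v.right else v.vert := by
  simp [next, v.left_ne_right]
theorem next_vert (v : Vertex m) : v.next v.vert = if isUp v.pos then v.left else v.right := by
  simp [next, v.vert_ne_left, v.vert_ne_right]
theorem prev_right (v : Vertex m) : v.prev v.right = if isUp v.pos then v.left else v.vert := by
  simp [prev]
theorem prev_left (v : Vertex m) : v.prev v.left = if isUp v.pos then v.vert else v.right := by
  simp [prev, v.left_ne_right]
theorem prev_vert (v : Vertex m) : v.prev v.vert = if isUp v.pos then v.right else v.left := by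
  simp [prev, v.vert_ne_left, v.vert_ne_right]

end Vertex

/-! ### The skeleton as a graph with a rotation system -/

open Vertex

/-- The skeleton: every vertex is joined to its left, its right and its vertical neighbour. -/
def graph (m : ℕ) : SimpleGraph (Vertex m) where
  Adj v w := w = v.left ∨ w = v.right ∨ w = v.vert
  symm := ⟨by rintro v w (rfl | rfl | rfl) <;> simp⟩
  loopless := ⟨by
    rintro v (h | h | h)
    · exact v.left_ne h.symm
    · exact v.right_ne h.symm
    · exact v.vert_ne h.symm⟩

theorem adj_iff {v w : Vertex m} : (graph m).Adj v w ↔ w = v.left ∨ w = v.right ∨ w = v.vert :=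
  Iff.rfl

theorem adj_left (v : Vertex m) : (graph m).Adj v v.left := Or.inl rfl
theorem adj_right (v : Vertex m) : (graph m).Adj v v.right := Or.inr (Or.inl rfl)
theorem adj_vert (v : Vertex m) : (graph m).Adj v v.vert := Or.inr (Or.inr rfl)

instance : DecidableRel (graph m).Adj := fun v w =>
  inferInstanceAs (Decidable (w = v.left ∨ w = v.right ∨ w = v.vert))

theorem adj_next {v w : Vertex m} (h : (graph m).Adj v w) :
    (graph m).Adj v (v.next w) ∧ v.prev (v.next w) = w := by
  rcases h with rfl | rfl | rfl
  · rw [next_left]; split_ifs with hu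
    · exact ⟨adj_right _, by simp [prev_right, hu]⟩
    · exact ⟨adj_vert _, by simp [prev_vert, hu]⟩
  · rw [next_right]; split_ifs with hu
    · exact ⟨adj_vert _, by simp [prev_vert, hu]⟩
    · exact ⟨adj_left _, by simp [prev_left, hu]⟩
  · rw [next_vert]; split_ifs with hu
    · exact ⟨adj_left _, by simp [prev_left, hu]⟩
    · exact ⟨adj_right _, by simp [prev_right, hu]⟩

theorem adj_prev {v w : Vertex m} (h : (graph m).Adj v w) :
    (graph m).Adj v (v.prev w) ∧ v.next (v.prev w) = w := by
  rcases h with rfl | rfl | rfl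
  · rw [prev_left]; split_ifs with hu
    · exact ⟨adj_vert _, by simp [next_vert, hu]⟩
    · exact ⟨adj_right _, by simp [next_right, hu]⟩
  · rw [prev_right]; split_ifs with hu
    · exact ⟨adj_left _, by simp [next_left, hu]⟩
    · exact ⟨adj_vert _, by simp [next_vert, hu]⟩
  · rw [prev_vert]; split_ifs with hu
    · exact ⟨adj_right _, by simp [next_right, hu]⟩
    · exact ⟨adj_left _, by simp [next_left, hu]⟩

/-- The dart from `v` to `w`. -/
def mkDart (v w : Vertex m) (h : (graph m).Adj v w) : (graph m).Dart := ⟨(v, w), h⟩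

theorem dart_eq_iff {d d' : (graph m).Dart} : d = d' ↔ d.fst = d'.fst ∧ d.snd = d'.snd := by
  rw [SimpleGraph.Dart.ext_iff, Prod.ext_iff]

def rotation (m : ℕ) : RotationSystem (graph m) where
  rot :=
    { toFun := fun d => ⟨(d.fst, d.fst.next d.snd), (adj_next d.adj).1⟩
      invFun := fun d => ⟨(d.fst, d.fst.prev d.snd), (adj_prev d.adj).1⟩
      left_inv := fun d => dart_eq_iff.2 ⟨rfl, (adj_next d.adj).2⟩
      right_inv := fun d => dart_eq_iff.2 ⟨rfl, (adj_prev d.adj).2⟩ }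
  rot_fst _ := rfl
  rot_cyclic := by
    rintro ⟨⟨v, w⟩, h⟩ ⟨⟨v', w'⟩, h'⟩ (rfl : v = v')
    set rot : Equiv.Perm (graph m).Dart :=
      { toFun := fun d => ⟨(d.fst, d.fst.next d.snd), (adj_next d.adj).1⟩
        invFun := fun d => ⟨(d.fst, d.fst.prev d.snd), (adj_prev d.adj).1⟩
        left_inv := fun d => dart_eq_iff.2 ⟨rfl, (adj_next d.adj).2⟩
        right_inv := fun d => dart_eq_iff.2 ⟨rfl, (adj_prev d.adj).2⟩ } with hrot
    have step : ∀ (a b : Vertex m) (ha : (graph m).Adj v a) (hb : (graph m).Adj v b),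
        v.next a = b → rot.SameCycle ⟨(v, a), ha⟩ ⟨(v, b), hb⟩ := fun a b ha hb e =>
      ⟨1, dart_eq_iff.2 ⟨rfl, e⟩⟩
    have key : ∀ (a : Vertex m) (ha : (graph m).Adj v a),
        rot.SameCycle ⟨(v, v.left), adj_left v⟩ ⟨(v, a), ha⟩ := by
      rintro a (rfl | rfl | rfl)
      · exact Equiv.Perm.SameCycle.refl _ _
      · cases hu : isUp v.pos
        · exact (step _ _ _ _ (by simp [next_right, hu])).symm
        · exact step _ _ _ _ (by simp [next_left, hu])
      · cases hu : isUp v.pos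
        · exact step _ _ _ _ (by simp [next_left, hu])
        · exact (step _ _ _ _ (by simp [next_vert, hu])).symm
    exact (key w h).symm.trans (key w' h')

end CappedTube

/-! ### Lengths of cycles of a permutation -/

theorem Equiv.Perm.ncard_setOf_sameCycle {α : Type*} [DecidableEq α] (f : Equiv.Perm α) (x : α)
    (h : 0 < Function.minimalPeriod f x) :
    {y | f.SameCycle y x}.ncard = Function.minimalPeriod f x := by
  have e : {y | f.SameCycle y x} =
      ((Finset.range (Function.minimalPeriod f x)).image (fun i => f^[i] x) : Finset α) := by
    ext y
    simp only [Set.mem_ofPred_eq, Finset.coe_image, Finset.coe_range, Set.mem_image, Set.mem_Iio]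
    constructor
    · rintro hy
      obtain ⟨i, hi⟩ := hy.symm
      have hp := Function.isPeriodicPt_minimalPeriod f x
      have h1 : ∀ k : ℤ, (f ^ ((Function.minimalPeriod f x : ℤ) * k)) x = x := by
        intro k
        rw [zpow_mul, zpow_natCast]
        have : (f ^ Function.minimalPeriod f x) x = x := by
          rw [← Equiv.Perm.iterate_eq_pow]; exact hp
        exact Function.IsFixedPt.perm_zpow this k
      have hpos : (0 : ℤ) < Function.minimalPeriod f x := by exact_mod_cast h
      refine ⟨(i % (Function.minimalPeriod f x : ℤ)).toNat, ?_, ?_⟩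
      · have := Int.emod_lt_of_pos i hpos
        have := Int.emod_nonneg i hpos.ne'
        omega
      · rw [Equiv.Perm.iterate_eq_pow, ← zpow_natCast, Int.toNat_of_nonneg
          (Int.emod_nonneg i hpos.ne'), ← hi]
        conv_rhs => rw [← Int.emod_add_mul_ediv i (Function.minimalPeriod f x), zpow_add,
          Equiv.Perm.mul_apply, h1]
    · rintro ⟨i, -, rfl⟩
      rw [Equiv.Perm.iterate_eq_pow]
      exact Equiv.Perm.SameCycle.symm ⟨i, by simp⟩
  rw [e, Set.ncard_coe_finset, Finset.card_image_of_injOn, Finset.card_range]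
  simpa using Function.iterate_injOn_Iio_minimalPeriod

theorem Function.minimalPeriod_eq_five {α : Type*} {f : α → α} {x : α} (h : f (f (f (f (f x)))) = x)
    (h1 : f x ≠ x) : Function.minimalPeriod f x = 5 := by
  have h5 : Function.IsPeriodicPt f 5 x := h
  rcases (Nat.dvd_prime Nat.prime_five).1 h5.minimalPeriod_dvd with h | h
  · exact absurd (Function.minimalPeriod_eq_one_iff_isFixedPt.1 h) h1
  · exact h

/-- Every proper divisor of six divides two or three, so two inequalities exclude a shorter period.
-/
theorem Function.minimalPeriod_eq_six {α : Type*} {f : α → α} {x : α}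
    (h : f (f (f (f (f (f x))))) = x) (h2 : f (f x) ≠ x) (h3 : f (f (f x)) ≠ x) :
    Function.minimalPeriod f x = 6 := by
  have h6 : Function.IsPeriodicPt f 6 x := h
  have hd := h6.minimalPeriod_dvd
  have hle := Nat.le_of_dvd (by norm_num) hd
  have n2 : ¬ Function.minimalPeriod f x ∣ 2 := fun h =>
    h2 ((Function.isPeriodicPt_iff_minimalPeriod_dvd (f := f)).2 h)
  have n3 : ¬ Function.minimalPeriod f x ∣ 3 := fun h =>
    h3 ((Function.isPeriodicPt_iff_minimalPeriod_dvd (f := f)).2 h)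
  interval_cases Function.minimalPeriod f x <;> simp_all

/-! ### The faces: labels, base vertices and lengths -/

namespace CappedTube

variable {m : ℕ}

open Vertex

def dartL (v : Vertex m) : (graph m).Dart := mkDart v v.left (adj_left v)
def dartR (v : Vertex m) : (graph m).Dart := mkDart v v.right (adj_right v)
def dartV (v : Vertex m) : (graph m).Dart := mkDart v v.vert (adj_vert v)

theorem dart_cases (d : (graph m).Dart) : ∃ v, d = dartL v ∨ d = dartR v ∨ d = dartV v := by
  obtain ⟨⟨v, w⟩, h⟩ := d
  refine ⟨v, ?_⟩
  obtain h | h | h := adj_iff.1 h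
  exacts [Or.inl (dart_eq_iff.2 ⟨rfl, h⟩), Or.inr (Or.inl (dart_eq_iff.2 ⟨rfl, h⟩)),
    Or.inr (Or.inr (dart_eq_iff.2 ⟨rfl, h⟩))]

theorem faceNext_dartL (v : Vertex m) :
    (rotation m).faceNext (dartL v) = if isUp v.left.pos then dartL v.left else dartV v.left := by
  have h : v.left.prev v = if isUp v.left.pos then v.left.left else v.left.vert := by
    rw [← prev_right, right_left]
  split_ifs at h ⊢ <;> exact dart_eq_iff.2 ⟨rfl, h⟩

theorem faceNext_dartR (v : Vertex m) :
    (rotation m).faceNext (dartR v) =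
      if isUp v.right.pos then dartV v.right else dartR v.right := by
  have h : v.right.prev v = if isUp v.right.pos then v.right.vert else v.right.right := by
    rw [← prev_left, left_right]
  split_ifs at h ⊢ <;> exact dart_eq_iff.2 ⟨rfl, h⟩

theorem faceNext_dartV (v : Vertex m) :
    (rotation m).faceNext (dartV v) = if isUp v.vert.pos then dartR v.vert else dartL v.vert := by
  have h : v.vert.prev v = if isUp v.vert.pos then v.vert.right else v.vert.left := by
    rw [← prev_vert, vert_vert]
  split_ifs at h ⊢ <;> exact dart_eq_iff.2 ⟨rfl, h⟩

/-- A face between two layers is named after the upward edge on its right-hand side. A face bounded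
by a chord is named after the end from which the chord has it to its left: in the bottom ring the
leftward path 9, 8, 6, 4, 3 closes up the face to the left of the chord from 3 to 9. `rightLabelPos`
treats the top ring in the same way. -/
def leftLabelPos (b : Bool) (y : ZMod 12) : ZMod 12 :=
  if b then (if y == 9 || y == 8 || y == 6 || y == 4 then 3 else 9)
  else if isUp y then y + 2 else y + 1

def rightLabelPos (t : Bool) (y : ZMod 12) : ZMod 12 :=
  if t then (if y == 4 || y == 5 || y == 7 || y == 9 then 10 else 4)
  else if isUp y then y + 2 else y + 1

/-- A leftward dart has its face below it. In the bottom layer `0 - 1 = 0` is the intended value,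
since the faces of the bottom chord carry labels in layer 0. -/
def labelLeft (v : Vertex m) : ℕ × ZMod 12 := (v.layer - 1, leftLabelPos v.bot v.pos)

def labelRight (v : Vertex m) : ℕ × ZMod 12 := (v.layer, rightLabelPos v.top v.pos)

def labelVert (v : Vertex m) : ℕ × ZMod 12 :=
  if isUp v.pos || v.bot then (v.layer, v.pos) else (v.layer - 1, v.pos + 3)

/-- The label of the face to the left of a dart: the layer and the position of a vertex from which
a vertical edge runs along that face. -/
def label (d : (graph m).Dart) : ℕ × ZMod 12 :=
  if d.snd = d.fst.right then labelRight d.fst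
  else if d.snd = d.fst.left then labelLeft d.fst else labelVert d.fst

@[simp] theorem label_dartL (v : Vertex m) : label (dartL v) = labelLeft v := by
  simp [label, dartL, mkDart, v.left_ne_right]
@[simp] theorem label_dartR (v : Vertex m) : label (dartR v) = labelRight v := by
  simp [label, dartR, mkDart]
@[simp] theorem label_dartV (v : Vertex m) : label (dartV v) = labelVert v := by
  simp [label, dartV, mkDart, v.vert_ne_left, v.vert_ne_right]

theorem leftLabelPos_left : ∀ b t y, (b && t) = false → present b t y = true →
    leftLabelPos b y = if isUp (leftPos b t y) then leftLabelPos b (leftPos b t y)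
      else if b then leftPos b t y else leftPos b t y + 3 := by decide

theorem rightLabelPos_right : ∀ b t y, (b && t) = false → present b t y = true →
    rightLabelPos t y = if isUp (rightPos b t y) then rightPos b t y
      else rightLabelPos t (rightPos b t y) := by decide

/-- The label is thus an invariant of faces. As it recovers the base vertex, and every face has a
base vertex (`exists_base`), it separates faces and reduces their enumeration to that of base
vertices. -/
theorem label_faceNext (d : (graph m).Dart) : label ((rotation m).faceNext d) = label d := by
  obtain ⟨v, rfl | rfl | rfl⟩ := dart_cases d
  · have key := leftLabelPos_left _ _ _ v.not_bot_top v.present_pos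
    rw [← pos_left] at key
    rw [faceNext_dartL, label_dartL, labelLeft, key]
    by_cases hu : isUp v.left.pos = true
    · rw [if_pos hu, if_pos hu]
      exact label_dartL _
    · rw [if_neg hu, if_neg hu, label_dartV, labelVert]
      by_cases hb : v.bot = true
      · rw [if_pos hb, if_pos (by simp [hb]), layer_left, v.bot_iff.1 hb]
      · rw [if_neg hb, if_neg (by simpa [hb] using hu), layer_left]
  · have key := rightLabelPos_right _ _ _ v.not_bot_top v.present_pos
    rw [← pos_right] at key
    rw [faceNext_dartR, label_dartR, labelRight, key]
    by_cases hu : isUp v.right.pos = true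
    · rw [if_pos hu, if_pos hu, label_dartV, labelVert, if_pos (by simp [hu]), layer_right]
    · rw [if_neg hu, if_neg hu]
      exact label_dartR _
  · rw [faceNext_dartV, apply_ite label]
    simp only [label_dartL, label_dartR, label_dartV, labelRight, labelLeft, labelVert]
    rcases v.vert_cases with h | h | ⟨h1, h2, h3, h4, h5, h6, h7, h8⟩ |
        ⟨h1, h2, h3, h4, h5, h6, h7, h8⟩
    · simp [h, isUp_sub_one, leftLabelPos]
    · simp [h, isUp_add_one, rightLabelPos]
      ring
    · simp only [h1, h4, h5, h7, isUp_two_sub]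
      rcases h8 with h | h <;> rw [h] <;> simp <;> decide
    · simp only [h1, h2, h4, h5, h6, isUp_neg]
      have := v.bot_iff.1 h2
      rcases h8 with h | h <;> rw [h, this] <;> simp <;> decide

/-- The vertices from which a vertical edge is drawn as the base of the face to its left. -/
def IsBase (v : Vertex m) : Prop := (isUp v.pos || v.bot && (v.pos == 3 || v.pos == 9)) = true

theorem label_base {v : Vertex m} (h : IsBase v) : label (dartV v) = (v.layer, v.pos) := by
  rw [label_dartV, labelVert]
  unfold IsBase at h
  rw [if_pos]
  revert h
  cases isUp v.pos <;> simp +contextual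

theorem isBase_of_isUp {v : Vertex m} (h : isUp v.pos = true) : IsBase v := by
  simp [IsBase, h]

theorem isBase_of_bot {v : Vertex m} (h : isUp v.pos = false) (hb : v.bot = true) : IsBase v := by
  have : ∀ t y, isUp y = false → present true t y = true → (y == 3 || y == 9) = true := by decide
  have h2 := v.present_pos
  rw [hb] at h2
  simp [IsBase, hb, this _ _ h h2]

theorem sameCycle_faceNext (d : (graph m).Dart) :
    (rotation m).faceNext.SameCycle d ((rotation m).faceNext d) := ⟨1, by simp⟩

theorem sameCycle_dartR_of_isUp {v : Vertex m} (h : isUp v.right.pos = true) :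
    (rotation m).faceNext.SameCycle (dartR v) (dartV v.right) := by
  have := sameCycle_faceNext (dartR v); rwa [faceNext_dartR, if_pos h] at this

theorem sameCycle_dartR_of_not_isUp {v : Vertex m} (h : isUp v.right.pos ≠ true) :
    (rotation m).faceNext.SameCycle (dartR v) (dartR v.right) := by
  have := sameCycle_faceNext (dartR v); rwa [faceNext_dartR, if_neg h] at this

theorem sameCycle_dartL_of_isUp {v : Vertex m} (h : isUp v.left.pos = true) :
    (rotation m).faceNext.SameCycle (dartL v) (dartL v.left) := by
  have := sameCycle_faceNext (dartL v); rwa [faceNext_dartL, if_pos h] at this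

theorem sameCycle_dartL_of_not_isUp {v : Vertex m} (h : isUp v.left.pos ≠ true) :
    (rotation m).faceNext.SameCycle (dartL v) (dartV v.left) := by
  have := sameCycle_faceNext (dartL v); rwa [faceNext_dartL, if_neg h] at this

/-- Walking to the right along the ring, the boundary leaves it at the first upward vertex. This is
reached after at most four steps: in the top ring three consecutive vertices, such as 5, 7, 9, point
downwards. -/
theorem exists_base_dartR (v : Vertex m) :
    ∃ w, IsBase w ∧ (rotation m).faceNext.SameCycle (dartR v) (dartV w) := by
  by_cases h1 : isUp v.right.pos = true
  · exact ⟨_, isBase_of_isUp h1, sameCycle_dartR_of_isUp h1⟩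
  have s1 := sameCycle_dartR_of_not_isUp h1
  by_cases h2 : isUp v.right.right.pos = true
  · exact ⟨_, isBase_of_isUp h2, s1.trans (sameCycle_dartR_of_isUp h2)⟩
  have s2 := s1.trans (sameCycle_dartR_of_not_isUp h2)
  by_cases h3 : isUp v.right.right.right.pos = true
  · exact ⟨_, isBase_of_isUp h3, s2.trans (sameCycle_dartR_of_isUp h3)⟩
  have s3 := s2.trans (sameCycle_dartR_of_not_isUp h3)
  by_cases h4 : isUp v.right.right.right.right.pos = true
  · exact ⟨_, isBase_of_isUp h4, s3.trans (sameCycle_dartR_of_isUp h4)⟩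
  exfalso
  have : ∀ b t y, (b && t) = false → present b t y = true →
      (isUp (rightPos b t y) || isUp (rightPos b t (rightPos b t y)) ||
      isUp (rightPos b t (rightPos b t (rightPos b t y))) ||
      isUp (rightPos b t (rightPos b t (rightPos b t (rightPos b t y))))) = true := by decide
  have := this _ _ _ v.not_bot_top v.present_pos
  simp only [pos_right, bot_right, top_right] at h1 h2 h3 h4
  simp [h1, h2, h3, h4] at this

theorem exists_base_dartV (v : Vertex m) :
    ∃ w, IsBase w ∧ (rotation m).faceNext.SameCycle (dartV v) (dartV w) := by
  cases hu : isUp v.pos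
  · cases hb : v.bot
    · obtain ⟨w, hw, hs⟩ := exists_base_dartR v.vert
      refine ⟨w, hw, Equiv.Perm.SameCycle.trans ?_ hs⟩
      have := sameCycle_faceNext (dartV v)
      rcases v.vert_cases with h | h | h | h <;>
        [simp [hu] at h; skip; simp [hu] at h; simp [hb] at h]
      rwa [faceNext_dartV, if_pos (by rw [h.2.2.2.1, isUp_add_one, hu]; rfl)] at this
    · exact ⟨v, isBase_of_bot hu hb, Equiv.Perm.SameCycle.refl _ _⟩
  · exact ⟨v, isBase_of_isUp hu, Equiv.Perm.SameCycle.refl _ _⟩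

theorem exists_base_dartL (v : Vertex m) :
    ∃ w, IsBase w ∧ (rotation m).faceNext.SameCycle (dartL v) (dartV w) := by
  have fin : ∀ w : Vertex m, (rotation m).faceNext.SameCycle (dartL v) (dartV w) →
      ∃ w, IsBase w ∧ (rotation m).faceNext.SameCycle (dartL v) (dartV w) := fun w hw => by
    obtain ⟨u, hu, hs⟩ := exists_base_dartV w
    exact ⟨u, hu, hw.trans hs⟩
  by_cases h1 : isUp v.left.pos ≠ true
  · exact fin _ (sameCycle_dartL_of_not_isUp h1)
  rw [not_not] at h1
  have s1 := sameCycle_dartL_of_isUp h1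
  by_cases h2 : isUp v.left.left.pos ≠ true
  · exact fin _ (s1.trans (sameCycle_dartL_of_not_isUp h2))
  rw [not_not] at h2
  have s2 := s1.trans (sameCycle_dartL_of_isUp h2)
  by_cases h3 : isUp v.left.left.left.pos ≠ true
  · exact fin _ (s2.trans (sameCycle_dartL_of_not_isUp h3))
  rw [not_not] at h3
  have s3 := s2.trans (sameCycle_dartL_of_isUp h3)
  by_cases h4 : isUp v.left.left.left.left.pos ≠ true
  · exact fin _ (s3.trans (sameCycle_dartL_of_not_isUp h4))
  rw [not_not] at h4
  exfalso
  have : ∀ b t y, (b && t) = false → present b t y = true →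
      (isUp (leftPos b t y) && isUp (leftPos b t (leftPos b t y)) &&
      isUp (leftPos b t (leftPos b t (leftPos b t y))) &&
      isUp (leftPos b t (leftPos b t (leftPos b t (leftPos b t y))))) = false := by decide
  have := this _ _ _ v.not_bot_top v.present_pos
  simp only [pos_left, bot_left, top_left] at h1 h2 h3 h4
  simp [h1, h2, h3, h4] at this

theorem exists_base (d : (graph m).Dart) :
    ∃ w, IsBase w ∧ (rotation m).faceNext.SameCycle d (dartV w) := by
  obtain ⟨v, rfl | rfl | rfl⟩ := dart_cases d
  exacts [exists_base_dartL v, exists_base_dartR v, exists_base_dartV v]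

theorem faceOf_eq_iff_sameCycle {d d' : (graph m).Dart} :
    (rotation m).faceOf d = (rotation m).faceOf d' ↔ (rotation m).faceNext.SameCycle d d' :=
  Quotient.eq (r := Equiv.Perm.SameCycle.setoid (rotation m).faceNext)

theorem label_eq_of_sameCycle {d d' : (graph m).Dart}
    (h : (rotation m).faceNext.SameCycle d d') : label d = label d' := by
  obtain ⟨i, rfl⟩ := h
  have nat : ∀ (n : ℕ) (d : (graph m).Dart), label (((rotation m).faceNext ^ n) d) = label d := by
    intro n
    induction n with
    | zero => simp
    | succ n ih => intro d; rw [pow_succ', Equiv.Perm.mul_apply, label_faceNext, ih]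
  obtain ⟨n, rfl | rfl⟩ := i.eq_nat_or_neg
  · simp [nat]
  · rw [← nat n (((rotation m).faceNext ^ (-(n : ℤ))) d)]
    simp

theorem label_eq_of_faceOf_eq {d d' : (graph m).Dart}
    (h : (rotation m).faceOf d = (rotation m).faceOf d') : label d = label d' :=
  label_eq_of_sameCycle (faceOf_eq_iff_sameCycle.1 h)

theorem exists_faceOf_base (F : (rotation m).Face) :
    ∃ w, IsBase w ∧ (rotation m).faceOf (dartV w) = F := by
  obtain ⟨d, rfl⟩ := Quotient.exists_rep F
  obtain ⟨w, hw, hs⟩ := exists_base d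
  exact ⟨w, hw, faceOf_eq_iff_sameCycle.2 hs.symm⟩

/-- The faces correspond to the base vertices. -/
theorem card_face : Nat.card (rotation m).Face = Nat.card {v : Vertex m // IsBase v} := by
  symm
  refine Nat.card_eq_of_bijective (fun w => (rotation m).faceOf (dartV w.1)) ⟨?_, ?_⟩
  · rintro ⟨v, hv⟩ ⟨w, hw⟩ h
    have := label_eq_of_faceOf_eq h
    rw [label_base hv, label_base hw, Prod.mk.injEq] at this
    exact Subtype.ext (Vertex.ext this.1 this.2)
  · intro F
    obtain ⟨w, hw, h⟩ := exists_faceOf_base F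
    exact ⟨⟨w, hw⟩, h⟩

theorem faceOf_eq_iff_label {d d' : (graph m).Dart} :
    (rotation m).faceOf d = (rotation m).faceOf d' ↔ label d = label d' := by
  refine ⟨label_eq_of_faceOf_eq, fun h => ?_⟩
  obtain ⟨v, hv, hs⟩ := exists_base d
  obtain ⟨w, hw, hs'⟩ := exists_base d'
  have e : v = w := by
    rw [label_eq_of_sameCycle hs, label_eq_of_sameCycle hs', label_base hv, label_base hw,
      Prod.mk.injEq] at h
    exact Vertex.ext h.1 h.2
  rw [faceOf_eq_iff_sameCycle]
  exact hs.trans (e ▸ hs'.symm)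

theorem sides_eq_minimalPeriod (d : (graph m).Dart)
    (h : 0 < Function.minimalPeriod (rotation m).faceNext d) :
    ((rotation m).faceOf d).sides = Function.minimalPeriod (rotation m).faceNext d := by
  rw [← Equiv.Perm.ncard_setOf_sameCycle _ _ h]
  unfold RotationSystem.Face.sides
  congr 1
  ext d'
  exact faceOf_eq_iff_sameCycle

theorem dart_ne_of_fst {d d' : (graph m).Dart} (h : d.fst ≠ d'.fst) : d ≠ d' :=
  fun e => h (e ▸ rfl)

/-- The boundary goes up from the base, left along the upper layer, down, and right along the lower
layer. Only the middle vertex of either horizontal path can be missing: the upper one in the top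
layer, the lower one in the bottom layer. -/
theorem sides_base_up {w : Vertex m} (hu : isUp w.pos = true) (ht : w.top = false) :
    ((rotation m).faceOf (dartV w)).sides = 5 ∨ ((rotation m).faceOf (dartV w)).sides = 6 := by
  set f := (rotation m).faceNext with hf
  rcases w.vert_cases with h | h | h | h <;> simp only [hu, ht] at h <;>
    simp only [Bool.true_eq_false, Bool.false_eq_true, false_and, and_false,
      true_and] at h
  obtain ⟨h1, h2, h3⟩ := h
  have s1 : f (dartV w) = dartL w.vert := by
    rw [hf, faceNext_dartV, if_neg (by rw [h2, isUp_sub_one, hu]; simp)]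
  have hne : dartL w.vert ≠ dartV w := dart_ne_of_fst w.vert_ne
  have p0 := w.present_pos
  have p1 := w.vert.present_pos
  have hT := w.vert.top_iff
  have hB := w.bot_iff
  rw [h3] at p1
  rw [ht] at p0
  have key : ∀ y, isUp y = true → present false w.vert.top (y - 1) = true →
      leftPos false w.vert.top (y - 1) =
        (if present false w.vert.top (y - 2) then y - 2 else y - 3) ∧
      leftPos false w.vert.top (y - 2) = y - 3 ∧ isUp (y - 2) = true ∧ isUp (y - 3) = false ∧
      rightPos w.bot false (y - 2) =
        (if present w.bot false (y - 1) then y - 1 else y) ∧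
      rightPos w.bot false (y - 1) = y := by
    generalize w.vert.top = t
    generalize w.bot = b
    revert b t; decide
  obtain ⟨k1, k2, k3, k4, k5, k6⟩ := key _ hu (h2 ▸ p1)
  -- the part of the boundary in the upper layer
  have upper : ∃ u : Vertex m, u.layer = w.layer + 1 ∧ u.pos = w.pos - 3 ∧
      (present false w.vert.top (w.pos - 2) = true → f (f (dartL w.vert)) = dartV u ∧
        f (dartL w.vert) = dartL u.right) ∧
      (present false w.vert.top (w.pos - 2) = false → f (dartL w.vert) = dartV u) := by
    by_cases hp : present false w.vert.top (w.pos - 2) = true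
    · refine ⟨w.vert.left.left, by simp [h1], ?_, fun _ => ?_, fun h => by simp [hp] at h⟩
      · rw [pos_left, pos_left, h2, bot_left, top_left, h3, k1, if_pos hp, k2]
      · have e : f (dartL w.vert) = dartL w.vert.left := by
          rw [hf, faceNext_dartL, if_pos (by rw [pos_left, h2, h3, k1, if_pos hp, k3])]
        refine ⟨?_, by rw [e, right_left]⟩
        rw [e, hf, faceNext_dartL, if_neg]
        rw [pos_left, pos_left, h2, bot_left, top_left, h3, k1, if_pos hp, k2, k4]; simp
    · refine ⟨w.vert.left, by simp [h1], ?_, fun h => absurd h hp, fun _ => ?_⟩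
      · rw [pos_left, h2, h3, k1, if_neg hp]
      · rw [hf, faceNext_dartL, if_neg (by rw [pos_left, h2, h3, k1, if_neg hp, k4]; simp)]
  obtain ⟨u, hu1, hu2, hu3, hu4⟩ := upper
  have hx : u.vert.layer = w.layer ∧ u.vert.pos = w.pos - 2 := by
    rcases u.vert_cases with h | h | h | h
    · rw [hu2, k4] at h; simp at h
    · exact ⟨by omega, by rw [h.2.2.2.1, hu2]; ring⟩
    · rw [hu2, k4] at h; simp at h
    · have := u.bot_iff.1 h.2.1; omega
  have xb : u.vert.bot = w.bot := by simp [bot, hx.1]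
  have xt : u.vert.top = false := by rw [← ht]; simp [top, hx.1]
  have s3 : f (dartV u) = dartR u.vert := by
    rw [hf, faceNext_dartV, if_pos (by rw [hx.2, k3])]
  have lower : (present w.bot false (w.pos - 1) = true → f (f (dartR u.vert)) = dartV w) ∧
      (present w.bot false (w.pos - 1) = false → f (dartR u.vert) = dartV w) := by
    constructor
    · intro hp
      have e : f (dartR u.vert) = dartR u.vert.right := by
        rw [hf, faceNext_dartR, if_neg]
        rw [pos_right, hx.2, xb, xt, k5, if_pos hp, isUp_sub_one, hu]; simp
      have e2 : u.vert.right.right = w := by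
        refine Vertex.ext (by simp [hx.1]) ?_
        rw [pos_right, pos_right, bot_right, top_right, hx.2, xb, xt, k5, if_pos hp, k6]
      rw [e, hf, faceNext_dartR, e2, if_pos hu]
    · intro hp
      have e2 : u.vert.right = w := by
        refine Vertex.ext (by simp [hx.1]) ?_
        rw [pos_right, hx.2, xb, xt, k5, hp]; simp
      rw [hf, faceNext_dartR, e2, if_pos hu]
  have lay : u ≠ w := fun e => by rw [e] at hu1; omega
  have lay' : u.right ≠ w := fun e => by
    have := congrArg layer e; rw [layer_right, hu1] at this; omega
  cases hp : present false w.vert.top (w.pos - 2) <;>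
    cases hq : present w.bot false (w.pos - 1)
  -- Two missing vertices would make the face touch both caps, but the layer above the bottom is
  -- never the top layer `3 * m + 2`.
  · exfalso
    have a1 : w.vert.top = true := by
      by_contra h; rw [Bool.not_eq_true] at h; rw [h] at hp; revert hp
      generalize w.pos = y; revert y; decide
    have a2 : w.bot = true := by
      by_contra h; rw [Bool.not_eq_true] at h; rw [h] at hq; revert hq
      generalize w.pos = y; revert y; decide
    have := hT.1 a1; have := hB.1 a2; omega
  · left
    have mp : Function.minimalPeriod f (dartV w) = 5 :=
      Function.minimalPeriod_eq_five (by rw [s1, hu4 hp, s3, lower.1 hq]) (by rw [s1]; exact hne)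
    rw [sides_eq_minimalPeriod _ (by rw [← hf, mp]; norm_num), ← hf, mp]
  · left
    have mp : Function.minimalPeriod f (dartV w) = 5 :=
      Function.minimalPeriod_eq_five (by rw [s1, (hu3 hp).1, s3, lower.2 hq])
        (by rw [s1]; exact hne)
    rw [sides_eq_minimalPeriod _ (by rw [← hf, mp]; norm_num), ← hf, mp]
  · right
    have mp : Function.minimalPeriod f (dartV w) = 6 :=
      Function.minimalPeriod_eq_six (by rw [s1, (hu3 hp).1, s3, lower.1 hq])
        (by rw [s1, (hu3 hp).2]; exact dart_ne_of_fst lay')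
        (by rw [s1, (hu3 hp).1]; exact dart_ne_of_fst lay)
    rw [sides_eq_minimalPeriod _ (by rw [← hf, mp]; norm_num), ← hf, mp]

/-- The boundary consists of the chord and four ring edges: the three vertices between the ends of
the chord point downwards, so the walk does not leave the ring. -/
theorem sides_base_top {w : Vertex m} (hu : isUp w.pos = true) (ht : w.top = true) :
    ((rotation m).faceOf (dartV w)).sides = 5 := by
  set f := (rotation m).faceNext with hf
  rcases w.vert_cases with h | h | ⟨-, -, hb, h1, h2, h3, h4, h5⟩ | h <;>
    [simp [ht] at h; simp [hu] at h; skip; simp [hu] at h]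
  have e1 : w.vert.right.right.right.right = w := by
    refine Vertex.ext (by simp [h1]) ?_
    simp only [pos_right, bot_right, top_right, h2, h3, h4]
    rcases h5 with h | h <;> rw [h] <;> decide
  have n1 : isUp w.vert.right.pos = false := by
    simp only [pos_right, h2, h3, h4]
    rcases h5 with h | h <;> rw [h] <;> decide
  have n2 : isUp w.vert.right.right.pos = false := by
    simp only [pos_right, bot_right, top_right, h2, h3, h4]
    rcases h5 with h | h <;> rw [h] <;> decide
  have n3 : isUp w.vert.right.right.right.pos = false := by
    simp only [pos_right, bot_right, top_right, h2, h3, h4]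
    rcases h5 with h | h <;> rw [h] <;> decide
  have s1 : f (dartV w) = dartR w.vert := by
    rw [hf, faceNext_dartV, if_pos (by rw [h2, isUp_two_sub, hu])]
  have mp : Function.minimalPeriod f (dartV w) = 5 := by
    refine Function.minimalPeriod_eq_five ?_ (by rw [s1]; exact dart_ne_of_fst w.vert_ne)
    rw [s1, hf, faceNext_dartR, n1]
    simp only [Bool.false_eq_true, if_false]
    rw [faceNext_dartR, n2]
    simp only [Bool.false_eq_true, if_false]
    rw [faceNext_dartR, n3]
    simp only [Bool.false_eq_true, if_false]
    rw [faceNext_dartR, e1, if_pos hu]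
  rw [sides_eq_minimalPeriod _ (by rw [← hf, mp]; norm_num), ← hf, mp]

theorem sides_base_bot {w : Vertex m} (hu : isUp w.pos = false) (hb : w.bot = true) :
    ((rotation m).faceOf (dartV w)).sides = 5 := by
  set f := (rotation m).faceNext with hf
  rcases w.vert_cases with h | h | h | ⟨-, -, hb, h1, h2, h3, h4, h5⟩ <;>
    [simp [hu] at h; simp [hb] at h; simp [hu] at h; skip]
  have e1 : w.vert.left.left.left.left = w := by
    refine Vertex.ext (by simp [h1]) ?_
    simp only [pos_left, bot_left, top_left, h2, h3, h4]
    rcases h5 with h | h <;> rw [h] <;> decide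
  have n1 : isUp w.vert.left.pos = true := by
    simp only [pos_left, h2, h3, h4]
    rcases h5 with h | h <;> rw [h] <;> decide
  have n2 : isUp w.vert.left.left.pos = true := by
    simp only [pos_left, bot_left, top_left, h2, h3, h4]
    rcases h5 with h | h <;> rw [h] <;> decide
  have n3 : isUp w.vert.left.left.left.pos = true := by
    simp only [pos_left, bot_left, top_left, h2, h3, h4]
    rcases h5 with h | h <;> rw [h] <;> decide
  have s1 : f (dartV w) = dartL w.vert := by
    rw [hf, faceNext_dartV, if_neg (by rw [h2, isUp_neg, hu]; simp)]
  have mp : Function.minimalPeriod f (dartV w) = 5 := by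
    refine Function.minimalPeriod_eq_five ?_ (by rw [s1]; exact dart_ne_of_fst w.vert_ne)
    rw [s1, hf, faceNext_dartL, if_pos n1, faceNext_dartL, if_pos n2, faceNext_dartL, if_pos n3,
      faceNext_dartL, e1, if_neg (by simp [hu])]
  rw [sides_eq_minimalPeriod _ (by rw [← hf, mp]; norm_num), ← hf, mp]

theorem sides_eq (F : (rotation m).Face) : F.sides = 5 ∨ F.sides = 6 := by
  obtain ⟨w, hw, rfl⟩ := exists_faceOf_base F
  cases hu : isUp w.pos
  · have hb : w.bot = true := by
      unfold IsBase at hw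
      rw [hu] at hw
      simp only [Bool.false_or, Bool.and_eq_true] at hw
      exact hw.1
    exact Or.inl (sides_base_bot hu hb)
  · cases ht : w.top
    · exact sides_base_up hu ht
    · exact Or.inl (sides_base_top hu ht)

end CappedTube

namespace CappedTube

variable {m : ℕ}

open Vertex

/-! ### Counting -/

/-- The vertices with a given property of the kind of layer and of the position. -/
def equivSigma (m : ℕ) (p : Bool → Bool → ZMod 12 → Bool) :
    {v : Vertex m // p v.bot v.top v.pos = true} ≃
      Σ j : Fin (3 * m + 3), {y : ZMod 12 // (present (j.1 == 0) (j.1 == 3 * m + 2) y &&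
        p (j.1 == 0) (j.1 == 3 * m + 2) y) = true} where
  toFun v := ⟨⟨v.1.layer, by have := v.1.layer_le; omega⟩, v.1.pos, by
    rw [Bool.and_eq_true]; exact ⟨v.1.present_pos, v.2⟩⟩
  invFun x := ⟨⟨(x.1.1, x.2.1), by have := x.1.2; simp only; omega,
    (Bool.and_eq_true_iff.1 x.2.2).1⟩, (Bool.and_eq_true_iff.1 x.2.2).2⟩
  left_inv _ := rfl
  right_inv _ := rfl

theorem card_subtype (m : ℕ) (p : Bool → Bool → ZMod 12 → Bool) (a b c : ℕ)
    (ha : Nat.card {y : ZMod 12 // (present true false y && p true false y) = true} = a)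
    (hb : Nat.card {y : ZMod 12 // (present false false y && p false false y) = true} = b)
    (hc : Nat.card {y : ZMod 12 // (present false true y && p false true y) = true} = c) :
    Nat.card {v : Vertex m // p v.bot v.top v.pos = true} = a + (3 * m + 1) * b + c := by
  rw [Nat.card_congr (equivSigma m p), Nat.card_sigma, Fin.sum_univ_succ, Fin.sum_univ_castSucc]
  have e1 : (0 == 3 * m + 2) = false := by simp
  have e2 : (3 * m + 1 + 1 == 3 * m + 2) = true := by simp
  have e3 : (3 * m + 1 + 1 == 0) = false := by simp
  have e4 : ∀ x : Fin (3 * m + 1), (x.castSucc.1 + 1 == 0) = false ∧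
      (x.castSucc.1 + 1 == 3 * m + 2) = false := by
    intro x
    have := x.2
    constructor
    · simp
    · simp only [Fin.val_castSucc, beq_eq_false_iff_ne]; omega
  simp only [e4, Fin.val_zero, e1, Fin.val_succ, Fin.val_last, e2, e3, beq_self_eq_true]
  rw [ha, hb, hc, Finset.sum_const, Finset.card_univ, Fintype.card_fin, smul_eq_mul]
  ring

instance : Finite (Vertex m) :=
  Finite.of_injective (fun v : Vertex m => ((⟨v.layer, by have := v.layer_le; omega⟩, v.pos) :
    Fin (3 * m + 3) × ZMod 12)) fun v w h => by
      simp only [Prod.mk.injEq, Fin.mk.injEq] at h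
      exact Vertex.ext h.1 h.2

theorem card_vertex (m : ℕ) : Nat.card (Vertex m) = 36 * m + 28 := by
  have h := card_subtype m (fun _ _ _ => true) 8 12 8 (by rw [Nat.card_eq_fintype_card]; decide)
    (by rw [Nat.card_eq_fintype_card]; decide) (by rw [Nat.card_eq_fintype_card]; decide)
  rw [Nat.card_congr (Equiv.subtypeUnivEquiv fun _ => rfl)] at h
  rw [h]; ring

theorem card_isBase (m : ℕ) : Nat.card {v : Vertex m // IsBase v} = 18 * m + 16 := by
  -- Six upward vertices per layer; the bottom layer has the two chord ends in addition, while in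
  -- the top layer only the two chord ends are upward.
  have h := card_subtype m (fun b _ y => isUp y || b && (y == 3 || y == 9)) 8 6 2
    (by rw [Nat.card_eq_fintype_card]; decide)
    (by rw [Nat.card_eq_fintype_card]; decide) (by rw [Nat.card_eq_fintype_card]; decide)
  unfold IsBase
  rw [h]; ring

theorem neighborSet_eq (v : Vertex m) :
    (graph m).neighborSet v = (({v.left, v.right, v.vert} : Finset (Vertex m)) : Set _) := by
  ext w
  simp [adj_iff]

theorem card_neighbors (v : Vertex m) :
    ({v.left, v.right, v.vert} : Finset (Vertex m)).card = 3 :=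
  Finset.card_eq_three.2
    ⟨_, _, _, v.left_ne_right, v.vert_ne_left.symm, v.vert_ne_right.symm, rfl⟩

theorem ncard_neighborSet (v : Vertex m) : ((graph m).neighborSet v).ncard = 3 := by
  rw [neighborSet_eq, Set.ncard_coe_finset, card_neighbors]

theorem ncard_edgeSet (m : ℕ) : 2 * (graph m).edgeSet.ncard = 3 * Nat.card (Vertex m) := by
  classical
  have := Fintype.ofFinite (Vertex m)
  have h := (graph m).sum_degrees_eq_twice_card_edges
  have hd : ∀ v, (graph m).degree v = 3 := fun v => by
    rw [← ncard_neighborSet v, ← SimpleGraph.card_neighborSet_eq_degree, ← Nat.card_eq_fintype_card]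
    rfl
  simp only [hd, Finset.sum_const, Finset.card_univ, smul_eq_mul] at h
  rw [Nat.card_eq_fintype_card, ← SimpleGraph.coe_edgeFinset, Set.ncard_coe_finset]
  omega

/-! ### Connectivity -/

/-- The vertex with a given layer and position. -/
def mkVertex (m j : ℕ) (y : ZMod 12) (hj : j ≤ 3 * m + 2)
    (hy : present (j == 0) (j == 3 * m + 2) y = true) : Vertex m := ⟨(j, y), hj, hy⟩

theorem exists_up (j : ℕ) (hj : j < 3 * m + 2) (y : ZMod 12) (hy : isUp y = true) :
    ∃ u : Vertex m, u.layer = j ∧ u.pos = y ∧ u.top = false := by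
  have e : (j == 3 * m + 2) = false := by simp; omega
  exact ⟨mkVertex m j y hj.le (by rw [e]; exact present_of_isUp _ _ hy), rfl, rfl, e⟩

theorem vert_of_up {v : Vertex m} (hu : isUp v.pos = true) (ht : v.layer < 3 * m + 2) :
    v.vert.layer = v.layer + 1 ∧ v.vert.pos = v.pos - 1 := by
  have := v.top_iff
  rcases v.vert_cases with h | h | h | h
  · exact ⟨h.2.2.1, h.2.2.2.1⟩
  · simp [hu] at h
  · have := this.1 h.2.1; omega
  · simp [hu] at h

theorem vert_of_down {v : Vertex m} (hu : isUp v.pos = false) (hb : v.layer ≠ 0) :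
    v.vert.layer + 1 = v.layer ∧ v.vert.pos = v.pos + 1 := by
  have := v.bot_iff
  rcases v.vert_cases with h | h | h | h
  · simp [hu] at h
  · exact ⟨h.2.2.1.symm, h.2.2.2.1⟩
  · simp [hu] at h
  · exact absurd (this.1 h.2.1) hb

theorem pos_iterate_right (v : Vertex m) (i : ℕ) :
    (right^[i] v).layer = v.layer ∧ (right^[i] v).pos = (rightPos v.bot v.top)^[i] v.pos := by
  induction i with
  | zero => exact ⟨rfl, rfl⟩
  | succ n ih =>
    rw [Function.iterate_succ_apply', Function.iterate_succ_apply', layer_right, pos_right, ih.2]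
    have hb : (right^[n] v).bot = v.bot := by simp [bot, ih.1]
    have ht : (right^[n] v).top = v.top := by simp [top, ih.1]
    exact ⟨ih.1, by rw [hb, ht]⟩

theorem exists_iterate_rightPos_eq_three : ∀ b t y, (b && t) = false → present b t y = true →
    ∃ i : Fin 12, (rightPos b t)^[i.1] y = 3 := by decide

theorem exists_iterate_rightPos_three : ∀ b t y, (b && t) = false → present b t y = true →
    ∃ i : Fin 12, (rightPos b t)^[i.1] 3 = y := by decide

theorem exists_iterate_right {v w : Vertex m} (h : v.layer = w.layer) :
    ∃ i : ℕ, right^[i] v = w := by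
  obtain ⟨i, hi⟩ := exists_iterate_rightPos_eq_three _ _ _ v.not_bot_top v.present_pos
  have hb : v.bot = w.bot := by simp [bot, h]
  have ht : v.top = w.top := by simp [top, h]
  obtain ⟨k, hk⟩ := exists_iterate_rightPos_three _ _ _ w.not_bot_top w.present_pos
  refine ⟨k.1 + i.1, Vertex.ext ?_ ?_⟩
  · rw [(pos_iterate_right _ _).1, h]
  · rw [(pos_iterate_right _ _).2, Function.iterate_add_apply, hi, hb, ht, hk]

section Linked

variable {D : Vertex m → Prop} {r : Vertex m → Vertex m → Prop}

/-- A cycle with at most one vertex deleted stays connected. Stating this for an arbitrary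
equivalence relation `r` lets the same argument serve the whole graph and the induced subgraphs. -/
theorem linked_ring (hr : Equivalence r)
    (hadj : ∀ a b, (graph m).Adj a b → ¬ D a → ¬ D b → r a b) (x : Vertex m)
    (hx : ∀ v : Vertex m, v.layer = x.layer → D v → v = x)
    {v w : Vertex m} (hv : v.layer = x.layer) (hw : w.layer = x.layer) (hDv : ¬ D v) (hDw : ¬ D w) :
    r v w := by
  have key : ∀ w : Vertex m, w.layer = x.layer → ¬ D w → r x.right w := by
    intro w hw hDw
    by_cases hwx : w = x
    · subst hwx
      refine hadj _ _ (adj_right _).symm (fun h => ?_) hDw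
      exact w.right_ne (hx _ rfl h)
    · classical
      have hex := exists_iterate_right hw.symm
      set i := Nat.find hex with hi
      have hiw : right^[i] x = w := Nat.find_spec hex
      have hne : ∀ n, 0 < n → n ≤ i → ¬ D (right^[n] x) := by
        intro n hn hni hD
        -- A deleted vertex on the way could only be `x` itself; having come back to `x`, the walk
        -- would have met `w` earlier, against the minimality of `i`.
        have e := hx _ (pos_iterate_right _ _).1 hD
        refine Nat.find_min hex (m := i - n) (by omega) ?_
        rw [← hiw]
        conv_rhs => rw [show i = (i - n) + n by omega, Function.iterate_add_apply, e]
      have hi0 : i ≠ 0 := fun h => hwx (by rw [← hiw, h]; rfl)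
      have : ∀ n, n + 1 ≤ i → r x.right (right^[n + 1] x) := by
        intro n
        induction n with
        | zero => intro _; exact hr.refl _
        | succ n ih =>
          intro hn
          refine hr.trans (ih (by omega)) ?_
          have h1 := hne (n + 1) (by omega) (by omega)
          have h2 := hne (n + 1 + 1) (by omega) hn
          rw [Function.iterate_succ_apply' _ (n + 1)] at h2 ⊢
          exact hadj _ _ (adj_right _) h1 h2
      have := this (i - 1) (by omega)
      rwa [show i - 1 + 1 = i by omega, hiw] at this
  exact hr.trans (hr.symm (key v hv hDv)) (key w hw hDw)

/-- Two positions meet at most two of the six disjoint pairs `y, y + 1` with `y` even. -/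
theorem exists_position_avoiding : ∀ a b : ZMod 12, ∃ y, isUp y = true ∧ y ≠ a ∧ y ≠ b ∧
    y + 1 ≠ a ∧ y + 1 ≠ b := by decide

/-- Six disjoint vertical edges join consecutive layers and two deleted vertices destroy at most two
of them, so connectedness passes from single rings to a block of layers. -/
theorem linked_layers (hr : Equivalence r)
    (hadj : ∀ a b, (graph m).Adj a b → ¬ D a → ¬ D b → r a b) (p q : Vertex m)
    (hD : ∀ v, D v → v = p ∨ v = q) (lo hi : ℕ)
    (hring : ∀ v w : Vertex m, v.layer = w.layer → lo ≤ v.layer → v.layer ≤ hi → ¬ D v → ¬ D w →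
      r v w) {v w : Vertex m}
    (hv : lo ≤ v.layer ∧ v.layer ≤ hi) (hw : lo ≤ w.layer ∧ w.layer ≤ hi)
    (hDv : ¬ D v) (hDw : ¬ D w) : r v w := by
  have step : ∀ n, lo ≤ n → n + 1 ≤ hi → n < 3 * m + 2 →
      ∃ u : Vertex m, u.layer = n ∧ u.vert.layer = n + 1 ∧ ¬ D u ∧ ¬ D u.vert := by
    intro n _ _ hn
    -- A deleted vertex in layer `n` excludes its own position; one in layer `n + 1` excludes the
    -- lower end of its vertical edge, at `pos + 1`.
    obtain ⟨y, hy, h1, h2, -⟩ := exists_position_avoiding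
      (if p.layer = n then p.pos else p.pos + 1) (if q.layer = n then q.pos else q.pos + 1)
    obtain ⟨u, rfl, rfl, -⟩ := exists_up n hn y hy
    have hV := vert_of_up hy hn
    refine ⟨u, rfl, hV.1, fun hd => ?_, fun hd => ?_⟩
    · rcases hD _ hd with h | h
      · rw [← h, if_pos rfl] at h1; exact h1 rfl
      · rw [← h, if_pos rfl] at h2; exact h2 rfl
    · rcases hD _ hd with h | h
      · rw [← h, if_neg (by omega), hV.2] at h1; exact h1 (by ring)
      · rw [← h, if_neg (by omega), hV.2] at h2; exact h2 (by ring)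
  have all : ∀ n, n ≤ hi → ∀ v w : Vertex m, lo ≤ v.layer → v.layer ≤ n → lo ≤ w.layer →
      w.layer ≤ n → ¬ D v → ¬ D w → r v w := by
    intro n
    induction n with
    | zero =>
      intro _ v w h1 h2 h3 h4 h5 h6
      exact hring v w (by omega) h1 (by omega) h5 h6
    | succ n ih =>
      intro hn v w h1 h2 h3 h4 h5 h6
      have down : ∀ v : Vertex m, lo ≤ v.layer → v.layer ≤ n + 1 → lo ≤ n → ¬ D v →
          ∃ u : Vertex m, lo ≤ u.layer ∧ u.layer ≤ n ∧ ¬ D u ∧ r v u := by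
        intro v h1 h2 hlo hd
        by_cases hvn : v.layer ≤ n
        · exact ⟨v, h1, hvn, hd, hr.refl _⟩
        · have := v.layer_le
          obtain ⟨u, hu1, hu2, hu3, hu4⟩ := step n hlo hn (by omega)
          refine ⟨u, by omega, by omega, hu3, hr.trans
            (hring v u.vert (by omega) h1 (by omega) hd hu4) ?_⟩
          exact hadj _ _ (adj_vert u).symm hu4 hu3
      by_cases hlo : lo ≤ n
      · obtain ⟨u, a1, a2, a3, a4⟩ := down v h1 h2 hlo h5
        obtain ⟨u', b1, b2, b3, b4⟩ := down w h3 h4 hlo h6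
        exact hr.trans a4 (hr.trans (ih (by omega) u u' a1 a2 b1 b2 a3 b3) (hr.symm b4))
      · exact hring v w (by omega) h1 (by omega) h5 h6
  exact all hi le_rfl v w hv.1 hv.2 hw.1 hw.2 hDv hDw

theorem chord_neighbors_bot : ∀ y : ZMod 12, y = 3 ∨ y = 9 →
    isUp (leftPos true false y) = true ∧ isUp (rightPos true false y) = true ∧
    leftPos true false (-y) ≠ leftPos true false y ∧
    leftPos true false (-y) ≠ rightPos true false y := by decide

theorem chord_neighbors_top : ∀ y : ZMod 12, y = 4 ∨ y = 10 →
    isUp (leftPos false true y) = false ∧ isUp (rightPos false true y) = false ∧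
    leftPos false true (2 - y) ≠ leftPos false true y ∧
    leftPos false true (2 - y) ≠ rightPos false true y := by decide

/-- Deleting at most two vertices does not disconnect the graph. -/
theorem linked_of_ne (hr : Equivalence r)
    (hadj : ∀ a b, (graph m).Adj a b → ¬ D a → ¬ D b → r a b) (p q : Vertex m)
    (hD : ∀ v, D v → v = p ∨ v = q) {v w : Vertex m} (hDv : ¬ D v) (hDw : ¬ D w) : r v w := by
  have ring_of_not : ∀ v w : Vertex m, v.layer = w.layer → v.layer ≠ p.layer → v.layer ≠ q.layer →
      r v w := by
    intro v w h h1 h2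
    have hn : ∀ u : Vertex m, u.layer = v.layer → ¬ D u := by
      intro u hu hd
      rcases hD u hd with rfl | rfl <;> omega
    exact linked_ring hr hadj v (fun u hu hd => absurd hd (hn u hu)) rfl h.symm (hn v rfl)
      (hn w h.symm)
  -- If both deleted vertices lie in one layer, its ring may fall apart, but the layers below and
  -- those above are intact blocks. It remains to attach the rest of that layer and to join the
  -- blocks.
  by_cases hpq : p.layer = q.layer
  · have hne : ∀ u : Vertex m, u.layer ≠ p.layer → ¬ D u := by
      intro u hu hd
      rcases hD u hd with rfl | rfl <;> omega
    have below : ∀ v w : Vertex m, v.layer < p.layer → w.layer < p.layer → r v w := by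
      intro v w hv hw
      exact linked_layers hr hadj p q hD 0 (p.layer - 1)
        (fun v w h _ h2 _ _ => ring_of_not v w h (by omega) (by omega))
        ⟨by omega, by omega⟩ ⟨by omega, by omega⟩ (hne v (by omega)) (hne w (by omega))
    have above : ∀ v w : Vertex m, p.layer < v.layer → p.layer < w.layer → r v w := by
      intro v w hv hw
      exact linked_layers hr hadj p q hD (p.layer + 1) (3 * m + 2)
        (fun v w h _ h2 _ _ => ring_of_not v w h (by omega) (by omega))
        ⟨by omega, v.layer_le⟩ ⟨by omega, w.layer_le⟩ (hne v (by omega)) (hne w (by omega))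
    have pl := p.layer_le
    have eT : ∀ v : Vertex m, v.layer = p.layer → v.top = p.top := fun v h => by simp [top, h]
    have eB : ∀ v : Vertex m, v.layer = p.layer → v.bot = p.bot := fun v h => by simp [bot, h]
    by_cases hp0 : p.layer = 0
    · have hb : p.bot = true := p.bot_iff.2 hp0
      -- A remaining vertex of the bottom ring escapes upwards by its own edge or, if it is a chord
      -- end, through a neighbour in the ring; if both of these are deleted, it escapes across the
      -- chord.
      have hub : ∀ v : Vertex m, ¬ D v → ∃ u : Vertex m, p.layer < u.layer ∧ r v u := by
        intro v hd
        by_cases hv : p.layer < v.layer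
        · exact ⟨v, hv, hr.refl _⟩
        have hv0 : v.layer = p.layer := by omega
        have up : ∀ v : Vertex m, v.layer = p.layer → isUp v.pos = true → ¬ D v →
            ∃ u : Vertex m, p.layer < u.layer ∧ r v u := by
          intro v hv0 hu hd
          have := vert_of_up hu (by omega)
          exact ⟨v.vert, by omega, hadj _ _ (adj_vert v) hd (hne _ (by omega))⟩
        rcases v.vert_cases with h | h | h | ⟨-, h2, h3, h4, h5, h6, h7, h8⟩
        · exact up v hv0 h.1 hd
        · rw [eB v hv0, hb] at h; simp at h
        · rw [eB v hv0, hb] at h; simp at h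
        have C := chord_neighbors_bot _ h8
        have hl : isUp v.left.pos = true := by rw [pos_left, h2, h3]; exact C.1
        have hr' : isUp v.right.pos = true := by rw [pos_right, h2, h3]; exact C.2.1
        by_cases dl : D v.left
        · by_cases dr : D v.right
          · have dv : ∀ u, D u → u = v.left ∨ u = v.right := by
              intro u hu
              rcases hD _ dl with h | h <;> rcases hD _ dr with h' | h'
              · exact absurd (h.trans h'.symm) v.left_ne_right
              · rw [h, h']; exact hD u hu
              · rw [h, h']; exact (hD u hu).symm
              · exact absurd (h.trans h'.symm) v.left_ne_right
            have d1 : ¬ D v.vert := fun h => (dv _ h).elim v.vert_ne_left v.vert_ne_right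
            have d2 : ¬ D v.vert.left := by
              intro h
              rcases dv _ h with e | e
              · have := congrArg pos e
                rw [pos_left, pos_left, h2, h3, h5, h6, h7] at this
                exact C.2.2.1 this
              · have := congrArg pos e
                rw [pos_left, pos_right, h2, h3, h5, h6, h7] at this
                exact C.2.2.2 this
            have hu : isUp v.vert.left.pos = true := by
              rw [pos_left, h5, h6, h7]
              exact (chord_neighbors_bot _ (by
                rcases h8 with h | h <;> rw [h] <;> decide)).1
            obtain ⟨u, hu1, hu2⟩ := up v.vert.left (by simp; omega) hu d2
            exact ⟨u, hu1, hr.trans (hadj _ _ (adj_vert v) hd d1)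
              (hr.trans (hadj _ _ (adj_left _) d1 d2) hu2)⟩
          · obtain ⟨u, hu1, hu2⟩ := up v.right hv0 hr' dr
            exact ⟨u, hu1, hr.trans (hadj _ _ (adj_right v) hd dr) hu2⟩
        · obtain ⟨u, hu1, hu2⟩ := up v.left hv0 hl dl
          exact ⟨u, hu1, hr.trans (hadj _ _ (adj_left v) hd dl) hu2⟩
      obtain ⟨u, a1, a2⟩ := hub v hDv
      obtain ⟨u', b1, b2⟩ := hub w hDw
      exact hr.trans a2 (hr.trans (above u u' a1 b1) (hr.symm b2))
    by_cases hpt : p.layer = 3 * m + 2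
    · have ht : p.top = true := p.top_iff.2 hpt
      have hub : ∀ v : Vertex m, ¬ D v → ∃ u : Vertex m, u.layer < p.layer ∧ r v u := by
        intro v hd
        have := v.layer_le
        by_cases hv : v.layer < p.layer
        · exact ⟨v, hv, hr.refl _⟩
        have hv0 : v.layer = p.layer := by omega
        have down : ∀ v : Vertex m, v.layer = p.layer → isUp v.pos = false → ¬ D v →
            ∃ u : Vertex m, u.layer < p.layer ∧ r v u := by
          intro v hv0 hu hd
          have := vert_of_down hu (by omega)
          exact ⟨v.vert, by omega, hadj _ _ (adj_vert v) hd (hne _ (by omega))⟩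
        rcases v.vert_cases with h | h | ⟨-, h2, h3, h4, h5, h6, h7, h8⟩ | h
        · rw [eT v hv0, ht] at h; simp at h
        · exact down v hv0 h.1 hd
        · have C := chord_neighbors_top _ h8
          have hl : isUp v.left.pos = false := by rw [pos_left, h2, h3]; exact C.1
          have hr' : isUp v.right.pos = false := by rw [pos_right, h2, h3]; exact C.2.1
          by_cases dl : D v.left
          · by_cases dr : D v.right
            · have dv : ∀ u, D u → u = v.left ∨ u = v.right := by
                intro u hu
                rcases hD _ dl with h | h <;> rcases hD _ dr with h' | h'
                · exact absurd (h.trans h'.symm) v.left_ne_right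
                · rw [h, h']; exact hD u hu
                · rw [h, h']; exact (hD u hu).symm
                · exact absurd (h.trans h'.symm) v.left_ne_right
              have d1 : ¬ D v.vert := fun h => (dv _ h).elim v.vert_ne_left v.vert_ne_right
              have d2 : ¬ D v.vert.left := by
                intro h
                rcases dv _ h with e | e
                · have := congrArg pos e
                  rw [pos_left, pos_left, h2, h3, h5, h6, h7] at this
                  exact C.2.2.1 this
                · have := congrArg pos e
                  rw [pos_left, pos_right, h2, h3, h5, h6, h7] at this
                  exact C.2.2.2 this
              have hu : isUp v.vert.left.pos = false := by
                rw [pos_left, h5, h6, h7]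
                exact (chord_neighbors_top _ (by
                  rcases h8 with h | h <;> rw [h] <;> decide)).1
              obtain ⟨u, hu1, hu2⟩ := down v.vert.left (by simp; omega) hu d2
              exact ⟨u, hu1, hr.trans (hadj _ _ (adj_vert v) hd d1)
                (hr.trans (hadj _ _ (adj_left _) d1 d2) hu2)⟩
            · obtain ⟨u, hu1, hu2⟩ := down v.right hv0 hr' dr
              exact ⟨u, hu1, hr.trans (hadj _ _ (adj_right v) hd dr) hu2⟩
          · obtain ⟨u, hu1, hu2⟩ := down v.left hv0 hl dl
            exact ⟨u, hu1, hr.trans (hadj _ _ (adj_left v) hd dl) hu2⟩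
        · rw [eT v hv0, ht] at h; simp at h
      obtain ⟨u, a1, a2⟩ := hub v hDv
      obtain ⟨u', b1, b2⟩ := hub w hDw
      exact hr.trans a2 (hr.trans (below u u' a1 b1) (hr.symm b2))
    · -- a pair of neighbours in the layer joins the two sides
      obtain ⟨y, hy, h1, h2, h3, h4⟩ := exists_position_avoiding p.pos q.pos
      obtain ⟨u, hul, rfl, hut⟩ := exists_up (m := m) p.layer (by omega) y hy
      have hub' : u.bot = false := by
        rw [Bool.eq_false_iff]; intro h; have := u.bot_iff.1 h; omega
      have hur : u.right.pos = u.pos + 1 := by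
        rw [pos_right, hub', hut]; rfl
      have d1 : ¬ D u := fun h => by
        rcases hD _ h with e | e
        · exact h1 (by rw [e])
        · exact h2 (by rw [e])
      have d2 : ¬ D u.right := fun h => by
        rcases hD _ h with e | e
        · exact h3 (by rw [← hur, e])
        · exact h4 (by rw [← hur, e])
      have V1 := vert_of_up (v := u) hy (by omega)
      have V2 := vert_of_down (v := u.right) (by rw [hur, isUp_add_one, hy]; rfl) (by simp; omega)
      rw [layer_right] at V2
      have d3 : ¬ D u.vert := hne _ (by omega)
      have d4 : ¬ D u.right.vert := hne _ (by omega)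
      have hub : ∀ v : Vertex m, ¬ D v → r v u.vert := by
        have h0 : ∀ v : Vertex m, v.layer ≠ p.layer → r v u.vert := by
          intro v hv
          by_cases hlt : v.layer < p.layer
          · exact hr.trans (below v u.right.vert hlt (by omega))
              (hr.trans (hadj _ _ (adj_vert _).symm d4 d2)
                (hr.trans (hadj _ _ (adj_right _).symm d2 d1) (hadj _ _ (adj_vert _) d1 d3)))
          · exact above v _ (by omega) (by omega)
        intro v hd
        by_cases hv : v.layer = p.layer
        · cases hu : isUp v.pos
          · have := vert_of_down hu (by omega)
            exact hr.trans (hadj _ _ (adj_vert v) hd (hne _ (by omega))) (h0 _ (by omega))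
          · have := vert_of_up hu (by omega)
            exact hr.trans (hadj _ _ (adj_vert v) hd (hne _ (by omega))) (h0 _ (by omega))
        · exact h0 v hv
      exact hr.trans (hub v hDv) (hr.symm (hub w hDw))
  -- With the deleted vertices in different layers, every ring loses at most one vertex.
  · refine linked_layers hr hadj p q hD 0 (3 * m + 2) ?_ ⟨by omega, v.layer_le⟩
      ⟨by omega, w.layer_le⟩ hDv hDw
    intro v w h _ _ hv hw
    by_cases h1 : v.layer = p.layer
    · refine linked_ring hr hadj p (fun u hu hd => ?_) h1 (by omega) hv hw
      rcases hD u hd with e | e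
      · exact e
      · rw [e] at hu; omega
    · by_cases h2 : v.layer = q.layer
      · refine linked_ring hr hadj q (fun u hu hd => ?_) h2 (by omega) hv hw
        rcases hD u hd with e | e
        · rw [e] at hu; omega
        · exact e
      · exact ring_of_not v w h h1 h2

end Linked

instance : Nonempty (Vertex m) := ⟨mkVertex m 0 3 (by omega) (by
  have : (0 == 3 * m + 2) = false := by simp
  rw [this]; decide)⟩

theorem connected (m : ℕ) : (graph m).Connected := by
  obtain ⟨p⟩ := (inferInstance : Nonempty (Vertex m))
  refine (SimpleGraph.connected_iff _).2 ⟨fun v w => ?_, ⟨p⟩⟩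
  exact linked_of_ne (D := fun _ => False) (r := (graph m).Reachable)
    ⟨fun _ => .refl _, fun h => h.symm, fun h h' => h.trans h'⟩ (fun _ _ h _ _ => h.reachable) p p
    (fun _ h => h.elim) (fun h => h) (fun h => h)

theorem connected_induce (s : Finset (Vertex m)) (hs : s.card ≤ 2) :
    ((graph m).induce {v | v ∉ s}).Connected := by
  classical
  obtain ⟨p, q, hpq⟩ : ∃ p q, ∀ v, v ∈ s → v = p ∨ v = q := by
    obtain ⟨p⟩ := (inferInstance : Nonempty (Vertex m))
    interval_cases h : s.card
    · exact ⟨p, p, fun v hv => by simp [Finset.card_eq_zero.1 h] at hv⟩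
    · obtain ⟨a, rfl⟩ := Finset.card_eq_one.1 h
      exact ⟨a, a, by simp⟩
    · obtain ⟨a, b, -, rfl⟩ := Finset.card_eq_two.1 h
      exact ⟨a, b, by simp⟩
  rw [SimpleGraph.connected_iff]
  constructor
  · rintro ⟨v, hv⟩ ⟨w, hw⟩
    -- The disjunct `a = b` only serves to make the relation reflexive at deleted vertices, where
    -- reachability in the induced graph has no meaning.
    let r : Vertex m → Vertex m → Prop := fun a b => a = b ∨ ∃ (ha : a ∉ s) (hb : b ∉ s),
      ((graph m).induce {v | v ∉ s}).Reachable ⟨a, ha⟩ ⟨b, hb⟩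
    have hr : Equivalence r :=
      { refl := fun a => Or.inl rfl
        symm := by
          rintro a b (rfl | ⟨ha, hb, h⟩)
          exacts [Or.inl rfl, Or.inr ⟨hb, ha, h.symm⟩]
        trans := by
          rintro a b c (rfl | ⟨ha, hb, h⟩) (rfl | ⟨hb', hc, h'⟩)
          exacts [Or.inl rfl, Or.inr ⟨hb', hc, h'⟩, Or.inr ⟨ha, hb, h⟩,
            Or.inr ⟨ha, hc, h.trans h'⟩] }
    have := linked_of_ne (D := (· ∈ s)) hr (fun a b h ha hb => Or.inr ⟨ha, hb,
      SimpleGraph.Adj.reachable (by simpa using h)⟩) p q hpq hv hw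
    rcases this with rfl | ⟨_, _, h⟩
    exacts [.refl _, h]
  · by_contra hne
    have hall : ∀ v : Vertex m, v ∈ s := fun v => by
      by_contra hv
      exact hne ⟨⟨v, hv⟩⟩
    have : Nat.card (Vertex m) ≤ s.card := by
      have h1 : (Set.univ : Set (Vertex m)) ⊆ s := fun v _ => hall v
      have := Set.ncard_le_ncard h1 s.finite_toSet
      rwa [Set.ncard_univ, Set.ncard_coe_finset] at this
    rw [card_vertex] at this
    omega

theorem isFullerene (m : ℕ) : (rotation m).IsFullerene := by
  refine ⟨⟨inferInstance, connected m, ?_⟩, ⟨?_, connected_induce⟩, ncard_neighborSet, sides_eq⟩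
  · have := ncard_edgeSet m
    rw [card_face, card_isBase]
    rw [card_vertex] at this ⊢
    omega
  · rw [card_vertex]; omega

end CappedTube

namespace CappedTube

variable {m : ℕ}

open Vertex

/-! ### Symmetries -/

/-- The column of a vertex: its position measured from a starting point common to all layers. -/
def Vertex.col (v : Vertex m) : ZMod 12 := v.pos + v.layer

theorem Vertex.ext_col {v w : Vertex m} (h1 : v.layer = w.layer) (h2 : v.col = w.col) : v = w :=
  Vertex.ext h1 (by simpa [col, h1] using h2)

def signOf (e : Bool) : ZMod 12 := if e then -1 else 1

/-- The parameters of a symmetry: whether it exchanges the two ends, whether it reverses the sense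
of rotation about the axis, and the column to which column `0` is mapped. -/
def SymParam (m : ℕ) : Type :=
  {x : Bool × Bool × ZMod 12 // 2 * (x.2.2 - if x.1 then ((3 * m + 3 : ℕ) : ZMod 12) else 0) = 0}

namespace SymParam

def swap (x : SymParam m) : Bool := x.1.1
def refl (x : SymParam m) : Bool := x.1.2.1
def shift (x : SymParam m) : ZMod 12 := x.1.2.2

theorem ext {x y : SymParam m} (h1 : x.swap = y.swap) (h2 : x.refl = y.refl)
    (h3 : x.shift = y.shift) : x = y :=
  Subtype.ext (Prod.ext h1 (Prod.ext h2 h3))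

/-- The number `3 * m + 3` is the twist of the top cap against the bottom cap, in columns. That four
times the twist vanishes means that `2 * shift` is unaffected by the sign of the twist, and this
makes the condition on `shift` stable under composition. -/
theorem four_mul_eq_zero (m : ℕ) : (4 : ZMod 12) * ((3 * m + 3 : ℕ) : ZMod 12) = 0 := by
  have : (12 : ZMod 12) = 0 := by decide
  push_cast
  linear_combination ((m : ZMod 12) + 1) * this

theorem shift_of_not_swap {x : SymParam m} (h : x.swap = false) : 2 * x.shift = 0 := by
  have := x.2
  unfold swap at h
  rw [h] at this
  simpa [shift] using this

theorem shift_of_swap {x : SymParam m} (h : x.swap = true) :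
    2 * (x.shift - ((3 * m + 3 : ℕ) : ZMod 12)) = 0 := by
  have := x.2
  unfold swap at h
  rw [h] at this
  simpa only [shift, if_true] using this

/-- The parameters of a composition. -/
def mul (x y : SymParam m) : SymParam m :=
  ⟨(xor x.swap y.swap, xor x.refl y.refl, x.shift + signOf x.refl * y.shift), by
    have h4 := four_mul_eq_zero m
    cases hx : x.swap <;> cases hy : y.swap <;> cases x.refl <;>
      simp only [Bool.xor_false, Bool.xor_true, Bool.not_true, Bool.not_false, signOf, if_true,
        Bool.false_eq_true, if_false]
    · linear_combination shift_of_not_swap hx + shift_of_not_swap hy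
    · linear_combination shift_of_not_swap hx - shift_of_not_swap hy
    · linear_combination shift_of_not_swap hx + shift_of_swap hy
    · linear_combination shift_of_not_swap hx - shift_of_swap hy - h4
    · linear_combination shift_of_swap hx + shift_of_not_swap hy
    · linear_combination shift_of_swap hx - shift_of_not_swap hy
    · linear_combination shift_of_swap hx + shift_of_swap hy + h4
    · linear_combination shift_of_swap hx - shift_of_swap hy⟩

end SymParam

open SymParam

def symLayer (x : SymParam m) (j : ℕ) : ℕ := if x.swap then 3 * m + 2 - j else j

/-- In terms of columns the map is `c ↦ ± c + shift`; subtracting the new layer turns the resulting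
column back into a position. -/
def symPos (x : SymParam m) (j : ℕ) (y : ZMod 12) : ZMod 12 :=
  signOf x.refl * (y + j) + x.shift - symLayer x j

theorem present_sym_bot_bot : ∀ c y : ZMod 12, 2 * c = 0 →
    present true false (y + c) = present true false y ∧
    present true false (-y + c) = present true false y := by decide

theorem present_sym_top_top : ∀ a y : ZMod 12, 2 * a = 0 →
    present false true (y + a) = present false true y ∧
    present false true (-y + 2 + a) = present false true y := by decide

theorem present_sym_bot_top : ∀ a y : ZMod 12, 2 * a = 0 →
    present false true (y + 1 + a) = present true false y ∧
    present false true (-y + 1 + a) = present true false y := by decide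

theorem present_sym_top_bot : ∀ a y : ZMod 12, 2 * a = 0 →
    present true false (y - 1 + a) = present false true y ∧
    present true false (1 - y + a) = present false true y := by decide

/-- Inner layers have all positions, so only the end rings matter. Up to multiples of the twist, the
condition on `shift` leaves a turn by 0 or 6 columns, which preserves the pattern of a cap. -/
theorem present_sym (x : SymParam m) {j : ℕ} (hj : j ≤ 3 * m + 2) (y : ZMod 12) :
    present (symLayer x j == 0) (symLayer x j == 3 * m + 2) (symPos x j y) =
      present (j == 0) (j == 3 * m + 2) y := by
  have h4 := four_mul_eq_zero m
  have c0 : (0 == 3 * m + 2) = false := by simp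
  have c1 : (3 * m + 2 == 0) = false := by simp
  have pt : ∀ y, present false false y = true := fun _ => rfl
  push_cast at h4
  cases hs : x.swap
  · have hc := shift_of_not_swap hs
    simp only [symPos, symLayer, hs, Bool.false_eq_true, if_false]
    rcases Nat.eq_zero_or_pos j with rfl | h0
    · rw [c0, beq_self_eq_true]
      cases x.refl
      · convert (present_sym_bot_bot _ y hc).1 using 2; simp [signOf]
      · convert (present_sym_bot_bot _ y hc).2 using 2; simp [signOf]
    · rw [show (j == 0) = false by simp; omega]
      rcases hj.eq_or_lt with rfl | h1
      · rw [beq_self_eq_true]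
        cases x.refl
        · convert (present_sym_top_top _ y hc).1 using 2; simp [signOf]; ring
        -- The reflection is centred at the bottom cap. Seen from the top cap its shift changes by
        -- twice the twist, which is harmless because four times the twist is zero.
        · convert (present_sym_top_top (x.shift - 2 * (3 * m + 3)) y
            (by linear_combination hc - h4)).2 using 2; simp [signOf]; ring
      · rw [show (j == 3 * m + 2) = false by simp; omega, pt, pt]
  · have hc := shift_of_swap hs
    push_cast at hc
    simp only [symPos, symLayer, hs, if_true]
    rcases Nat.eq_zero_or_pos j with rfl | h0
    · rw [c0, beq_self_eq_true, Nat.sub_zero, c1, beq_self_eq_true]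
      cases x.refl
      · convert (present_sym_bot_top _ y hc).1 using 2; simp [signOf]; ring
      · convert (present_sym_bot_top _ y hc).2 using 2; simp [signOf]; ring
    · rw [show (j == 0) = false by simp; omega]
      rcases hj.eq_or_lt with rfl | h1
      · rw [Nat.sub_self, c0, beq_self_eq_true, beq_self_eq_true]
        cases x.refl
        · convert (present_sym_top_bot (x.shift + (3 * m + 3)) y
            (by linear_combination hc + h4)).1 using 2; simp [signOf]; ring
        · convert (present_sym_top_bot _ y hc).2 using 2; simp [signOf]; ring
      · rw [show (j == 3 * m + 2) = false by simp; omega,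
          show (3 * m + 2 - j == 0) = false by simp; omega,
          show (3 * m + 2 - j == 3 * m + 2) = false by simp; omega, pt, pt]

theorem symLayer_le (x : SymParam m) {j : ℕ} (hj : j ≤ 3 * m + 2) : symLayer x j ≤ 3 * m + 2 := by
  unfold symLayer; split_ifs <;> omega

def symFun (x : SymParam m) (v : Vertex m) : Vertex m :=
  mkVertex m (symLayer x v.layer) (symPos x v.layer v.pos) (symLayer_le x v.layer_le)
    ((present_sym x v.layer_le _).trans v.present_pos)

theorem layer_symFun (x : SymParam m) (v : Vertex m) :
    (symFun x v).layer = if x.swap then 3 * m + 2 - v.layer else v.layer := rfl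

theorem pos_symFun (x : SymParam m) (v : Vertex m) :
    (symFun x v).pos = symPos x v.layer v.pos := rfl

theorem col_symFun (x : SymParam m) (v : Vertex m) :
    (symFun x v).col = signOf x.refl * v.col + x.shift := by
  simp only [col, pos_symFun, symPos]
  rw [show (symFun x v).layer = symLayer x v.layer from rfl]
  ring

theorem symFun_mul (x y : SymParam m) (v : Vertex m) :
    symFun (x.mul y) v = symFun x (symFun y v) := by
  have := v.layer_le
  refine Vertex.ext_col ?_ ?_
  · simp only [layer_symFun]
    rw [show (x.mul y).swap = xor x.swap y.swap from rfl]
    cases x.swap <;> cases y.swap <;> simp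
    omega
  · simp only [col_symFun]
    rw [show (x.mul y).refl = xor x.refl y.refl from rfl,
      show (x.mul y).shift = x.shift + signOf x.refl * y.shift from rfl]
    cases x.refl <;> cases y.refl <;> simp [signOf] <;> ring

theorem symFun_injective (x : SymParam m) : Function.Injective (symFun x) := by
  intro v w h
  have h1 := congrArg layer h
  have h2 := congrArg col h
  have := v.layer_le
  have := w.layer_le
  simp only [layer_symFun, col_symFun] at h1 h2
  refine Vertex.ext_col ?_ ?_
  · split_ifs at h1 <;> omega
  · cases hx : x.refl <;> simpa [hx, signOf] using h2

theorem isUp_symFun (x : SymParam m) (v : Vertex m) :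
    isUp (symFun x v).pos = xor x.swap (isUp v.pos) := by
  have k : ∀ a j y : ZMod 12, 2 * a = 0 → isUp (y + a) = isUp y ∧
      isUp (-y - 2 * j + a) = isUp y ∧ isUp (y + 2 * j + 1 + a) = !isUp y ∧
      isUp (1 - y + a) = !isUp y := by decide
  have hl := v.layer_le
  rw [pos_symFun, symPos, symLayer]
  cases hs : x.swap
  · have K := k _ v.layer v.pos (shift_of_not_swap hs)
    cases x.refl
    · simp only [Bool.false_eq_true, if_false, signOf, Bool.false_xor]
      rw [← K.1]; congr 1; ring
    · simp only [Bool.false_eq_true, if_false, if_true, signOf, Bool.false_xor]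
      rw [← K.2.1]; congr 1; ring
  · have K := k _ v.layer v.pos (shift_of_swap hs)
    cases x.refl
    · simp only [Bool.false_eq_true, if_false, if_true, signOf, Bool.true_xor]
      rw [← K.2.2.1]; congr 1; push_cast [hl]; ring
    · simp only [if_true, signOf, Bool.true_xor]
      rw [← K.2.2.2]; congr 1; push_cast [hl]; ring

theorem symFun_right (x : SymParam m) (v : Vertex m) :
    symFun x v.right = if x.refl then (symFun x v).left else (symFun x v).right := by
  have hp := present_sym x v.layer_le (v.pos + 1)
  have e : ∀ z : ZMod 12, symPos x v.layer (v.pos + z) =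
      (symFun x v).pos + signOf x.refl * z := fun z => by
    rw [pos_symFun]; unfold symPos; ring
  rw [e] at hp
  change present (symFun x v).bot (symFun x v).top _ = present v.bot v.top _ at hp
  have e2 : (symFun x v.right).pos = if present v.bot v.top (v.pos + 1)
      then (symFun x v).pos + signOf x.refl * 1 else (symFun x v).pos + signOf x.refl * 2 := by
    rw [← e, ← e, pos_symFun, pos_right, layer_right]
    unfold rightPos
    split_ifs <;> rfl
  cases hx : x.refl <;> rw [hx] at hp e2
  · refine Vertex.ext rfl ?_
    simp only [Bool.false_eq_true, if_false, signOf] at *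
    rw [pos_right, rightPos, e2, ← hp]
    simp
  · refine Vertex.ext rfl ?_
    simp only [if_true, signOf] at *
    rw [pos_left, leftPos, e2, ← hp]
    simp [sub_eq_add_neg]

theorem symFun_left (x : SymParam m) (v : Vertex m) :
    symFun x v.left = if x.refl then (symFun x v).right else (symFun x v).left := by
  have h := symFun_right x v.left
  rw [right_left] at h
  split_ifs at h ⊢ <;> rw [h] <;> simp

/-- Vertical edges between layers preserve the column, so they are respected by any affine map of
columns combined with a reversal of layers. Only the chords use the condition on `shift`. -/
theorem symFun_vert (x : SymParam m) (v : Vertex m) :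
    symFun x v.vert = (symFun x v).vert := by
  have h4 := four_mul_eq_zero m
  push_cast at h4
  have hl := v.layer_le
  have hl' := v.vert.layer_le
  have hu := isUp_symFun x v
  have T := v.top_iff
  have B := v.bot_iff
  have T' := (symFun x v).top_iff
  have B' := (symFun x v).bot_iff
  have L := layer_symFun x v
  have L' := layer_symFun x v.vert
  have P : (symFun x v).pos =
    signOf x.refl * (v.pos + v.layer) + x.shift - (symFun x v).layer := rfl
  have P' : (symFun x v.vert).pos =
    signOf x.refl * (v.vert.pos + v.vert.layer) + x.shift - (symFun x v.vert).layer := rfl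
  cases hs : x.swap
  · have hc := shift_of_not_swap hs
    have hbb : (symFun x v).bot = v.bot := by simp [bot, L, hs]
    have htt : (symFun x v).top = v.top := by simp [top, L, hs]
    simp only [hs, Bool.false_eq_true, if_false, Bool.false_xor] at L L' hu
    -- The ends are kept, so the kind of the vertical edge is kept as well: four of the sixteen
    -- combinations survive.
    rcases v.vert_cases with h | h | h | h <;>
      rcases (symFun x v).vert_cases with h' | h' | h' | h' <;>
        [skip; simp [h, hu] at h'; simp [h, htt] at h'; simp [h, hu] at h';
        simp [h, hu] at h'; skip; simp [h, hu] at h'; simp [h, hbb] at h';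
        simp [h, htt] at h'; simp [h, hu] at h'; skip; simp [h, hu] at h';
        simp [h, hu] at h'; simp [h, hbb] at h'; simp [h, hu] at h'; skip] <;>
      refine Vertex.ext (by omega) ?_
    · rw [P', h'.2.2.2.1, P, L', L, h.2.2.1, h.2.2.2.1]; push_cast; ring
    · rw [P', h'.2.2.2.1, P, L', L, h.2.2.1, h.2.2.2.1]; push_cast; ring
    · have : v.layer = 3 * m + 2 := T.1 h.2.1
      rw [P', h'.2.2.2.2.1, P, L', L, h.2.2.2.1, h.2.2.2.2.1, this]
      cases x.refl <;> simp only [signOf, Bool.false_eq_true, if_false, if_true] <;> push_cast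
      · linear_combination hc
      · linear_combination hc - h4
    · have : v.layer = 0 := B.1 h.2.1
      rw [P', h'.2.2.2.2.1, P, L', L, h.2.2.2.1, h.2.2.2.2.1, this]
      push_cast
      linear_combination hc
  · have hc := shift_of_swap hs
    push_cast at hc
    have hbb : (symFun x v).bot = v.top := by
      simp only [bot, top, L, hs, if_true, beq_eq_beq]; omega
    have htt : (symFun x v).top = v.bot := by
      simp only [bot, top, L, hs, if_true, beq_eq_beq]; omega
    simp only [hs, if_true, Bool.true_xor] at L L' hu
    rcases v.vert_cases with h | h | h | h <;>
      rcases (symFun x v).vert_cases with h' | h' | h' | h' <;>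
        [simp [h, hu] at h'; skip; simp [h, hu] at h'; simp [h, hbb] at h';
        skip; simp [h, hu] at h'; simp [h, htt] at h'; simp [h, hu] at h';
        simp [h, hu] at h'; simp [h, hbb] at h'; simp [h, hu] at h'; skip;
        simp [h, htt] at h'; simp [h, hu] at h'; skip; simp [h, hu] at h'] <;>
      refine Vertex.ext (by omega) ?_
    · rw [P', h'.2.2.2.1, P, L', L, h.2.2.1, h.2.2.2.1]
      rw [show 3 * m + 2 - v.layer = (3 * m + 2 - (v.layer + 1)) + 1 by omega]
      push_cast; ring
    · rw [P', h'.2.2.2.1, P, L', L, h.2.2.1, h.2.2.2.1]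
      rw [show 3 * m + 2 - v.vert.layer = (3 * m + 2 - (v.vert.layer + 1)) + 1 by omega]
      push_cast; ring
    · have : v.layer = 3 * m + 2 := T.1 h.2.1
      rw [P', h'.2.2.2.2.1, P, L', L, h.2.2.2.1, h.2.2.2.2.1, this, Nat.sub_self]
      cases x.refl <;> simp only [signOf, Bool.false_eq_true, if_false, if_true] <;> push_cast
      · linear_combination hc + h4
      · linear_combination hc
    · have : v.layer = 0 := B.1 h.2.1
      rw [P', h'.2.2.2.2.1, P, L', L, h.2.2.2.1, h.2.2.2.2.1, this, Nat.sub_zero]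
      push_cast
      linear_combination hc

/-- The symmetry with given parameters. -/
noncomputable def sym (x : SymParam m) : graph m ≃g graph m where
  toEquiv := Equiv.ofBijective (symFun x) (Finite.injective_iff_bijective.1 (symFun_injective x))
  map_rel_iff' := by
    intro v w
    simp only [Equiv.ofBijective_apply, adj_iff]
    rw [← symFun_vert, (symFun_injective x).eq_iff]
    have h1 := symFun_left x v
    have h2 := symFun_right x v
    split_ifs at h1 h2 <;> rw [← h1, ← h2, (symFun_injective x).eq_iff,
      (symFun_injective x).eq_iff]
    tauto

@[simp] theorem sym_apply (x : SymParam m) (v : Vertex m) : sym x v = symFun x v := rfl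

theorem sym_mul (x y : SymParam m) : sym x * sym y = sym (x.mul y) := by
  ext v
  exact (symFun_mul x y v).symm

/-- Exchanging the ends and reversing the sense of rotation both reverse the cyclic order at a
vertex; equal flags mean that the two effects cancel or that neither occurs. -/
theorem preservesOrientation_sym {x : SymParam m} (h : x.swap = x.refl) :
    (rotation m).PreservesOrientation (sym x) := by
  rintro ⟨⟨v, w⟩, hw : (graph m).Adj v w⟩
  refine dart_eq_iff.2 ⟨rfl, ?_⟩
  change symFun x (v.next w) = (symFun x v).next (symFun x w)
  have hu := isUp_symFun x v
  have hl := symFun_left x v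
  have hr := symFun_right x v
  have hv := symFun_vert x v
  rw [h] at hu
  rcases adj_iff.1 hw with rfl | rfl | rfl <;> cases hx : x.refl <;>
    simp only [hx, Bool.false_eq_true, if_false, if_true, Bool.false_xor, Bool.true_xor]
      at hu hl hr <;>
    simp only [hl, hr, hv, next_left, next_right, next_vert, hu] <;> cases isUp v.pos <;>
    simp [hl, hr, hv]

theorem reversesOrientation_sym {x : SymParam m} (h : x.swap = !x.refl) :
    (rotation m).ReversesOrientation (sym x) := by
  rintro ⟨⟨v, w⟩, hw : (graph m).Adj v w⟩
  refine dart_eq_iff.2 ⟨rfl, ?_⟩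
  change symFun x (v.next w) = (symFun x v).prev (symFun x w)
  have hu := isUp_symFun x v
  have hl := symFun_left x v
  have hr := symFun_right x v
  have hv := symFun_vert x v
  rw [h] at hu
  rcases adj_iff.1 hw with rfl | rfl | rfl <;> cases hx : x.refl <;>
    simp only [hx, Bool.false_eq_true, if_false, if_true, Bool.false_xor, Bool.true_xor,
      Bool.not_true, Bool.not_false] at hu hl hr <;>
    simp only [hl, hr, hv, next_left, next_right, next_vert, prev_left, prev_right, prev_vert,
      hu] <;> cases isUp v.pos <;>
    simp [hl, hr, hv]

/-- At a vertex of degree three the clockwise and the counterclockwise successor of an edge are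
different. -/
theorem not_preserves_and_reverses (f : graph m ≃g graph m)
    (h1 : (rotation m).PreservesOrientation f) (h2 : (rotation m).ReversesOrientation f) :
    False := by
  obtain ⟨v⟩ := (inferInstance : Nonempty (Vertex m))
  have h := (h1 (dartL (f.symm v))).symm.trans (h2 (dartL (f.symm v)))
  have e : ∀ d : (graph m).Dart, (rotation m).rot d ≠ (rotation m).rot.symm d := by
    intro d h
    have h' : d.fst.next d.snd = d.fst.prev d.snd := (dart_eq_iff.1 h).2
    have n1 := d.fst.left_ne_right
    have n2 := d.fst.vert_ne_left
    have n3 := d.fst.vert_ne_right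
    rcases adj_iff.1 d.adj with e | e | e <;> rw [e] at h' <;>
      simp only [next_left, next_right, next_vert, prev_left, prev_right, prev_vert] at h' <;>
      split_ifs at h' <;> simp_all [eq_comm]
  exact e _ h

end CappedTube

/-! ### Zigzags: reversal, and the effect of reflections -/

namespace RotationSystem

variable {V : Type*} {G : SimpleGraph V} (R : RotationSystem G)

theorem zigzagOf_zigzagNext (x : G.Dart × Bool) : R.zigzagOf (R.zigzagNext x) = R.zigzagOf x :=
  (Quotient.sound (s := R.zigzagSetoid) (Relation.EqvGen.rel _ _ (Or.inl rfl))).symm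

theorem zigzagOf_zigzagRev (x : G.Dart × Bool) : R.zigzagOf (zigzagRev x) = R.zigzagOf x :=
  (Quotient.sound (s := R.zigzagSetoid) (Relation.EqvGen.rel _ _ (Or.inr rfl))).symm

/-- Reversal conjugates the step to its inverse. Hence a set of states closed under steps and
reversals is also closed under backward steps. -/
theorem zigzagNext_rev_zigzagNext (x : G.Dart × Bool) :
    R.zigzagNext (zigzagRev (R.zigzagNext x)) = zigzagRev x := by
  obtain ⟨d, b⟩ := x
  cases b <;> simp [zigzagNext, zigzagRev]

theorem zigzagRev_zigzagRev (x : G.Dart × Bool) : zigzagRev (zigzagRev x) = x := by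
  simp [zigzagRev]

/-- A set of states which is closed under steps and reversals is a union of zigzags. -/
theorem mem_iff_of_zigzagOf_eq {S : Set (G.Dart × Bool)}
    (hn : ∀ x ∈ S, R.zigzagNext x ∈ S) (hr : ∀ x ∈ S, zigzagRev x ∈ S) {x y : G.Dart × Bool}
    (h : R.zigzagOf x = R.zigzagOf y) : x ∈ S ↔ y ∈ S := by
  have hr' : ∀ x, zigzagRev x ∈ S → x ∈ S := fun x h => zigzagRev_zigzagRev x ▸ hr _ h
  have h' : Relation.EqvGen _ x y := Quotient.exact h
  clear h
  induction h' with
  | rel x y h =>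
    rcases h with rfl | rfl
    · refine ⟨hn x, fun h => hr' _ ?_⟩
      rw [← R.zigzagNext_rev_zigzagNext]
      exact hn _ (hr _ h)
    · exact ⟨hr x, hr' x⟩
  | refl => rfl
  | symm x y h ih => exact ih.symm
  | trans x y z h1 h2 ih1 ih2 => exact ih1.trans ih2

/-- The action of an orientation-reversing automorphism on the states of zigzags. -/
def mapState (f : G ≃g G) (x : G.Dart × Bool) : G.Dart × Bool := (f.toHom.mapDart x.1, !x.2)

variable {R} {f : G ≃g G}

theorem mapDart_symm (d : G.Dart) :
    f.toHom.mapDart d.symm = (f.toHom.mapDart d).symm := rfl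

theorem ReversesOrientation.mapDart_rot_symm (hf : R.ReversesOrientation f) (d : G.Dart) :
    f.toHom.mapDart (R.rot.symm d) = R.rot (f.toHom.mapDart d) := by
  have := hf (R.rot.symm d)
  rw [Equiv.apply_symm_apply] at this
  rw [this, Equiv.apply_symm_apply]

/-- A reflection exchanges left and right turns; with the negated flag it commutes with the step and
with reversal, so it acts on zigzags. -/
theorem ReversesOrientation.zigzagOf_mapState (hf : R.ReversesOrientation f) {x y : G.Dart × Bool}
    (h : R.zigzagOf x = R.zigzagOf y) : R.zigzagOf (mapState f x) = R.zigzagOf (mapState f y) := by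
  have hN : ∀ x, mapState f (R.zigzagNext x) = R.zigzagNext (mapState f x) := by
    rintro ⟨d, b⟩
    cases b
    · simp only [mapState, zigzagNext, Bool.not_false, Bool.not_true, Bool.false_eq_true, if_true,
        if_false, hf _, mapDart_symm]
    · simp only [mapState, zigzagNext, Bool.not_false, Bool.not_true, Bool.false_eq_true, if_true,
        if_false, hf.mapDart_rot_symm, mapDart_symm]
  have h' : Relation.EqvGen _ x y := Quotient.exact h
  clear h
  induction h' with
  | rel x y h =>
    rcases h with rfl | rfl
    · rw [hN, zigzagOf_zigzagNext]
    · exact (R.zigzagOf_zigzagRev (mapState f x)).symm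
  | refl => rfl
  | symm x y h ih => exact ih.symm
  | trans x y z h1 h2 ih1 ih2 => exact ih1.trans ih2

end RotationSystem

/-! ### The two zigzags and their common edges -/

namespace CappedTube

variable {m : ℕ}

open Vertex RotationSystem

/-- The vertices in the two bands between positions `3` and `4` and between `9` and `10`. -/
def InBand (v : Vertex m) : Prop := v.pos = 3 ∨ v.pos = 4 ∨ v.pos = 9 ∨ v.pos = 10

/-- The other end of the horizontal edge of the band. -/
def across (v : Vertex m) : Vertex m := if isUp v.pos then v.left else v.right

theorem adj_across (v : Vertex m) : (graph m).Adj v (across v) := by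
  unfold across; split_ifs
  exacts [adj_left v, adj_right v]

def dartAcross (v : Vertex m) : (graph m).Dart := mkDart v (across v) (adj_across v)

theorem across_ne_vert (v : Vertex m) : across v ≠ v.vert := by
  unfold across; split_ifs
  exacts [v.vert_ne_left.symm, v.vert_ne_right.symm]

/-- The positions 3, 4, 9 and 10 are missing in no layer, so the bands run through the whole tube
without interruption. -/
theorem pos_across {v : Vertex m} (h : InBand v) :
    (across v).pos = (if isUp v.pos then v.pos - 1 else v.pos + 1) ∧ InBand (across v) ∧
    isUp (across v).pos = !isUp v.pos := by
  have k : ∀ b t y, (b && t) = false → (y = 3 ∨ y = 4 ∨ y = 9 ∨ y = 10) →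
      (isUp y = true → leftPos b t y = y - 1 ∧ (leftPos b t y = 3 ∨ leftPos b t y = 4 ∨
        leftPos b t y = 9 ∨ leftPos b t y = 10) ∧ isUp (leftPos b t y) = false) ∧
      (isUp y = false → rightPos b t y = y + 1 ∧ (rightPos b t y = 3 ∨ rightPos b t y = 4 ∨
        rightPos b t y = 9 ∨ rightPos b t y = 10) ∧ isUp (rightPos b t y) = true) := by decide
  have K := k _ _ _ v.not_bot_top h
  unfold across InBand
  cases hu : isUp v.pos
  · simpa [pos_right] using K.2 hu
  · simpa [pos_left] using K.1 hu

theorem across_across {v : Vertex m} (h : InBand v) : across (across v) = v := by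
  have := (pos_across h).2.2
  rw [across, this]
  cases hu : isUp v.pos <;> simp [across, hu]

theorem inBand_vert {v : Vertex m} (h : InBand v) : InBand v.vert := by
  unfold InBand at *
  rcases v.vert_cases with H | H | ⟨H1, -, -, -, H2, -, -, H3⟩ | ⟨H1, -, -, -, H2, -, -, H3⟩
  · have := H.1
    rw [H.2.2.2.1]
    revert this h; generalize v.pos = y; revert y; decide
  · have := H.1
    rw [H.2.2.2.1]
    revert this h; generalize v.pos = y; revert y; decide
  · rw [H2]; rcases H3 with e | e <;> rw [e] <;> decide
  · rw [H2]; rcases H3 with e | e <;> rw [e] <;> decide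

/-- The states of the zigzag that winds through the two bands. -/
def bandStates (m : ℕ) : Set ((graph m).Dart × Bool) :=
  {x | ∃ v, InBand v ∧ (x = (dartV v, false) ∨ x = (dartAcross v, true))}

theorem symm_dartV (v : Vertex m) : (dartV v).symm = dartV v.vert :=
  dart_eq_iff.2 ⟨rfl, (vert_vert v).symm⟩

theorem symm_dartAcross {v : Vertex m} (h : InBand v) :
    (dartAcross v).symm = dartAcross (across v) :=
  dart_eq_iff.2 ⟨rfl, (across_across h).symm⟩

theorem rev_vert (v : Vertex m) : zigzagRev (dartV v, false) = (dartV v.vert, false) := by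
  rw [zigzagRev, symm_dartV]

theorem rev_across {v : Vertex m} (h : InBand v) :
    zigzagRev (dartAcross v, true) = (dartAcross (across v), true) := by
  rw [zigzagRev, symm_dartAcross h]

theorem zigzagNext_vert (v : Vertex m) :
    (rotation m).zigzagNext (dartV v, false) = (dartAcross v.vert, true) := by
  simp only [zigzagNext, Bool.false_eq_true, if_false, symm_dartV]
  refine Prod.ext (dart_eq_iff.2 ⟨rfl, ?_⟩) rfl
  exact next_vert _

theorem zigzagNext_across {v : Vertex m} (h : InBand v) :
    (rotation m).zigzagNext (dartAcross v, true) = (dartV (across v), false) := by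
  simp only [zigzagNext, if_true, symm_dartAcross h]
  refine Prod.ext (dart_eq_iff.2 ⟨rfl, ?_⟩) rfl
  change (across v).prev (across (across v)) = (across v).vert
  generalize across v = u
  cases hu : isUp u.pos
  · simp [across, prev_right, hu]
  · simp [across, prev_left, hu]

theorem zigzagNext_mem_bandStates (x : (graph m).Dart × Bool) (hx : x ∈ bandStates m) :
    (rotation m).zigzagNext x ∈ bandStates m := by
  obtain ⟨v, hv, rfl | rfl⟩ := hx
  · rw [zigzagNext_vert]
    exact ⟨_, inBand_vert hv, Or.inr rfl⟩
  · rw [zigzagNext_across hv]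
    exact ⟨_, (pos_across hv).2.1, Or.inl rfl⟩

theorem zigzagRev_mem_bandStates (x : (graph m).Dart × Bool) (hx : x ∈ bandStates m) :
    zigzagRev x ∈ bandStates m := by
  obtain ⟨v, hv, rfl | rfl⟩ := hx
  · rw [rev_vert]
    exact ⟨_, inBand_vert hv, Or.inl rfl⟩
  · rw [rev_across hv]
    exact ⟨_, (pos_across hv).2.1, Or.inr rfl⟩

def base (m : ℕ) (y : ZMod 12) (hy : present true false y = true) : Vertex m :=
  mkVertex m 0 y (by omega) (by
    have : (0 == 3 * m + 2) = false := by simp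
    rw [this]; exact hy)

def baseChord (m : ℕ) : Vertex m := base m 3 (by decide)

theorem vert_chord_bot {v : Vertex m} (hu : isUp v.pos = false) (h0 : v.layer = 0) :
    v.vert.layer = 0 ∧ v.vert.pos = -v.pos := by
  rcases v.vert_cases with H | H | H | H
  · simp [hu] at H
  · omega
  · simp [hu] at H
  · exact ⟨by omega, H.2.2.2.2.1⟩

theorem vert_chord_top {v : Vertex m} (hu : isUp v.pos = true) (ht : v.layer = 3 * m + 2) :
    v.vert.layer = 3 * m + 2 ∧ v.vert.pos = 2 - v.pos := by
  rcases v.vert_cases with H | H | H | H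
  · have := v.vert.layer_le; omega
  · simp [hu] at H
  · exact ⟨by omega, H.2.2.2.2.1⟩
  · simp [hu] at H

/-- The state from which the first zigzag is traced. -/
def baseState (m : ℕ) : (graph m).Dart × Bool := (dartV (baseChord m), false)

theorem zigzagOf_across {v : Vertex m} (hv : InBand v) :
    (rotation m).zigzagOf (dartAcross v, true) = (rotation m).zigzagOf (dartV v, false) := by
  have h := (rotation m).zigzagOf_zigzagNext (dartAcross (across v), true)
  rw [zigzagNext_across (pos_across hv).2.1, across_across hv, ← rev_across hv,
    zigzagOf_zigzagRev] at h
  exact h.symm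

/-- Induction on the layer: crossing the band below a downward edge leads to the next downward edge.
In the bottom layer the chord connects the two bands, so all band states belong to one zigzag. -/
theorem zigzagOf_vert {v : Vertex m} (hv : InBand v) :
    (rotation m).zigzagOf (dartV v, false) = (rotation m).zigzagOf (baseState m) := by
  have odd : ∀ n, ∀ v : Vertex m, v.layer = n → InBand v → isUp v.pos = false →
      (rotation m).zigzagOf (dartV v, false) = (rotation m).zigzagOf (baseState m) := by
    intro n
    induction n with
    | zero =>
      intro v h0 hv hu
      have : v.pos = 3 ∨ v.pos = 9 := by
        unfold InBand at hv
        revert hv hu; generalize v.pos = y; revert y; decide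
      rcases this with e | e
      · rw [show v = baseChord m from Vertex.ext h0 e]; rfl
      · have e2 : v = (baseChord m).vert := by
          have H := vert_chord_bot (v := baseChord m) (by change isUp 3 = false; decide) rfl
          exact Vertex.ext (h0.trans H.1.symm)
            (by rw [e, H.2]; change (9 : ZMod 12) = -3; decide)
        rw [e2, ← rev_vert, zigzagOf_zigzagRev]; rfl
    | succ n ih =>
      intro v h0 hv hu
      have hd := vert_of_down hu (by omega)
      have hvv := inBand_vert hv
      have hl : isUp v.vert.pos = true := by rw [hd.2, isUp_add_one, hu]; rfl
      have e := ih (across v.vert) (by rw [across, hl]; simp; omega) (pos_across hvv).2.1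
        (by rw [(pos_across hvv).2.2, hl]; rfl)
      rw [← e, ← zigzagOf_across (pos_across hvv).2.1, ← rev_across hvv, zigzagOf_zigzagRev,
        zigzagOf_across hvv, ← rev_vert, zigzagOf_zigzagRev]
  cases hu : isUp v.pos
  · exact odd _ v rfl hv hu
  · have e := odd _ (across v) rfl (pos_across hv).2.1 (by rw [(pos_across hv).2.2, hu]; rfl)
    rw [← e, ← zigzagOf_across (pos_across hv).2.1, ← rev_across hv, zigzagOf_zigzagRev,
      zigzagOf_across hv]

theorem inBand_base : InBand (baseChord m) := Or.inl rfl

theorem zigzagOf_eq_iff (x : (graph m).Dart × Bool) :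
    (rotation m).zigzagOf x = (rotation m).zigzagOf (baseState m) ↔ x ∈ bandStates m := by
  constructor
  · intro h
    rw [mem_iff_of_zigzagOf_eq _ zigzagNext_mem_bandStates zigzagRev_mem_bandStates h]
    exact ⟨_, inBand_base, Or.inl rfl⟩
  · rintro ⟨v, hv, rfl | rfl⟩
    · exact zigzagOf_vert hv
    · rw [zigzagOf_across hv, zigzagOf_vert hv]

/-- Among the band states vertical edges carry only the flag `false` and horizontal ones only
`true`, so an edge admits just one state and its reversal. -/
theorem bandStates_simple {x y : (graph m).Dart × Bool} (hx : x ∈ bandStates m)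
    (hy : y ∈ bandStates m) (h : x.1.edge = y.1.edge) : y = x ∨ y = zigzagRev x := by
  obtain ⟨v, hv, rfl | rfl⟩ := hx <;> obtain ⟨w, hw, rfl | rfl⟩ := hy <;>
    rcases SimpleGraph.dart_edge_eq_iff _ _ |>.1 h with h | h
  · exact Or.inl (by rw [← show dartV v = dartV w from h])
  · exact Or.inr (by rw [zigzagRev, show dartV v = (dartV w).symm from h]; simp)
  · have h := dart_eq_iff.1 h
    exact absurd (show v.vert = across w from h.2) (by
      rw [show v = w from h.1]; exact (across_ne_vert w).symm)
  · rw [symm_dartAcross hw] at h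
    have h := dart_eq_iff.1 h
    exact absurd (show v.vert = across (across w) from h.2) (by
      rw [show v = across w from h.1]; exact (across_ne_vert _).symm)
  · have h := dart_eq_iff.1 h
    exact absurd (show across v = w.vert from h.2) (by
      rw [show v = w from h.1]; exact across_ne_vert w)
  · rw [symm_dartV] at h
    have h := dart_eq_iff.1 h
    exact absurd (show across v = w.vert.vert from h.2) (by
      rw [show v = w.vert from h.1]; exact across_ne_vert _)
  · exact Or.inl (by rw [← show dartAcross v = dartAcross w from h])
  · exact Or.inr (by rw [zigzagRev, show dartAcross v = (dartAcross w).symm from h]; simp)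

/-- The parameters of the reflection which fixes the columns `0` and `6`. -/
def mirrorParam (m : ℕ) : SymParam m := ⟨(false, true, 0), by simp⟩

noncomputable def mirror (m : ℕ) : graph m ≃g graph m := sym (mirrorParam m)

theorem mirror_apply (v : Vertex m) : mirror m v = symFun (mirrorParam m) v := rfl

theorem layer_mirror (v : Vertex m) : (mirror m v).layer = v.layer := rfl

theorem pos_mirror (v : Vertex m) : (mirror m v).pos = -v.pos - 2 * v.layer := by
  rw [mirror_apply, pos_symFun]
  simp only [symPos, mirrorParam, signOf, SymParam.refl, SymParam.shift, symLayer, SymParam.swap]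
  simp; ring

theorem mirror_mirror (v : Vertex m) : mirror m (mirror m v) = v :=
  Vertex.ext rfl (by rw [pos_mirror, pos_mirror, layer_mirror]; ring)

theorem mirror_vert (v : Vertex m) : mirror m v.vert = (mirror m v).vert := symFun_vert _ v

theorem reverses_mirror (m : ℕ) : (rotation m).ReversesOrientation (mirror m) :=
  reversesOrientation_sym rfl

theorem mapState_mapState (x : (graph m).Dart × Bool) :
    mapState (mirror m) (mapState (mirror m) x) = x :=
  Prod.ext (dart_eq_iff.2 ⟨mirror_mirror _, mirror_mirror _⟩) (Bool.not_not _)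

theorem zigzagOf_mirror_eq_iff (x : (graph m).Dart × Bool) :
    (rotation m).zigzagOf x = (rotation m).zigzagOf (mapState (mirror m) (baseState m)) ↔
      mapState (mirror m) x ∈ bandStates m := by
  rw [← zigzagOf_eq_iff]
  constructor
  · intro h
    have := (reverses_mirror m).zigzagOf_mapState h
    rwa [mapState_mapState] at this
  · intro h
    have := (reverses_mirror m).zigzagOf_mapState h
    rwa [mapState_mapState] at this

theorem edge_mirror (d : (graph m).Dart) :
    ((mirror m).toHom.mapDart d).edge = Sym2.map (mirror m) d.edge := by
  induction d with
  | _ p => rfl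

theorem edge_dartV_eq_iff {v w : Vertex m} :
    (dartV v).edge = (dartV w).edge ↔ v = w ∨ v = w.vert := by
  rw [SimpleGraph.dart_edge_eq_iff, symm_dartV, dart_eq_iff, dart_eq_iff]
  constructor
  · rintro (h | h)
    exacts [Or.inl h.1, Or.inr h.1]
  · rintro (rfl | rfl)
    exacts [Or.inl ⟨rfl, rfl⟩, Or.inr ⟨rfl, rfl⟩]

theorem mapDart_dartV (v : Vertex m) : (mirror m).toHom.mapDart (dartV v) = dartV (mirror m v) :=
  dart_eq_iff.2 ⟨rfl, mirror_vert v⟩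

/-- The edges common to the first zigzag and its mirror image. -/
theorem common_edges (m : ℕ) :
    ((rotation m).zigzagOf (baseState m)).edges ∩
      ((rotation m).zigzagOf (mapState (mirror m) (baseState m))).edges =
    {e | ∃ v : Vertex m, InBand v ∧ InBand (mirror m v) ∧ (dartV v).edge = e} := by
  ext e
  constructor
  · rintro ⟨⟨x, hx, rfl⟩, ⟨y, hy, he⟩⟩
    rw [zigzagOf_eq_iff] at hx
    rw [zigzagOf_mirror_eq_iff] at hy
    obtain ⟨v, hv, hx⟩ := hx
    obtain ⟨w, hw, hy⟩ := hy
    have hy' : y = mapState (mirror m) (dartV w, false) ∨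
        y = mapState (mirror m) (dartAcross w, true) := by
      rcases hy with h | h
      · exact Or.inl (by rw [← h, mapState_mapState])
      · exact Or.inr (by rw [← h, mapState_mapState])
    have noVert : ∀ u u' : Vertex m, InBand u' →
        (dartV u).edge ≠ (dartAcross u').edge := by
      intro u u' hu' h
      rcases SimpleGraph.dart_edge_eq_iff _ _ |>.1 h with h | h
      · have h := dart_eq_iff.1 h
        exact across_ne_vert u' ((show u.vert = across u' from h.2).symm.trans
          (by rw [show u = u' from h.1]))
      · rw [symm_dartAcross hu'] at h
        have h := dart_eq_iff.1 h
        exact across_ne_vert _ ((show u.vert = across (across u') from h.2).symm.trans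
          (by rw [show u = across u' from h.1]))
    have bandV : ∀ {u : Vertex m}, InBand u → InBand u.vert := inBand_vert
    rcases hx with rfl | rfl <;> rcases hy' with rfl | rfl
    · change ((mirror m).toHom.mapDart (dartV w)).edge = _ at he
      rw [mapDart_dartV, edge_dartV_eq_iff] at he
      refine ⟨v, hv, ?_, rfl⟩
      rcases he with h | h
      · rw [← h, mirror_mirror]; exact hw
      · have : v = mirror m w.vert := by rw [mirror_vert, h, vert_vert]
        rw [this, mirror_mirror]; exact inBand_vert hw
    · exfalso
      change ((mirror m).toHom.mapDart (dartAcross w)).edge = (dartV v).edge at he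
      have h2 := congrArg (Sym2.map (mirror m)) he
      rw [← edge_mirror, ← edge_mirror, mapDart_dartV] at h2
      have e2 : (mirror m).toHom.mapDart ((mirror m).toHom.mapDart (dartAcross w)) =
          dartAcross w := dart_eq_iff.2 ⟨mirror_mirror _, mirror_mirror _⟩
      rw [e2] at h2
      exact noVert _ _ hw h2.symm
    · exfalso
      change ((mirror m).toHom.mapDart (dartV w)).edge = _ at he
      rw [mapDart_dartV] at he
      exact noVert _ _ hv he
    · exfalso
      change ((mirror m).toHom.mapDart (dartAcross w)).edge = (dartAcross v).edge at he
      -- A band edge joins an odd position to the even one after it. The reflection keeps parities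
      -- but reverses the order, so the image joins an odd position to the even one before it and is
      -- not a band edge.
      have h1 : InBand (mirror m v) ∧ InBand (mirror m (across v)) := by
        rcases SimpleGraph.dart_edge_eq_iff _ _ |>.1 he with h | h
        · have h := dart_eq_iff.1 h
          rw [← show mirror m w = v from h.1, ← show mirror m (across w) = across (mirror m w) from
            h.2.trans (by rw [← show mirror m w = v from h.1]; rfl), mirror_mirror, mirror_mirror]
          exact ⟨hw, (pos_across hw).2.1⟩
        · have h := dart_eq_iff.1 h
          rw [← show mirror m w = across v from h.1, ← show mirror m (across w) = v from h.2,
            mirror_mirror, mirror_mirror]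
          exact ⟨(pos_across hw).2.1, hw⟩
      have h2 := (pos_across hv).1
      have h3 : (across v).layer = v.layer := by unfold across; split_ifs <;> rfl
      unfold InBand at h1 hv
      rw [pos_mirror, pos_mirror, h2, h3] at h1
      revert h1 hv
      generalize v.pos = y
      generalize (v.layer : ZMod 12) = j
      revert y j
      decide
  · rintro ⟨v, hv, hv', rfl⟩
    refine ⟨⟨(dartV v, false), ?_, rfl⟩, ⟨(dartV v, true), ?_, rfl⟩⟩
    · rw [zigzagOf_eq_iff]; exact ⟨v, hv, Or.inl rfl⟩
    · rw [zigzagOf_mirror_eq_iff]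
      exact ⟨mirror m v, hv', Or.inl (Prod.ext (mapDart_dartV v) rfl)⟩

/-- One end of each of the common edges of the two zigzags. -/
def crossing (m : ℕ) : Option (Fin (m + 1) ⊕ Fin m) → Vertex m
  | none => baseChord m
  | some (.inl i) => mkVertex m (3 * i.1 + 2) 4 (by omega) (by
      have : (3 * i.1 + 2 == 0) = false := by simp
      rw [this]; cases (3 * i.1 + 2 == 3 * m + 2) <;> rfl)
  | some (.inr i) => mkVertex m (3 * i.1 + 2) 10 (by omega) (by
      have : (3 * i.1 + 2 == 0) = false := by simp
      rw [this]; cases (3 * i.1 + 2 == 3 * m + 2) <;> rfl)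

/-- The bands and their mirror images drift by two positions per layer against each other, and the
pattern of the bands repeats after six positions; so they coincide in every third layer. -/
theorem two_mul_natCast_iff (j : ℕ) :
    ((-4 - 2 * (j : ZMod 12) = 3 ∨ -4 - 2 * (j : ZMod 12) = 4 ∨ -4 - 2 * (j : ZMod 12) = 9 ∨
      -4 - 2 * (j : ZMod 12) = 10) ↔ j % 3 = 2) ∧
    ((-10 - 2 * (j : ZMod 12) = 3 ∨ -10 - 2 * (j : ZMod 12) = 4 ∨ -10 - 2 * (j : ZMod 12) = 9 ∨
      -10 - 2 * (j : ZMod 12) = 10) ↔ j % 3 = 2) := by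
  rw [← ZMod.natCast_mod j 12, show j % 3 = j % 12 % 3 by omega]
  have := Nat.mod_lt j (show 0 < 12 by norm_num)
  generalize j % 12 = i at *
  interval_cases i <;> decide

theorem crossing_mem (i : Option (Fin (m + 1) ⊕ Fin m)) :
    InBand (crossing m i) ∧ InBand (mirror m (crossing m i)) := by
  unfold InBand
  rw [pos_mirror]
  rcases i with _ | i | i
  · exact ⟨Or.inl rfl, by rw [show ((crossing m none).layer : ZMod 12) = 0 from Nat.cast_zero]
                          rw [show (crossing m none).pos = 3 from rfl]; decide⟩
  · exact ⟨Or.inr (Or.inl rfl), (two_mul_natCast_iff (3 * i.1 + 2)).1.2 (by omega)⟩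
  · exact ⟨Or.inr (Or.inr (Or.inr rfl)), (two_mul_natCast_iff (3 * i.1 + 2)).2.2 (by omega)⟩

theorem exists_crossing {v : Vertex m} (hv : InBand v) (hv' : InBand (mirror m v)) :
    ∃ i, (dartV (crossing m i)).edge = (dartV v).edge := by
  simp only [edge_dartV_eq_iff]
  have up : ∀ v : Vertex m, InBand v → InBand (mirror m v) → isUp v.pos = true →
      ∃ i, crossing m i = v ∨ crossing m i = v.vert := by
    intro v hv hv' hu
    have hl := v.layer_le
    have h := two_mul_natCast_iff v.layer
    unfold InBand at hv'
    rw [pos_mirror] at hv'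
    rcases hv with e | e | e | e <;> rw [e] at hv' hu
    · exact absurd hu (by decide)
    · have := h.1.1 hv'
      exact ⟨some (.inl ⟨v.layer / 3, by omega⟩), Or.inl (Vertex.ext
        (show 3 * (v.layer / 3) + 2 = _ by omega) e.symm)⟩
    · exact absurd hu (by decide)
    · have h2 := h.2.1 hv'
      -- In the top layer position 10 is the other end of the chord already counted at position 4;
      -- this is why the second summand is only `Fin m`.
      by_cases ht : v.layer = 3 * m + 2
      · refine ⟨some (.inl (Fin.last m)), Or.inr ?_⟩
        have H := vert_chord_top (v := v) (by rw [e]; decide) ht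
        exact Vertex.ext H.1.symm (by rw [H.2, e]; change (4 : ZMod 12) = 2 - 10; decide)
      · exact ⟨some (.inr ⟨v.layer / 3, by omega⟩), Or.inl (Vertex.ext
          (show 3 * (v.layer / 3) + 2 = _ by omega) e.symm)⟩
  cases hu : isUp v.pos
  · rcases v.vert_cases with H | H | H | H
    · simp [hu] at H
    · obtain ⟨i, hi⟩ := up v.vert (inBand_vert hv) (by rw [mirror_vert]; exact inBand_vert hv')
        (by rw [H.2.2.2.1, isUp_add_one, hu]; rfl)
      rw [vert_vert] at hi
      exact ⟨i, hi.symm⟩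
    · simp [hu] at H
    · have h0 := v.bot_iff.1 H.2.1
      refine ⟨none, ?_⟩
      rcases H.2.2.2.2.2.2.2 with e | e
      · exact Or.inl (Vertex.ext h0.symm e.symm)
      · exact Or.inr (Vertex.ext (by rw [H.2.2.2.1, h0]; rfl) (by
          rw [H.2.2.2.2.1, e]; change (3 : ZMod 12) = -9; decide))
  · exact up v hv hv' hu

theorem crossing_injective (m : ℕ) :
    Function.Injective fun i => (dartV (crossing m i)).edge := by
  have hup : ∀ i, isUp (crossing m (some i)).pos = true := by
    rintro (i | i)
    · change isUp 4 = true; decide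
    · change isUp 10 = true; decide
  have hpos : ∀ i j, crossing m (some i) ≠ (crossing m (some j)).vert := by
    intro i j h
    rcases (crossing m (some j)).vert_cases with H | H | H | H
    · have := hup i
      rw [h, H.2.2.2.1, isUp_sub_one, hup j] at this
      simp at this
    · simp [hup j] at H
    · have ht := (top_iff _).1 H.2.1
      have hl := congrArg layer h
      rw [H.2.2.2.1, ht] at hl
      have hp := congrArg pos h
      rw [H.2.2.2.2.1] at hp
      rcases i with i | i <;> rcases j with j | j
      · exact absurd (show (4 : ZMod 12) = 2 - 4 from hp) (by decide)
      · have : 3 * j.1 + 2 = 3 * m + 2 := ht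
        omega
      · have : 3 * i.1 + 2 = 3 * m + 2 := hl
        omega
      · exact absurd (show (10 : ZMod 12) = 2 - 10 from hp) (by decide)
    · simp [hup j] at H
  have hnone : ∀ i, crossing m none ≠ crossing m (some i) ∧
      crossing m none ≠ (crossing m (some i)).vert := by
    intro i
    have hl : (crossing m (some i)).layer ≠ 0 ∧ (crossing m (some i)).layer ≠ 1 := by
      rcases i with i | i
      · exact ⟨by change 3 * i.1 + 2 ≠ 0; omega, by change 3 * i.1 + 2 ≠ 1; omega⟩
      · exact ⟨by change 3 * i.1 + 2 ≠ 0; omega, by change 3 * i.1 + 2 ≠ 1; omega⟩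
    constructor
    · intro h
      exact hl.1 (congrArg layer h).symm
    · intro h
      have h := congrArg layer h
      rw [show (crossing m none).layer = 0 from rfl] at h
      rcases (crossing m (some i)).vert_cases with H | H | H | H <;> omega
  rintro (_ | i) (_ | j) h
  · rfl
  · rcases edge_dartV_eq_iff.1 h with h | h
    exacts [absurd h (hnone j).1, absurd h (hnone j).2]
  · rcases edge_dartV_eq_iff.1 h.symm with h | h
    exacts [absurd h (hnone i).1, absurd h (hnone i).2]
  · rcases edge_dartV_eq_iff.1 h with h | h
    · have h1 := congrArg layer h
      have h2 := congrArg pos h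
      rcases i with i | i <;> rcases j with j | j
      · have : 3 * i.1 + 2 = 3 * j.1 + 2 := h1
        congr 2; ext; omega
      · exact absurd (show (4 : ZMod 12) = 10 from h2) (by decide)
      · exact absurd (show (10 : ZMod 12) = 4 from h2) (by decide)
      · have : 3 * i.1 + 2 = 3 * j.1 + 2 := h1
        congr 2; ext; omega
    · exact absurd h (hpos i j)

theorem exists_zigzags (m : ℕ) :
    ∃ Z₁ Z₂ : (rotation m).Zigzag, Z₁ ≠ Z₂ ∧ Z₁.IsSimple ∧ Z₂.IsSimple ∧
      (Z₁.edges ∩ Z₂.edges).ncard = 2 * m + 2 := by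
  refine ⟨(rotation m).zigzagOf (baseState m),
    (rotation m).zigzagOf (mapState (mirror m) (baseState m)), ?_, ?_, ?_, ?_⟩
  -- The mirror image passes a vertical edge with the flag `true`, which never happens on the first
  -- zigzag.
  · intro h
    rw [zigzagOf_mirror_eq_iff] at h
    obtain ⟨v, -, h | h⟩ := h
    · simpa [mapState, baseState] using congrArg Prod.snd h
    · have h := dart_eq_iff.1 (congrArg Prod.fst h)
      have h1 : mirror m (baseChord m) = v := h.1
      have h2 : mirror m (baseChord m).vert = across v := h.2
      exact across_ne_vert v (by rw [← h2, ← h1, mirror_vert])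
  · intro x y hx hy h
    exact bandStates_simple ((zigzagOf_eq_iff x).1 hx) ((zigzagOf_eq_iff y).1 hy) h
  · intro x y hx hy h
    have := bandStates_simple ((zigzagOf_mirror_eq_iff x).1 hx) ((zigzagOf_mirror_eq_iff y).1 hy)
      (by change ((mirror m).toHom.mapDart x.1).edge = ((mirror m).toHom.mapDart y.1).edge
          rw [edge_mirror, edge_mirror, h])
    rcases this with h | h
    · left; rw [← mapState_mapState y, h, mapState_mapState]
    · right; rw [← mapState_mapState y, h]
      change zigzagRev (mapState _ (mapState _ x)) = _
      rw [mapState_mapState]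
  · rw [common_edges]
    have : {e | ∃ v : Vertex m, InBand v ∧ InBand (mirror m v) ∧ (dartV v).edge = e} =
        (fun i => (dartV (crossing m i)).edge) '' Set.univ := by
      ext e
      constructor
      · rintro ⟨v, hv, hv', rfl⟩
        obtain ⟨i, hi⟩ := exists_crossing hv hv'
        exact ⟨i, trivial, hi⟩
      · rintro ⟨i, -, rfl⟩
        exact ⟨_, (crossing_mem i).1, (crossing_mem i).2, rfl⟩
    rw [this, Set.ncard_image_of_injective _ (crossing_injective m), Set.ncard_univ,
      Nat.card_eq_fintype_card]
    simp
    omega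

end CappedTube

namespace CappedTube

variable {m : ℕ}

open Vertex SymParam

/-! ### Classification of the automorphisms -/

/-- Layers and positions of the neighbours, with the top layer at height `t`. -/
def rawNeighbors (t : ℕ) (p : ℕ × ZMod 12) : List (ℕ × ZMod 12) :=
  [(p.1, leftPos (p.1 == 0) (p.1 == t) p.2), (p.1, rightPos (p.1 == 0) (p.1 == t) p.2),
    (if isUp p.2 then (if p.1 == t then p.1 else p.1 + 1) else p.1 - 1,
      vertPos (p.1 == 0) (p.1 == t) p.2)]

def Vertex.neighbors (v : Vertex m) : List (Vertex m) := [v.left, v.right, v.vert]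

theorem mem_neighbors {v w : Vertex m} : w ∈ v.neighbors ↔ (graph m).Adj v w := by
  simp [neighbors, adj_iff]

/-- Coordinates after lowering by `s` layers. -/
def Vertex.coord (s : ℕ) (v : Vertex m) : ℕ × ZMod 12 := (v.layer - s, v.pos)

theorem coord_injective {s : ℕ} {v w : Vertex m} (hv : s ≤ v.layer) (hw : s ≤ w.layer)
    (h : v.coord s = w.coord s) : v = w := by
  have h1 := congrArg Prod.fst h
  simp only [coord] at h1
  have h2 := congrArg Prod.snd h
  exact Vertex.ext (by omega) h2

/-- Lowering the tube does not change neighbourhoods as long as the vertex does not become part of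
the bottom and the height `t` is consistent with the top. This reduces statements about tubes of any
length to finitely many cases. -/
theorem map_coord_neighbors {s t : ℕ} (v : Vertex m) (hs : s = 0 ∨ s < v.layer)
    (ht : v.layer = 3 * m + 2 ↔ v.layer - s = t) :
    v.neighbors.map (coord s) = rawNeighbors t (v.coord s) := by
  have hb : v.bot = (v.layer - s == 0) := by
    unfold bot
    rw [Bool.eq_iff_iff]
    simp only [beq_iff_eq]
    omega
  have htt : v.top = (v.layer - s == t) := by
    unfold top
    rw [Bool.eq_iff_iff]
    simp only [beq_iff_eq]
    exact ht
  have e : (v.layer == 3 * m + 2) = v.top := rfl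
  have hB := v.bot_iff
  simp only [neighbors, List.map_cons, List.map_nil, rawNeighbors, coord, layer_left, layer_right,
    pos_left, pos_right, layer_vert, pos_vert, ← hb, ← htt, vertLayer, e]
  congr 4
  split_ifs
  · rfl
  · omega
  · omega

/-- Some two neighbours of the vertex do not lie on a common pentagon with it. -/
def pentagonGap (t : ℕ) (p : ℕ × ZMod 12) : Bool :=
  (rawNeighbors t p).any fun a => (rawNeighbors t p).any fun b => a != b &&
    (rawNeighbors t a).all fun x => (rawNeighbors t b).all fun y =>
      x == p || y == p || !(rawNeighbors t x).contains y

/-- Any two neighbours of the vertex lie on a common cycle of length five with it. -/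
def OnThreePentagons (v : Vertex m) : Prop :=
  ∀ a b, (graph m).Adj v a → (graph m).Adj v b → a ≠ b →
    ∃ x y, (graph m).Adj a x ∧ (graph m).Adj x y ∧ (graph m).Adj y b ∧ x ≠ v ∧ y ≠ v

theorem OnThreePentagons.map {v : Vertex m} (h : OnThreePentagons v) (f : graph m ≃g graph m) :
    OnThreePentagons (f v) := by
  intro a b ha hb hab
  obtain ⟨x, y, h1, h2, h3, h4, h5⟩ := h (f.symm a) (f.symm b)
    (by rw [← f.map_adj_iff]; simpa using ha) (by rw [← f.map_adj_iff]; simpa using hb)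
    (fun e => hab (f.symm.injective e))
  refine ⟨f x, f y, ?_, f.map_adj_iff.2 h2, ?_, fun e => h4 (f.injective e),
    fun e => h5 (f.injective e)⟩
  · rw [← f.map_adj_iff] at h1; simpa using h1
  · rw [← f.map_adj_iff] at h3; simpa using h3

theorem layer_of_adj {v w : Vertex m} (h : (graph m).Adj v w) :
    w.layer ≤ v.layer + 1 ∧ v.layer ≤ w.layer + 1 := by
  rcases adj_iff.1 h with rfl | rfl | rfl
  · simp
  · simp
  · rcases v.vert_cases with H | H | H | H <;> omega

/-- The closed walks of length five in question stay within two layers of `v`. The three layers kept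
below `v` ensure that truncated subtraction loses no information on them. -/
theorem not_onThreePentagons_of_gap {s t : ℕ} {v : Vertex m} (hs : s = 0 ∨ s + 3 ≤ v.layer)
    (ht : ∀ u : Vertex m, u.layer ≤ v.layer + 2 → v.layer ≤ u.layer + 2 →
      (u.layer = 3 * m + 2 ↔ u.layer - s = t)) (h : pentagonGap t (v.coord s) = true) :
    ¬ OnThreePentagons v := by
  intro hT
  have hmap : ∀ u : Vertex m, u.layer ≤ v.layer + 2 → v.layer ≤ u.layer + 2 →
      u.neighbors.map (coord s) = rawNeighbors t (u.coord s) := fun u h1 h2 =>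
    map_coord_neighbors u (by omega) (ht u h1 h2)
  simp only [pentagonGap, List.any_eq_true, Bool.and_eq_true, bne_iff_ne, List.all_eq_true,
    Bool.or_eq_true, beq_iff_eq, Bool.not_eq_true', List.contains_eq_mem, decide_eq_false_iff_not] at h
  rw [← hmap v (by omega) (by omega)] at h
  simp only [List.mem_map] at h
  obtain ⟨a', ⟨a, ha, rfl⟩, b', ⟨b, hb, rfl⟩, hab, H⟩ := h
  rw [mem_neighbors] at ha hb
  obtain ⟨x, y, h1, h2, h3, h4, h5⟩ := hT a b ha hb (fun e => hab (by rw [e]))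
  have la := layer_of_adj ha
  have lb := layer_of_adj hb
  have lx := layer_of_adj h1
  have ly := layer_of_adj h3
  rw [← hmap a (by omega) (by omega), ← hmap b (by omega) (by omega)] at H
  rcases H (x.coord s) (List.mem_map_of_mem (mem_neighbors.2 h1)) (y.coord s)
    (List.mem_map_of_mem (mem_neighbors.2 h3.symm)) with (e | e) | e
  · exact h4 (coord_injective (by omega) (by omega) e)
  · exact h5 (coord_injective (by omega) (by omega) e)
  · rw [← hmap x (by omega) (by omega)] at e
    exact e (List.mem_map_of_mem (mem_neighbors.2 h2))

/-- The height 9 of the top is out of reach from the four lowest layers. Layer 3 stands for all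
higher layers that are at distance at least three from the top. -/
theorem pentagonGap_low : ∀ j : Fin 4, ∀ y : ZMod 12, present (j.1 == 0) false y = true →
    (j.1 = 0 ∧ (y = 0 ∨ y = 6)) ∨ pentagonGap 9 (j.1, y) = true := by decide

theorem onThreePentagons_low {v : Vertex m} (hv : v.layer + 3 ≤ 3 * m + 2)
    (h : OnThreePentagons v) : v.layer = 0 ∧ (v.pos = 0 ∨ v.pos = 6) := by
  have hp := v.present_pos
  have htop : v.top = false := by
    rw [Bool.eq_false_iff]; intro e; have := v.top_iff.1 e; omega
  rw [htop] at hp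
  by_cases h3 : v.layer < 4
  · rcases pentagonGap_low ⟨v.layer, h3⟩ v.pos hp with e | e
    · exact e
    · exact absurd h (not_onThreePentagons_of_gap (s := 0) (t := 9) (Or.inl rfl)
        (fun u _ _ => by omega) e)
  · rcases pentagonGap_low ⟨3, by norm_num⟩ v.pos (by
      rw [show v.bot = false by
        rw [Bool.eq_false_iff]; intro e; have := v.bot_iff.1 e; omega] at hp
      exact hp) with e | e
    · exact absurd e.1 (by norm_num)
    · refine absurd h (not_onThreePentagons_of_gap (s := v.layer - 3) (t := 9) (by omega)
        (fun u _ _ => by omega) ?_)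
      rwa [coord, show v.layer - (v.layer - 3) = 3 by omega]

/-- The two centres of the bottom cap. -/
def capA (m : ℕ) : Vertex m := base m 0 (by decide)
def capB (m : ℕ) : Vertex m := base m 6 (by decide)

theorem low_adj_iff {v w : Vertex m} (hv : v.layer ≤ 1) :
    (graph m).Adj v w ↔ w.coord 0 ∈ rawNeighbors 9 (v.coord 0) := by
  rw [← map_coord_neighbors v (Or.inl rfl) (by omega), ← mem_neighbors]
  constructor
  · exact fun h => List.mem_map_of_mem h
  · intro h
    obtain ⟨u, hu, e⟩ := List.mem_map.1 h
    rwa [← coord_injective (Nat.zero_le _) (Nat.zero_le _) e]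

theorem coord_left {v : Vertex m} (hv : v.layer ≤ 1) :
    v.left.coord 0 = (v.layer, leftPos (v.layer == 0) false v.pos) := by
  have : v.top = false := by
    rw [Bool.eq_false_iff]; intro e; have := v.top_iff.1 e; omega
  rw [coord, pos_left, this]; rfl

theorem coord_right {v : Vertex m} (hv : v.layer ≤ 1) :
    v.right.coord 0 = (v.layer, rightPos (v.layer == 0) false v.pos) := by
  have : v.top = false := by
    rw [Bool.eq_false_iff]; intro e; have := v.top_iff.1 e; omega
  rw [coord, pos_right, this]; rfl

theorem coord_vert {v : Vertex m} (hv : v.layer ≤ 1) :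
    v.vert.coord 0 = (if isUp v.pos then v.layer + 1 else v.layer - 1,
      vertPos (v.layer == 0) false v.pos) := by
  have : v.top = false := by
    rw [Bool.eq_false_iff]; intro e; have := v.top_iff.1 e; omega
  have e : (v.layer == 3 * m + 2) = v.top := rfl
  rw [coord, pos_vert, layer_vert, vertLayer, e, this]; rfl

theorem coord_capA : (capA m).coord 0 = (0, 0) := rfl
theorem coord_capB : (capB m).coord 0 = (0, 6) := rfl

theorem coord_capA_right : (capA m).right.coord 0 = (0, 2) := by
  rw [coord_right (v := capA m) (Nat.zero_le 1)]; rfl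
theorem coord_capA_left : (capA m).left.coord 0 = (0, 10) := by
  rw [coord_left (v := capA m) (Nat.zero_le 1)]; rfl
theorem coord_capA_vert : (capA m).vert.coord 0 = (1, 11) := by
  rw [coord_vert (v := capA m) (Nat.zero_le 1)]; rfl

/-- A vertex of the two lowest layers. -/
def low (m j : ℕ) (y : ZMod 12) (hj : j ≤ 1) (hy : present (j == 0) false y = true) : Vertex m :=
  mkVertex m j y (by omega) (by
    have : (j == 3 * m + 2) = false := by simp; omega
    rw [this]; exact hy)

theorem adj_low {j j' : ℕ} {y y' : ZMod 12} (hj hy hj' hy')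
    (h : (j', y') ∈ rawNeighbors 9 (j, y)) :
    (graph m).Adj (low m j y hj hy) (low m j' y' hj' hy') :=
  (low_adj_iff (show (low m j y hj hy).layer ≤ 1 from hj)).2 h

/-- The three pentagons are the face of the chord whose boundary has positions 3, 2, 0, 10, 9, and
the two faces shortened by the missing positions 1 and 11. -/
theorem onThreePentagons_capA : OnThreePentagons (capA m) := by
  have key : ∀ a b : Vertex m, ∀ p q : ℕ × ZMod 12, ∀ (h1 : p.1 ≤ 1) (h2 : q.1 ≤ 1)
      (h3 : present (p.1 == 0) false p.2 = true) (h4 : present (q.1 == 0) false q.2 = true),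
      a.coord 0 ∈ rawNeighbors 9 p → q ∈ rawNeighbors 9 p → b.coord 0 ∈ rawNeighbors 9 q →
      p ≠ (0, 0) → q ≠ (0, 0) →
      ∃ x y, (graph m).Adj a x ∧ (graph m).Adj x y ∧ (graph m).Adj y b ∧ x ≠ capA m ∧
        y ≠ capA m := by
    intro a b p q h1 h2 h3 h4 ha hpq hb hp hq
    refine ⟨low m p.1 p.2 h1 h3, low m q.1 q.2 h2 h4, ?_, adj_low _ _ _ _ hpq, ?_, ?_, ?_⟩
    · exact ((low_adj_iff (show (low m p.1 p.2 h1 h3).layer ≤ 1 from h1)).2 ha).symm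
    · exact (low_adj_iff (show (low m q.1 q.2 h2 h4).layer ≤ 1 from h2)).2 hb
    · exact fun e => hp (congrArg (coord 0) e)
    · exact fun e => hq (congrArg (coord 0) e)
  intro a b ha hb hab
  rcases adj_iff.1 ha with rfl | rfl | rfl <;> rcases adj_iff.1 hb with rfl | rfl | rfl
  · exact absurd rfl hab
  · exact key _ _ (0, 9) (0, 3) (by decide) (by decide) (by decide) (by decide)
      (by rw [coord_capA_left]; decide) (by decide) (by rw [coord_capA_right]; decide)
      (by decide) (by decide)
  · exact key _ _ (1, 9) (1, 10) (by decide) (by decide) (by decide) (by decide)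
      (by rw [coord_capA_left]; decide) (by decide) (by rw [coord_capA_vert]; decide)
      (by decide) (by decide)
  · exact key _ _ (0, 3) (0, 9) (by decide) (by decide) (by decide) (by decide)
      (by rw [coord_capA_right]; decide) (by decide) (by rw [coord_capA_left]; decide)
      (by decide) (by decide)
  · exact absurd rfl hab
  · exact key _ _ (1, 1) (1, 0) (by decide) (by decide) (by decide) (by decide)
      (by rw [coord_capA_right]; decide) (by decide) (by rw [coord_capA_vert]; decide)
      (by decide) (by decide)
  · exact key _ _ (1, 10) (1, 9) (by decide) (by decide) (by decide) (by decide)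
      (by rw [coord_capA_vert]; decide) (by decide) (by rw [coord_capA_left]; decide)
      (by decide) (by decide)
  · exact key _ _ (1, 0) (1, 1) (by decide) (by decide) (by decide) (by decide)
      (by rw [coord_capA_vert]; decide) (by decide) (by rw [coord_capA_right]; decide)
      (by decide) (by decide)
  · exact absurd rfl hab

/-! #### Rigidity -/

theorem left_left_ne : ∀ t y, isUp y = true → present false t y = true →
    isUp (leftPos false t y) = false ∧ isUp (rightPos false t y) = false ∧
    leftPos false t (leftPos false t y) ≠ rightPos false t (rightPos false t y) := by decide

/-- A vertex with a downward edge is the only neighbour of its lower end outside the fixed layers.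
Each remaining vertex of the layer lies between two such vertices, which have no other common
neighbour in that layer. -/
theorem fixes_next_layer (f : graph m ≃g graph m) (n : ℕ)
    (h : ∀ v : Vertex m, v.layer ≤ n → f v = v) : ∀ v : Vertex m, v.layer ≤ n + 1 → f v = v := by
  have hne : ∀ v w : Vertex m, v.layer = n + 1 → w.layer ≤ n → f v ≠ w := by
    intro v w hv hw e
    rw [← h w hw] at e
    have := f.injective e
    rw [this] at hv
    omega
  have down : ∀ v : Vertex m, v.layer = n + 1 → isUp v.pos = false → f v = v := by
    intro v hv hu
    have hd := vert_of_down hu (by omega)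
    have ha := f.map_adj_iff.2 (adj_vert v).symm
    rw [h v.vert (by omega)] at ha
    rcases adj_iff.1 ha with e | e | e
    · exact absurd e (hne _ _ hv (by simp; omega))
    · exact absurd e (hne _ _ hv (by simp; omega))
    · rw [e, vert_vert]
  intro v hv
  rcases Nat.lt_or_ge n v.layer with h1 | h1
  · have hv' : v.layer = n + 1 := by omega
    cases hu : isUp v.pos
    · exact down v hv' hu
    · have hb : v.bot = false := by
        rw [Bool.eq_false_iff]; intro e; have := v.bot_iff.1 e; omega
      have hp := v.present_pos
      rw [hb] at hp
      have K' := left_left_ne _ _ hu hp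
      have pl : v.left.pos = leftPos false v.top v.pos := by rw [pos_left, hb]
      have pr : v.right.pos = rightPos false v.top v.pos := by rw [pos_right, hb]
      have K : isUp v.left.pos = false ∧ isUp v.right.pos = false ∧
          v.left.left.pos ≠ v.right.right.pos := by
        have bl : v.left.bot = false := hb
        have br : v.right.bot = false := hb
        have tl : v.left.top = v.top := rfl
        have tr : v.right.top = v.top := rfl
        rw [pos_left v.left, pos_right v.right, bl, br, tl, tr, pl, pr]
        exact K'
      have L := down v.left hv' K.1
      have R := down v.right hv' K.2.1
      have dl := vert_of_down (v := v.left) K.1 (by simp; omega)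
      have dr := vert_of_down (v := v.right) K.2.1 (by simp; omega)
      rw [layer_left] at dl
      rw [layer_right] at dr
      have a1 := f.map_adj_iff.2 (adj_left v).symm
      have a2 := f.map_adj_iff.2 (adj_right v).symm
      rw [L] at a1
      rw [R] at a2
      rcases adj_iff.1 a1 with e1 | e1 | e1
      · rcases adj_iff.1 a2 with e2 | e2 | e2
        · rw [e2, left_right]
        · exact absurd (congrArg pos (e1.symm.trans e2)) K.2.2
        · exact absurd e2 (hne _ _ hv' (by omega))
      · rw [e1, right_left]
      · exact absurd e1 (hne _ _ hv' (by omega))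
  · exact h v h1

theorem eq_one_of_fixes_bottom (f : graph m ≃g graph m) (h : ∀ v : Vertex m, v.layer = 0 → f v = v) :
    f = 1 := by
  have : ∀ n, ∀ v : Vertex m, v.layer ≤ n → f v = v := by
    intro n
    induction n with
    | zero => exact fun v hv => h v (by omega)
    | succ n ih => exact fixes_next_layer f n ih
  ext v
  exact this _ v le_rfl

/-- The path `p, q, r, b` is pinned from its ends: the third neighbour `e` of `p` cannot continue to
`b` in two steps, and the third neighbour `q'` of `q` is not adjacent to `b`. -/
theorem fixes_path {V : Type*} {G : SimpleGraph V} (f : G ≃g G) {a p q e r q' b : V}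
    (hp : f p = p) (ha : f a = a) (hb : f b = b) (np : ∀ w, G.Adj p w → w = a ∨ w = q ∨ w = e)
    (hpq : G.Adj p q) (hqa : q ≠ a) (hqr : G.Adj q r) (hrb : G.Adj r b)
    (he : ∀ x, G.Adj e x → ¬ G.Adj x b) (nq : ∀ w, G.Adj q w → w = p ∨ w = r ∨ w = q')
    (hq' : ¬ G.Adj q' b) (hrp : r ≠ p) : f q = q ∧ f r = r := by
  have h1 := f.map_adj_iff.2 hpq
  have h2 := f.map_adj_iff.2 hqr
  have h3 := f.map_adj_iff.2 hrb
  rw [hp] at h1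
  rw [hb] at h3
  have hq : f q = q := by
    rcases np _ h1 with h | h | h
    · exact absurd (f.injective (h.trans ha.symm)) hqa
    · exact h
    · rw [h] at h2
      exact absurd h3 (he _ h2)
  refine ⟨hq, ?_⟩
  rw [hq] at h2
  rcases nq _ h2 with h | h | h
  · exact absurd (f.injective (h.trans hp.symm)) hrp
  · exact h
  · rw [h] at h3
    exact absurd h3 hq'

theorem low_neighbors {p : ℕ × ZMod 12} {j : ℕ} {y : ZMod 12} (hj hy) {w : Vertex m}
    (h : (graph m).Adj (low m j y hj hy) w) (hp : (j, y) = p) :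
    w.coord 0 ∈ rawNeighbors 9 p := by
  subst hp
  exact (low_adj_iff (show (low m j y hj hy).layer ≤ 1 from hj)).1 h

theorem eq_low {w : Vertex m} {j : ℕ} {y : ZMod 12} (hj hy) (h : w.coord 0 = (j, y)) :
    w = low m j y hj hy :=
  coord_injective (Nat.zero_le _) (Nat.zero_le _) h

theorem eq_one_of_fixes_cap (f : graph m ≃g graph m) (hA : f (capA m) = capA m)
    (hB : f (capB m) = capB m) (hr : f (capA m).right = (capA m).right)
    (hl : f (capA m).left = (capA m).left) : f = 1 := by
  rw [eq_low (j := 0) (y := 2) (by decide) (by decide) coord_capA_right] at hr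
  rw [eq_low (j := 0) (y := 10) (by decide) (by decide) coord_capA_left] at hl
  have far : ∀ (y : ZMod 12) (hy), (∀ c ∈ rawNeighbors 9 (0, 6), c ∉ rawNeighbors 9 (1, y)) →
      ∀ x, (graph m).Adj (low m 1 y (by decide) hy) x → ¬ (graph m).Adj x (capB m) := by
    intro y hy h x hx hx'
    exact h _ ((low_adj_iff (v := capB m) (Nat.zero_le 1)).1 hx'.symm)
      ((low_adj_iff (v := low m 1 y _ hy) le_rfl).1 hx)
  have nb : ∀ (y : ZMod 12) (hy) (p q r : ℕ × ZMod 12) (hp1 hp2 hq1 hq2 hr1 hr2),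
      rawNeighbors 9 (0, y) ⊆ [p, q, r] → ∀ w, (graph m).Adj (low m 0 y (by decide) hy) w →
      w = low m p.1 p.2 hp1 hp2 ∨ w = low m q.1 q.2 hq1 hq2 ∨ w = low m r.1 r.2 hr1 hr2 := by
    intro y hy p q r hp1 hp2 hq1 hq2 hr1 hr2 hsub w hw
    have := hsub ((low_adj_iff (v := low m 0 y _ hy) (Nat.zero_le 1)).1 hw)
    simp only [List.mem_cons, List.not_mem_nil, or_false] at this
    rcases this with h | h | h
    · exact Or.inl (eq_low _ _ h)
    · exact Or.inr (Or.inl (eq_low _ _ h))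
    · exact Or.inr (Or.inr (eq_low _ _ h))
  have ne : ∀ {j y j' y'} (hj hy hj' hy'), (j, y) ≠ (j', y') →
      low m j y hj hy ≠ low m j' y' hj' hy' := fun _ _ _ _ h e => h (congrArg (coord 0) e)
  -- Positions 3 and 4 are pinned along the path 2, 3, 4, 6 of the bottom ring; `P2` treats the path
  -- 10, 9, 8, 6 on the other side.
  have P1 := fixes_path f (a := capA m) (p := low m 0 2 (by decide) (by decide))
    (q := low m 0 3 (by decide) (by decide)) (e := low m 1 1 (by decide) (by decide))
    (r := low m 0 4 (by decide) (by decide)) (q' := low m 0 9 (by decide) (by decide))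
    (b := capB m) hr hA hB
    (nb 2 (by decide) (0, 0) (0, 3) (1, 1) (by decide) (by decide) (by decide) (by decide) (by decide)
      (by decide) (by decide))
    (adj_low (by decide) (by decide) (by decide) (by decide) (by decide)) (ne (j := 0) (y := 3) (j' := 0) (y' := 0) (by decide) (by decide) (by decide) (by decide)
      (by decide)) (adj_low (by decide) (by decide) (by decide) (by decide) (by decide))
    (adj_low (by decide) (by decide) (by decide) (by decide) (by decide)) (far 1 _ (by decide))
    (nb 3 (by decide) (0, 2) (0, 4) (0, 9) (by decide) (by decide) (by decide) (by decide) (by decide)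
      (by decide) (by decide))
    (fun h => absurd (low_neighbors _ _ h rfl) (by rw [coord_capB]; decide))
    (ne (j := 0) (y := 4) (j' := 0) (y' := 2) (by decide) (by decide) (by decide) (by decide)
      (by decide))
  have P2 := fixes_path f (a := capA m) (p := low m 0 10 (by decide) (by decide))
    (q := low m 0 9 (by decide) (by decide)) (e := low m 1 9 (by decide) (by decide))
    (r := low m 0 8 (by decide) (by decide)) (q' := low m 0 3 (by decide) (by decide))
    (b := capB m) hl hA hB
    (nb 10 (by decide) (0, 0) (0, 9) (1, 9) (by decide) (by decide) (by decide) (by decide) (by decide)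
      (by decide) (by decide))
    (adj_low (by decide) (by decide) (by decide) (by decide) (by decide)) (ne (j := 0) (y := 9) (j' := 0) (y' := 0) (by decide) (by decide) (by decide) (by decide)
      (by decide)) (adj_low (by decide) (by decide) (by decide) (by decide) (by decide))
    (adj_low (by decide) (by decide) (by decide) (by decide) (by decide)) (far 9 _ (by decide))
    (nb 9 (by decide) (0, 10) (0, 8) (0, 3) (by decide) (by decide) (by decide) (by decide) (by decide)
      (by decide) (by decide))
    (fun h => absurd (low_neighbors _ _ h rfl) (by rw [coord_capB]; decide))
    (ne (j := 0) (y := 8) (j' := 0) (y' := 10) (by decide) (by decide) (by decide) (by decide)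
      (by decide))
  refine eq_one_of_fixes_bottom f fun v hv => ?_
  have hp := v.present_pos
  rw [v.bot_iff.2 hv, show v.top = false by
    rw [Bool.eq_false_iff]; intro e; have := v.top_iff.1 e; omega] at hp
  have K : ∀ y, present true false y = true → y = 0 ∨ y = 2 ∨ y = 3 ∨ y = 4 ∨ y = 6 ∨ y = 8 ∨
    y = 9 ∨ y = 10 := by decide
  have E : ∀ y, v.pos = y → v.coord 0 = (0, y) := fun y hy => by rw [coord, hv, hy]
  rcases K _ hp with e | e | e | e | e | e | e | e
  · rw [eq_low (by decide) (by decide) (E _ e)]; exact hA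
  · rw [eq_low (by decide) (by decide) (E _ e)]; exact hr
  · rw [eq_low (by decide) (by decide) (E _ e)]; exact P1.1
  · rw [eq_low (by decide) (by decide) (E _ e)]; exact P1.2
  · rw [eq_low (by decide) (by decide) (E _ e)]; exact hB
  · rw [eq_low (by decide) (by decide) (E _ e)]; exact P2.2
  · rw [eq_low (by decide) (by decide) (E _ e)]; exact P2.1
  · rw [eq_low (by decide) (by decide) (E _ e)]; exact hl

theorem mirror_capA : mirror m (capA m) = capA m := by
  refine Vertex.ext rfl ?_
  rw [pos_mirror]
  change -(0 : ZMod 12) - 2 * ((0 : ℕ) : ZMod 12) = 0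
  simp

theorem mirror_capB : mirror m (capB m) = capB m := by
  refine Vertex.ext rfl ?_
  rw [pos_mirror]
  change -(6 : ZMod 12) - 2 * ((0 : ℕ) : ZMod 12) = 6
  simp only [Nat.cast_zero]; decide

/-- Both ring neighbours of `capA` are joined to `capB` by walks of length three, the vertical
neighbour is not. Hence the ring neighbours are fixed or exchanged, and in the second case composing
with `mirror` fixes them. -/
theorem eq_one_or_mirror (f : graph m ≃g graph m) (hA : f (capA m) = capA m)
    (hB : f (capB m) = capB m) : f = 1 ∨ f = mirror m := by
  have l0 : (0 : ℕ) ≤ 1 := by norm_num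
  -- the vertical neighbour has no walk of length three to the other centre
  have far : ∀ x z, (graph m).Adj (capA m).vert x → (graph m).Adj x z →
      ¬ (graph m).Adj z (capB m) := by
    intro x z hx hxz hz
    rw [eq_low (j := 1) (y := 11) (by decide) (by decide) coord_capA_vert] at hx
    have h1 := low_neighbors _ _ hx rfl
    have h2 := (low_adj_iff (v := capB m) l0).1 hz.symm
    rw [coord_capB] at h2
    have hzl : z.layer ≤ 1 := by
      have : ∀ c ∈ rawNeighbors 9 (0, 6), c.1 ≤ 1 := by decide
      exact this _ h2
    have h3 := (low_adj_iff hzl).1 hxz.symm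
    have : ∀ c ∈ rawNeighbors 9 (0, 6), ∀ d ∈ rawNeighbors 9 (1, 11), d ∉ rawNeighbors 9 c := by
      decide
    exact this _ h2 _ h1 h3
  have step : ∀ a x z, (graph m).Adj (capA m) a → (graph m).Adj a x → (graph m).Adj x z →
      (graph m).Adj z (capB m) → f a = (capA m).left ∨ f a = (capA m).right := by
    intro a x z h1 h2 h3 h4
    have k1 := f.map_adj_iff.2 h1
    have k2 := f.map_adj_iff.2 h2
    have k3 := f.map_adj_iff.2 h3
    have k4 := f.map_adj_iff.2 h4
    rw [hA] at k1
    rw [hB] at k4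
    rcases adj_iff.1 k1 with e | e | e
    · exact Or.inl e
    · exact Or.inr e
    · rw [e] at k2
      exact absurd k4 (far _ _ k2 k3)
  have hr := step (capA m).right (low m 0 3 (by decide) (by decide))
    (low m 0 4 (by decide) (by decide)) (adj_right _)
    ((low_adj_iff (v := (capA m).right) l0).2 (by
      rw [coord_capA_right]; change ((0, 3) : ℕ × ZMod 12) ∈ _; decide))
    (adj_low (by decide) (by decide) (by decide) (by decide) (by decide)) (adj_low (by decide) (by decide) (by decide) (by decide) (by decide))
  have hl := step (capA m).left (low m 0 9 (by decide) (by decide))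
    (low m 0 8 (by decide) (by decide)) (adj_left _)
    ((low_adj_iff (v := (capA m).left) l0).2 (by
      rw [coord_capA_left]; change ((0, 9) : ℕ × ZMod 12) ∈ _; decide))
    (adj_low (by decide) (by decide) (by decide) (by decide) (by decide)) (adj_low (by decide) (by decide) (by decide) (by decide) (by decide))
  have hlr : f (capA m).left ≠ f (capA m).right := fun e => left_ne_right _ (f.injective e)
  rcases hr with hr | hr
  · right
    have hl : f (capA m).left = (capA m).right := by
      rcases hl with h | h
      · exact absurd (h.trans hr.symm) hlr
      · exact h
    have ml : mirror m (capA m).left = (capA m).right := by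
      have := symFun_left (mirrorParam m) (capA m)
      rw [if_pos (show (mirrorParam m).refl = true from rfl)] at this
      rw [mirror_apply, this, ← mirror_apply, mirror_capA]
    have mr : mirror m (capA m).right = (capA m).left := by
      have := symFun_right (mirrorParam m) (capA m)
      rw [if_pos (show (mirrorParam m).refl = true from rfl)] at this
      rw [mirror_apply, this, ← mirror_apply, mirror_capA]
    have h1 : mirror m * f = 1 := eq_one_of_fixes_cap _
      (by rw [RelIso.mul_apply, hA, mirror_capA]) (by rw [RelIso.mul_apply, hB, mirror_capB])
      (by rw [RelIso.mul_apply, hr, ml]) (by rw [RelIso.mul_apply, hl, mr])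
    have h2 : mirror m * mirror m = 1 := by ext v; exact mirror_mirror v
    exact mul_left_cancel (h1.trans h2.symm)
  · left
    refine eq_one_of_fixes_cap f hA hB hr ?_
    rcases hl with h | h
    · exact h
    · exact absurd (h.trans hr.symm) hlr

/-! #### Long tubes -/

def rotParam (m : ℕ) : SymParam m := ⟨(false, false, 6), by simp; decide⟩

def oneParam (m : ℕ) : SymParam m := ⟨(false, false, 0), by simp⟩

theorem symFun_one (v : Vertex m) : symFun (oneParam m) v = v := by
  refine Vertex.ext rfl ?_
  rw [pos_symFun]
  change 1 * (v.pos + v.layer) + 0 - v.layer = v.pos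
  ring

def flipParam (m : ℕ) : SymParam m :=
  ⟨(true, true, ((3 * m + 3 : ℕ) : ZMod 12)), by simp⟩

theorem symFun_flip (v : Vertex m) :
    (symFun (flipParam m) v).layer = 3 * m + 2 - v.layer ∧
      (symFun (flipParam m) v).pos = 1 - v.pos := by
  refine ⟨rfl, ?_⟩
  have hl := v.layer_le
  rw [pos_symFun]
  change -1 * (v.pos + v.layer) + ((3 * m + 3 : ℕ) : ZMod 12) - ((3 * m + 2 - v.layer : ℕ) : ZMod 12)
    = _
  push_cast [hl]
  ring

theorem symFun_flip_flip (v : Vertex m) : symFun (flipParam m) (symFun (flipParam m) v) = v := by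
  have h1 := symFun_flip v
  have h2 := symFun_flip (symFun (flipParam m) v)
  have := v.layer_le
  exact Vertex.ext (by omega) (by rw [h2.2, h1.2]; ring)

theorem symFun_rot_capA : symFun (rotParam m) (capA m) = capB m := by
  refine Vertex.ext rfl ?_
  rw [pos_symFun]
  change 1 * ((0 : ZMod 12) + ((0 : ℕ) : ZMod 12)) + 6 - ((0 : ℕ) : ZMod 12) = 6
  simp

theorem symFun_rot_capB : symFun (rotParam m) (capB m) = capA m := by
  refine Vertex.ext rfl ?_
  rw [pos_symFun]
  change 1 * ((6 : ZMod 12) + ((0 : ℕ) : ZMod 12)) + 6 - ((0 : ℕ) : ZMod 12) = 0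
  simp only [Nat.cast_zero]; decide

theorem onThreePentagons_capB : OnThreePentagons (capB m) := by
  have := onThreePentagons_capA.map (sym (rotParam m))
  rwa [sym_apply, symFun_rot_capA] at this

/-- With at least six layers, a vertex within two layers of the top is moved by the flip to a place
where the analysis of the lower part applies. -/
theorem onThreePentagons_cases (hm : 1 ≤ m) {v : Vertex m} (h : OnThreePentagons v) :
    v = capA m ∨ v = capB m ∨ v = symFun (flipParam m) (capA m) ∨
      v = symFun (flipParam m) (capB m) := by
  have low : ∀ v : Vertex m, v.layer + 3 ≤ 3 * m + 2 → OnThreePentagons v →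
      v = capA m ∨ v = capB m := by
    intro v hv h
    rcases onThreePentagons_low hv h with ⟨h0, h1 | h1⟩
    exacts [Or.inl (Vertex.ext h0 h1), Or.inr (Vertex.ext h0 h1)]
  by_cases hv : v.layer + 3 ≤ 3 * m + 2
  · rcases low v hv h with e | e
    exacts [Or.inl e, Or.inr (Or.inl e)]
  · have h' := h.map (sym (flipParam m))
    rw [sym_apply] at h'
    have hl := (symFun_flip v).1
    rw [← symFun_flip_flip v]
    rcases low _ (by omega) h' with e | e <;> rw [e]
    exacts [Or.inr (Or.inr (Or.inl rfl)), Or.inr (Or.inr (Or.inr rfl))]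

theorem sym_surjective (hm : 1 ≤ m) (f : graph m ≃g graph m) : ∃ x, f = sym x := by
  have hA := onThreePentagons_cases hm (onThreePentagons_capA.map f)
  have hB := onThreePentagons_cases hm (onThreePentagons_capB.map f)
  have hne : f (capA m) ≠ f (capB m) := fun e => by
    have := congrArg (coord 0) (f.injective e)
    rw [coord_capA, coord_capB] at this
    exact absurd this (by decide)
  -- The two centres of a cap are joined by a walk of length four, whereas the caps are at least
  -- five layers apart; so their images lie in one cap.
  have walk : (f (capA m)).layer ≤ (f (capB m)).layer + 4 ∧
      (f (capB m)).layer ≤ (f (capA m)).layer + 4 := by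
    have h1 := layer_of_adj (f.map_adj_iff.2 (adj_low (m := m) (j := 0) (y := 0) (j' := 0) (y' := 2)
      (by decide) (by decide) (by decide) (by decide) (by decide)))
    have h2 := layer_of_adj (f.map_adj_iff.2 (adj_low (m := m) (j := 0) (y := 2) (j' := 0) (y' := 3)
      (by decide) (by decide) (by decide) (by decide) (by decide)))
    have h3 := layer_of_adj (f.map_adj_iff.2 (adj_low (m := m) (j := 0) (y := 3) (j' := 0) (y' := 4)
      (by decide) (by decide) (by decide) (by decide) (by decide)))
    have h4 := layer_of_adj (f.map_adj_iff.2 (adj_low (m := m) (j := 0) (y := 4) (j' := 0) (y' := 6)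
      (by decide) (by decide) (by decide) (by decide) (by decide)))
    change _ ∧ (f (capA m)).layer ≤ _ at h1
    change (f (capB m)).layer ≤ _ ∧ _ at h4
    have h1' : _ ≤ (f (capA m)).layer + 1 := h1.1
    have h4' : _ ≤ (f (capB m)).layer + 1 := h4.2
    omega
  have fin : ∀ x : SymParam m, f (capA m) = symFun x (capA m) → f (capB m) = symFun x (capB m) →
      ∃ x, f = sym x := by
    intro x h1 h2
    have e1 : ((sym x)⁻¹ * f) (capA m) = capA m := by
      rw [RelIso.mul_apply, h1, ← sym_apply, ← RelIso.mul_apply, inv_mul_cancel]; rfl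
    have e2 : ((sym x)⁻¹ * f) (capB m) = capB m := by
      rw [RelIso.mul_apply, h2, ← sym_apply, ← RelIso.mul_apply, inv_mul_cancel]; rfl
    rcases eq_one_or_mirror _ e1 e2 with h | h
    · exact ⟨x, (inv_mul_eq_one.1 h).symm⟩
    · exact ⟨x.mul (mirrorParam m), by rw [← sym_mul, ← mirror, ← h]; group⟩
  have lA : (symFun (flipParam m) (capA m)).layer = 3 * m + 2 := rfl
  have lB : (symFun (flipParam m) (capB m)).layer = 3 * m + 2 := rfl
  have l0 : (capA m).layer = 0 := rfl
  have l1 : (capB m).layer = 0 := rfl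
  rcases hA with a | a | a | a <;> rcases hB with b | b | b | b <;> rw [a, b] at hne walk
  · exact absurd rfl hne
  · exact fin (oneParam m) (by rw [symFun_one, a]) (by rw [symFun_one, b])
  · omega
  · omega
  · exact fin (rotParam m) (by rw [a, symFun_rot_capA]) (by rw [b, symFun_rot_capB])
  · exact absurd rfl hne
  · omega
  · omega
  · omega
  · omega
  · exact absurd rfl hne
  · exact fin (flipParam m) a b
  · omega
  · omega
  · exact fin ((flipParam m).mul (rotParam m)) (by rw [symFun_mul, symFun_rot_capA, a])
      (by rw [symFun_mul, symFun_rot_capB, b])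
  · exact absurd rfl hne

/-- The image of `capA`, in column 0, shows the shift and whether the ends are exchanged; its right
neighbour, in column 2, shows the sense of rotation. -/
theorem sym_injective : Function.Injective (sym : SymParam m → _) := by
  intro x y h
  have hf : ∀ v, symFun x v = symFun y v := fun v => DFunLike.congr_fun h v
  have hc := fun v => congrArg col (hf v)
  simp only [col_symFun] at hc
  have c0 := hc (capA m)
  have c1 := hc (capA m).right
  have e0 : (capA m).col = 0 := by
    change (0 : ZMod 12) + ((0 : ℕ) : ZMod 12) = 0; simp
  have e1 : (capA m).right.col = 2 := by
    have := congrArg Prod.snd (coord_capA_right (m := m))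
    change (capA m).right.pos = 2 at this
    rw [col, this]; change (2 : ZMod 12) + ((0 : ℕ) : ZMod 12) = 2; simp
  rw [e0] at c0
  rw [e1] at c1
  have hs : x.shift = y.shift := by simpa using c0
  refine SymParam.ext ?_ ?_ hs
  · have := congrArg layer (hf (capA m))
    simp only [layer_symFun] at this
    have l0 : (capA m).layer = 0 := rfl
    rw [l0] at this
    cases hx : x.swap <;> cases hy : y.swap <;> simp [hx, hy] at this <;> rfl
  · rw [hs] at c1
    have c2 := add_right_cancel c1
    revert c2
    cases x.refl <;> cases y.refl <;> decide

end CappedTube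

/-! ### Recognising a point group; faces under automorphisms -/

namespace RotationSystem

variable {V : Type*} {G : SimpleGraph V} {R : RotationSystem G}

/-- Since no automorphism both preserves and reverses orientation, it suffices to exhibit one of the
two for each automorphism, together with the matching determinant; the equivalences follow. -/
theorem hasPointGroup_of_injective (Φ : (G ≃g G) →* Matrix.orthogonalGroup (Fin 3) ℝ)
    (hinj : Function.Injective Φ) {P : Subgroup (Matrix.orthogonalGroup (Fin 3) ℝ)}
    (hP : Φ.range = P)
    (hnot : ∀ f, R.PreservesOrientation f → R.ReversesOrientation f → False)
    (hor : ∀ f, R.PreservesOrientation f ∧ (Φ f : Matrix (Fin 3) (Fin 3) ℝ).det = 1 ∨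
      R.ReversesOrientation f ∧ (Φ f : Matrix (Fin 3) (Fin 3) ℝ).det = -1)
    (hfix : ∀ f, R.FixesCell f ↔
      ∃ x : Fin 3 → ℝ, x ≠ 0 ∧ Matrix.mulVec (Φ f : Matrix (Fin 3) (Fin 3) ℝ) x = x) :
    R.HasPointGroup P := by
  subst hP
  refine ⟨MonoidHom.ofInjective hinj, fun f => ⟨?_, ?_, hfix f⟩⟩ <;>
    rw [MonoidHom.ofInjective_apply]
  · rcases hor f with ⟨h1, h2⟩ | ⟨h1, h2⟩
    · simp [h1, h2]
    · rw [h2]; exact ⟨fun h => (hnot f h h1).elim, fun h => by norm_num at h⟩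
  · rcases hor f with ⟨h1, h2⟩ | ⟨h1, h2⟩
    · rw [h2]; exact ⟨fun h => (hnot f h1 h).elim, fun h => by norm_num at h⟩
    · simp [h1, h2]

/-- An orientation-preserving automorphism commutes with `faceNext`, so it maps face cycles to face
cycles; a single dart returning to its face decides the matter. -/
theorem Face.edges_image_of_preserves {f : G ≃g G} (hf : R.PreservesOrientation f) {d : G.Dart}
    (h : R.faceOf (f.toHom.mapDart d) = R.faceOf d) :
    Sym2.map f '' (R.faceOf d).edges = (R.faceOf d).edges := by
  have hrot : ∀ d, f.toHom.mapDart (R.rot.symm d) = R.rot.symm (f.toHom.mapDart d) := by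
    intro d
    rw [Equiv.eq_symm_apply, ← hf, Equiv.apply_symm_apply]
  have hnext : ∀ d, f.toHom.mapDart (R.faceNext d) = R.faceNext (f.toHom.mapDart d) := by
    intro d
    exact hrot d.symm
  have hnat : ∀ (n : ℕ) d, f.toHom.mapDart ((R.faceNext ^ n) d) =
      (R.faceNext ^ n) (f.toHom.mapDart d) := by
    intro n
    induction n with
    | zero => intro d; rfl
    | succ n ih =>
      intro d
      rw [pow_succ, Equiv.Perm.mul_apply, ih, hnext, Equiv.Perm.mul_apply]
  have hint : ∀ (i : ℤ) d, f.toHom.mapDart ((R.faceNext ^ i) d) =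
      (R.faceNext ^ i) (f.toHom.mapDart d) := by
    intro i d
    obtain ⟨n, rfl | rfl⟩ := i.eq_nat_or_neg
    · exact hnat n d
    · rw [zpow_neg, zpow_natCast, Equiv.Perm.eq_inv_iff_eq, ← hnat]
      simp
  have hiff : ∀ d d', R.faceOf d = R.faceOf d' ↔ R.faceNext.SameCycle d d' := fun d d' =>
    Quotient.eq (r := Equiv.Perm.SameCycle.setoid R.faceNext)
  rw [hiff] at h
  ext e
  constructor
  · rintro ⟨_, ⟨d', hd', rfl⟩, rfl⟩
    obtain ⟨i, hi⟩ := (hiff _ _).1 hd'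
    refine ⟨f.toHom.mapDart d', (hiff _ _).2 (Equiv.Perm.SameCycle.trans ⟨i, ?_⟩ h), ?_⟩
    · rw [← hint, hi]
    · rfl
  · rintro ⟨d', hd', rfl⟩
    obtain ⟨i, hi⟩ := h.trans ((hiff _ _).1 hd').symm
    refine ⟨((R.faceNext ^ i) d).edge, ⟨_, (hiff _ _).2 ⟨-i, by simp⟩, rfl⟩, ?_⟩
    rw [← hi, ← hint]
    rfl

end RotationSystem

namespace CappedTube

variable {m : ℕ}

open Vertex SymParam

/-! ### The symmetries as isometries -/

/-- Cosines and sines of the multiples of a right angle, which is three columns wide. -/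
def cosTable (c : ZMod 12) : ℤ := if c = 0 then 1 else if c = 6 then -1 else 0
def sinTable (c : ZMod 12) : ℤ := if c = 3 then 1 else if c = 9 then -1 else 0

theorem table_add : ∀ a b : ZMod 12, 4 * a = 0 → 4 * b = 0 →
    cosTable (a + b) = cosTable a * cosTable b - sinTable a * sinTable b ∧
    sinTable (a + b) = sinTable a * cosTable b + cosTable a * sinTable b := by decide

theorem table_neg : ∀ a : ZMod 12, cosTable (-a) = cosTable a ∧ sinTable (-a) = -sinTable a := by
  decide

theorem table_sq : ∀ a : ZMod 12, 4 * a = 0 →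
    cosTable a * cosTable a + sinTable a * sinTable a = 1 := by
  decide

theorem SymParam.four_mul_shift (x : SymParam m) : 4 * x.shift = 0 := by
  cases h : x.swap
  · linear_combination 2 * shift_of_not_swap h
  · linear_combination 2 * shift_of_swap h + four_mul_eq_zero m

def boolSign (e : Bool) : ℤ := if e then -1 else 1

/-- The matrix of the symmetry with given parameters. -/
def symMatrix (x : SymParam m) : Matrix (Fin 3) (Fin 3) ℝ :=
  !![(cosTable x.shift : ℝ), -(boolSign x.refl * sinTable x.shift : ℤ), 0;
    (sinTable x.shift : ℝ), (boolSign x.refl * cosTable x.shift : ℤ), 0;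
    0, 0, (boolSign x.swap : ℝ)]

theorem symMatrix_mul (x y : SymParam m) : symMatrix (x.mul y) = symMatrix x * symMatrix y := by
  have e1 : (x.mul y).swap = xor x.swap y.swap := rfl
  have e2 : (x.mul y).refl = xor x.refl y.refl := rfl
  have e3 : (x.mul y).shift = x.shift + signOf x.refl * y.shift := rfl
  have hs : boolSign (x.mul y).swap = boolSign x.swap * boolSign y.swap := by
    rw [e1]; cases x.swap <;> cases y.swap <;> rfl
  have hr : boolSign (x.mul y).refl = boolSign x.refl * boolSign y.refl := by
    rw [e2]; cases x.refl <;> cases y.refl <;> rfl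
  have hσ : boolSign x.refl * boolSign x.refl = 1 := by cases x.refl <;> rfl
  have hx := x.four_mul_shift
  have hy := y.four_mul_shift
  have hc : cosTable (x.mul y).shift = cosTable x.shift * cosTable y.shift -
      boolSign x.refl * (sinTable x.shift * sinTable y.shift) ∧
      sinTable (x.mul y).shift = sinTable x.shift * cosTable y.shift +
      boolSign x.refl * (cosTable x.shift * sinTable y.shift) := by
    rw [e3]
    cases x.refl
    · have := table_add _ _ hx hy
      simpa [signOf, boolSign] using this
    · have := table_add x.shift (-y.shift) hx (by rw [mul_neg, hy, neg_zero])
      rw [(table_neg _).1, (table_neg _).2] at this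
      simpa [signOf, boolSign] using this
  have hσ' : (boolSign x.refl : ℝ) * boolSign x.refl = 1 := by exact_mod_cast hσ
  ext i j
  fin_cases i <;> fin_cases j <;>
    simp [symMatrix, Matrix.mul_apply, Fin.sum_univ_three, hs, hr, hc.1, hc.2] <;>
    first
      | ring1
      | linear_combination (-(sinTable x.shift : ℝ) * sinTable y.shift * boolSign y.refl) * hσ'
      | linear_combination (-(cosTable x.shift : ℝ) * sinTable y.shift * boolSign y.refl) * hσ'

theorem boolSign_mul_self (e : Bool) : (boolSign e : ℝ) * boolSign e = 1 := by
  cases e <;> simp [boolSign]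

theorem symMatrix_mem (x : SymParam m) : symMatrix x ∈ Matrix.orthogonalGroup (Fin 3) ℝ := by
  have h : (cosTable x.shift : ℝ) * cosTable x.shift + sinTable x.shift * sinTable x.shift = 1 := by
    exact_mod_cast table_sq _ x.four_mul_shift
  have hs := boolSign_mul_self x.swap
  have hr := boolSign_mul_self x.refl
  rw [Matrix.mem_orthogonalGroup_iff]
  ext i j
  fin_cases i <;> fin_cases j <;>
    simp [symMatrix, Matrix.mul_apply, Fin.sum_univ_three] <;>
    first
      | linear_combination h + ((sinTable x.shift : ℝ) * sinTable x.shift) * hr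
      | linear_combination h + ((cosTable x.shift : ℝ) * cosTable x.shift) * hr
      | linear_combination (-(cosTable x.shift : ℝ) * sinTable x.shift) * hr
      | linear_combination hs

theorem det_symMatrix (x : SymParam m) :
    (symMatrix x).det = if x.swap = x.refl then 1 else -1 := by
  have h : (cosTable x.shift : ℝ) * cosTable x.shift + sinTable x.shift * sinTable x.shift = 1 := by
    exact_mod_cast table_sq _ x.four_mul_shift
  rw [Matrix.det_fin_three]
  simp [symMatrix]
  cases x.swap <;> cases x.refl <;> simp [boolSign] <;> linarith

theorem symMatrix_injective : Function.Injective (symMatrix : SymParam m → _) := by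
  intro x y h
  have h1 : (cosTable x.shift : ℝ) = cosTable y.shift := congrFun (congrFun h 0) 0
  have h2 : (sinTable x.shift : ℝ) = sinTable y.shift := congrFun (congrFun h 1) 0
  have h3 : (boolSign x.swap : ℝ) = boolSign y.swap := congrFun (congrFun h 2) 2
  -- Once `swap` is known, the determinant determines `refl`.
  have h4 := congrArg Matrix.det h
  rw [det_symMatrix, det_symMatrix] at h4
  have key : ∀ a b : ZMod 12, 4 * a = 0 → 4 * b = 0 → cosTable a = cosTable b →
    sinTable a = sinTable b → a = b := by decide
  have hs : x.swap = y.swap := by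
    cases hx : x.swap <;> cases hy : y.swap <;> rw [hx, hy] at h3 <;> norm_num [boolSign] at h3
  refine SymParam.ext hs ?_ (key _ _ x.four_mul_shift y.four_mul_shift (by exact_mod_cast h1)
    (by exact_mod_cast h2))
  rw [hs] at h4
  cases hx : x.refl <;> cases hy : y.refl <;> cases hz : y.swap <;> rw [hx, hy, hz] at h4 <;>
    norm_num at h4

/-- Without exchange of the ends the tube axis is fixed. Exchange with reversal is a half-turn about
a horizontal axis. Exchange alone negates the axis and turns the horizontal plane, which leaves a
fixed vector only when there is no turn. -/
theorem symMatrix_fixes_iff (x : SymParam m) :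
    (∃ v : Fin 3 → ℝ, v ≠ 0 ∧ Matrix.mulVec (symMatrix x) v = v) ↔
      (x.swap = true → x.refl = false → x.shift = 0) := by
  constructor
  · rintro ⟨v, hv, h⟩ hs hr
    by_contra hc
    apply hv
    have h0 := congrFun h 0
    have h1 := congrFun h 1
    have h2 := congrFun h 2
    simp [symMatrix, Matrix.mulVec, dotProduct, Fin.sum_univ_three, hs, hr, boolSign] at h0 h1 h2
    have key : ∀ c : ZMod 12, 4 * c = 0 → c ≠ 0 → c = 3 ∨ c = 6 ∨ c = 9 := by decide
    have v2 : v 2 = 0 := by linarith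
    have : v 0 = 0 ∧ v 1 = 0 := by
      rcases key _ x.four_mul_shift hc with e | e | e <;> rw [e] at h0 h1 <;>
        [rw [show cosTable 3 = 0 from rfl, show sinTable 3 = 1 from rfl] at h0 h1;
        rw [show cosTable 6 = -1 from rfl, show sinTable 6 = 0 from rfl] at h0 h1;
        rw [show cosTable 9 = 0 from rfl, show sinTable 9 = -1 from rfl] at h0 h1] <;>
        push_cast at h0 h1 <;> constructor <;> linarith
    ext i
    fin_cases i
    exacts [this.1, this.2, v2]
  · intro h
    cases hs : x.swap
    · refine ⟨![0, 0, 1], fun e => by simpa using congrFun e 2, ?_⟩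
      ext i
      fin_cases i <;>
        simp [symMatrix, Matrix.mulVec, dotProduct, Fin.sum_univ_three, hs, boolSign]
    · cases hr : x.refl
      · refine ⟨![1, 0, 0], fun e => by simpa using congrFun e 0, ?_⟩
        rw [symMatrix, h hs hr, show cosTable 0 = 1 from rfl, show sinTable 0 = 0 from rfl]
        ext i
        fin_cases i <;> simp [Matrix.mulVec, dotProduct, Fin.sum_univ_three]
      · have key : ∀ c : ZMod 12, 4 * c = 0 → c = 0 ∨ c = 3 ∨ c = 6 ∨ c = 9 := by decide
        -- The axis of the half-turn lies at half the angle of `shift`, whence multiples of 45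
        -- degrees.
        rcases key _ x.four_mul_shift with e | e | e | e
        · refine ⟨![1, 0, 0], fun e => by simpa using congrFun e 0, ?_⟩
          rw [symMatrix, e, show cosTable 0 = 1 from rfl, show sinTable 0 = 0 from rfl]
          ext i
          fin_cases i <;> simp [Matrix.mulVec, dotProduct, Fin.sum_univ_three]
        · refine ⟨![1, 1, 0], fun e => by simpa using congrFun e 0, ?_⟩
          rw [symMatrix, e, hr, show cosTable 3 = 0 from rfl, show sinTable 3 = 1 from rfl]
          ext i
          fin_cases i <;> simp [Matrix.mulVec, dotProduct, Fin.sum_univ_three, boolSign]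
        · refine ⟨![0, 1, 0], fun e => by simpa using congrFun e 1, ?_⟩
          rw [symMatrix, e, hr, show cosTable 6 = -1 from rfl, show sinTable 6 = 0 from rfl]
          ext i
          fin_cases i <;> simp [Matrix.mulVec, dotProduct, Fin.sum_univ_three, boolSign]
        · refine ⟨![1, -1, 0], fun e => by simpa using congrFun e 0, ?_⟩
          rw [symMatrix, e, hr, show cosTable 9 = 0 from rfl, show sinTable 9 = -1 from rfl]
          ext i
          fin_cases i <;> simp [Matrix.mulVec, dotProduct, Fin.sum_univ_three, boolSign]

end CappedTube

namespace CappedTube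

variable {m : ℕ}

open Vertex SymParam

/-! ### Fixed cells of the symmetries -/

theorem fixesCell_of_edge {f : graph m ≃g graph m} {v w : Vertex m} (h : (graph m).Adj v w)
    (h1 : f v = w) (h2 : f w = v) : (rotation m).FixesCell f := by
  refine Or.inr (Or.inl ⟨s(v, w), h, ?_⟩)
  rw [Sym2.map_mk, h1, h2, Sym2.eq_swap]

theorem symFun_chord (x : SymParam m) (hs : x.swap = false) (hr : x.refl = false)
    (hx : x.shift = 6) :
    symFun x (baseChord m) = (baseChord m).vert := by
  have hv := vert_chord_bot (v := baseChord m) (show isUp 3 = false by decide) rfl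
  refine Vertex.ext ?_ ?_
  · rw [layer_symFun, hs, hv.1]; rfl
  · rw [pos_symFun, symPos, symLayer, hs, hr, hx, hv.2]
    change 1 * ((3 : ZMod 12) + ((0 : ℕ) : ZMod 12)) + 6 - ((0 : ℕ) : ZMod 12) = -(3 : ZMod 12)
    simp only [Nat.cast_zero]; decide

theorem symFun_of_not_swap {x : SymParam m} (hs : x.swap = false) (v : Vertex m) :
    (symFun x v).layer = v.layer := by rw [layer_symFun, hs]; rfl

theorem fixesCell_of_not_swap {x : SymParam m} (hs : x.swap = false) :
    (rotation m).FixesCell (sym x) := by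
  have h2 := shift_of_not_swap hs
  have key : ∀ c : ZMod 12, 2 * c = 0 → c = 0 ∨ c = 6 := by decide
  cases hr : x.refl
  · rcases key _ h2 with h | h
    · refine Or.inl ⟨capA m, Vertex.ext_col (symFun_of_not_swap hs _) ?_⟩
      rw [sym_apply, col_symFun, hr, h]
      simp [signOf]
    · refine fixesCell_of_edge (adj_vert (baseChord m)) ?_ ?_
      · exact symFun_chord x hs hr h
      · rw [sym_apply, symFun_vert, symFun_chord x hs hr h, vert_vert]
  · rcases key _ h2 with h | h
    · refine Or.inl ⟨capA m, Vertex.ext_col (symFun_of_not_swap hs _) ?_⟩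
      rw [sym_apply, col_symFun, hr, h]
      change signOf true * ((0 : ZMod 12) + ((0 : ℕ) : ZMod 12)) + 0 =
        (0 : ZMod 12) + ((0 : ℕ) : ZMod 12)
      simp
    · refine Or.inl ⟨baseChord m, Vertex.ext_col (symFun_of_not_swap hs _) ?_⟩
      rw [sym_apply, col_symFun, hr, h]
      change signOf true * ((3 : ZMod 12) + ((0 : ℕ) : ZMod 12)) + 6 =
        (3 : ZMod 12) + ((0 : ℕ) : ZMod 12)
      simp only [Nat.cast_zero]; decide

/-- The vertex at the given position of a layer which is neither the lowest nor the highest. -/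
def inner (m j : ℕ) (y : ZMod 12) (h0 : 0 < j) (h1 : j < 3 * m + 2) : Vertex m :=
  mkVertex m j y h1.le (by
    rw [show (j == 0) = false by simp; omega, show (j == 3 * m + 2) = false by simp; omega]; rfl)

theorem layer_inner {j : ℕ} {y : ZMod 12} (h0 h1) : (inner m j y h0 h1).layer = j := rfl
theorem pos_inner {j : ℕ} {y : ZMod 12} (h0 h1) : (inner m j y h0 h1).pos = y := rfl

theorem right_inner {j : ℕ} {y : ZMod 12} (h0 h1) :
    (inner m j y h0 h1).right = inner m j (y + 1) h0 h1 := by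
  have hb : (inner m j y h0 h1).bot = false := by
    rw [Bool.eq_false_iff]; intro e; have := (bot_iff _).1 e; rw [layer_inner] at this; omega
  have ht : (inner m j y h0 h1).top = false := by
    rw [Bool.eq_false_iff]; intro e; have := (top_iff _).1 e; rw [layer_inner] at this; omega
  refine Vertex.ext rfl ?_
  rw [pos_right, hb, ht]; rfl

theorem symFun_swap_inner {x : SymParam m} (hs : x.swap = true) {j : ℕ} {y : ZMod 12} (h0 h1) :
    symFun x (inner m j y h0 h1) = inner m (3 * m + 2 - j)
      (signOf x.refl * (y + j) + x.shift - ((3 * m + 2 : ℕ) : ZMod 12) + j)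
      (by omega) (by omega) := by
  refine Vertex.ext ?_ ?_
  · rw [layer_symFun, hs]; rfl
  · rw [pos_symFun, symPos, symLayer, hs]
    change _ - ((3 * m + 2 - j : ℕ) : ZMod 12) = signOf x.refl * (y + j) + x.shift -
      ((3 * m + 2 : ℕ) : ZMod 12) + j
    rw [Nat.cast_sub h1.le]
    simp only [pos_inner, layer_inner]
    ring

theorem vert_inner {j : ℕ} {y : ZMod 12} (h0 h1) (hu : isUp y = true) (h2) :
    (inner m j y h0 h1).vert = inner m (j + 1) (y - 1) (by omega) h2 := by
  have hv := vert_of_up (v := inner m j y h0 h1) hu (by rw [layer_inner]; omega)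
  exact Vertex.ext hv.1 hv.2

theorem inner_congr {j j' : ℕ} {y y' : ZMod 12} (h0 h1 h0' h1') (hj : j = j') (hy : y = y') :
    inner m j y h0 h1 = inner m j' y' h0' h1' := by subst hj; subst hy; rfl

theorem labelVert_of_up {v : Vertex m} (h : isUp v.pos = true) : labelVert v = (v.layer, v.pos) := by
  rw [labelVert, h]; rfl

theorem labelVert_of_down {v : Vertex m} (h : isUp v.pos = false) (hb : v.bot = false) :
    labelVert v = (v.layer - 1, v.pos + 3) := by
  rw [labelVert, h, hb]; rfl

theorem labelVert_of_bot {v : Vertex m} (hb : v.bot = true) :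
    labelVert v = (v.layer, v.pos) := by
  rw [labelVert, hb, Bool.or_true]; rfl

/-- The axis of the half-turn meets the tube at half its height. For even `m` there is a middle
layer and a ring edge is reversed. For odd `m` the axis passes between two layers, through a face or
the midpoint of a vertical edge. -/
theorem fixesCell_of_swap_refl (hm : 1 ≤ m) {x : SymParam m} (hs : x.swap = true)
    (hr : x.refl = true) : (rotation m).FixesCell (sym x) := by
  have h2 := shift_of_swap hs
  have key : ∀ c : ZMod 12, 2 * c = 0 → c = 0 ∨ c = 6 := by decide
  have K := key _ h2
  have e : ∀ j y h0 h1, symFun x (inner m j y h0 h1) = inner m (3 * m + 2 - j)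
      (1 - y + (x.shift - ((3 * m + 3 : ℕ) : ZMod 12))) (by omega) (by omega) := by
    intro j y h0 h1
    rw [symFun_swap_inner hs]
    refine inner_congr _ _ _ _ rfl ?_
    rw [hr]; push_cast; simp only [signOf, if_true]; ring
  generalize x.shift - ((3 * m + 3 : ℕ) : ZMod 12) = d at *
  obtain ⟨n, hn⟩ | ⟨n, hn⟩ := m.even_or_odd
  · have hj : ∃ j, 2 * j = 3 * m + 2 ∧ 0 < j ∧ j < 3 * m + 2 := ⟨3 * n + 1, by omega⟩
    obtain ⟨j, hj, h0, h1⟩ := hj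
    rcases K with K | K
    · have a := adj_right (inner m j 0 h0 h1)
      rw [right_inner] at a
      refine fixesCell_of_edge a ?_ ?_
      · rw [sym_apply, e]; exact inner_congr _ _ _ _ (by omega) (by rw [K]; decide)
      · rw [sym_apply, e]; exact inner_congr _ _ _ _ (by omega) (by rw [K]; decide)
    · have a := adj_right (inner m j 3 h0 h1)
      rw [right_inner] at a
      refine fixesCell_of_edge a ?_ ?_
      · rw [sym_apply, e]; exact inner_congr _ _ _ _ (by omega) (by rw [K]; decide)
      · rw [sym_apply, e]; exact inner_congr _ _ _ _ (by omega) (by rw [K]; decide)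
  · have hj : ∃ j, 2 * j + 1 = 3 * m + 2 ∧ 0 < j ∧ j + 1 < 3 * m + 2 := ⟨3 * n + 2, by omega⟩
    obtain ⟨j, hj, h0, h1⟩ := hj
    rcases K with K | K
    · refine Or.inr (Or.inr ⟨(rotation m).faceOf (dartV (inner m j 2 h0 (by omega))),
        RotationSystem.Face.edges_image_of_preserves
          (preservesOrientation_sym (hs.trans hr.symm)) ?_⟩)
      have hb : (inner m (j + 1) (-1) (by omega) h1).bot = false := by
        rw [Bool.eq_false_iff]; intro e; have := (bot_iff _).1 e; rw [layer_inner] at this; omega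
      have hu : isUp (inner m (j + 1) (-1) (by omega) h1).pos = false := show isUp (-1) = false by decide
      have hd : (sym x).toHom.mapDart (dartV (inner m j 2 h0 (by omega))) =
          dartV (inner m (j + 1) (-1) (by omega) h1) := by
        refine dart_eq_iff.2 ⟨?_, ?_⟩
        · change symFun x _ = _
          rw [e]; exact inner_congr (by omega) (by omega) (by omega) h1 (by omega) (by rw [K]; decide)
        · change symFun x _ = _
          rw [symFun_vert, e]
          exact congrArg vert
            (inner_congr (by omega) (by omega) (by omega) h1 (by omega) (by rw [K]; decide))
      rw [hd, faceOf_eq_iff_label, label_dartV, label_dartV, labelVert_of_down hu hb,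
        labelVert_of_up (v := inner m j 2 _ _) (show isUp 2 = true by decide)]
      exact Prod.ext (by simp [layer_inner]) (show (-1 + 3 : ZMod 12) = 2 by decide)
    · have a := adj_vert (inner m j 4 h0 (by omega))
      rw [vert_inner _ _ (by decide) h1] at a
      refine fixesCell_of_edge a ?_ ?_
      · rw [sym_apply, e]; exact inner_congr _ _ _ _ (by omega) (by rw [K]; decide)
      · rw [sym_apply, e]; exact inner_congr _ _ _ _ (by omega) (by rw [K]; decide)

theorem odd_of_two_mul_shift {x : SymParam m} (hs : x.swap = true) (h : 2 * x.shift = 0) :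
    Odd m := by
  have h2 := shift_of_swap hs
  have h3 : ((6 * m + 6 : ℕ) : ZMod 12) = 0 := by
    push_cast at h2 ⊢
    linear_combination h - h2
  rw [ZMod.natCast_eq_zero_iff] at h3
  obtain ⟨n, hn⟩ | h := m.even_or_odd
  · omega
  · exact h

/-- This is the reflection in the horizontal plane. It exists only for odd `m`, where it reverses
the vertical edges between the two middle layers. -/
theorem fixesCell_of_shift_eq_zero {x : SymParam m} (hs : x.swap = true)
    (hr : x.refl = false) (hx : x.shift = 0) : (rotation m).FixesCell (sym x) := by
  obtain ⟨n, hn⟩ := odd_of_two_mul_shift hs (by rw [hx, mul_zero])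
  obtain ⟨j, hj, h0, h1⟩ : ∃ j, 2 * j + 1 = 3 * m + 2 ∧ 0 < j ∧ j + 1 < 3 * m + 2 :=
    ⟨3 * n + 2, by omega⟩
  have e : ∀ i y h0 h1, symFun x (inner m i y h0 h1) = inner m (3 * m + 2 - i)
      (y + 2 * i - ((3 * m + 2 : ℕ) : ZMod 12)) (by omega) (by omega) := by
    intro j y h0 h1
    rw [symFun_swap_inner hs]
    refine inner_congr _ _ _ _ rfl ?_
    rw [hr, hx]; simp only [signOf, Bool.false_eq_true, if_false]; ring
  have hN : ((3 * m + 2 : ℕ) : ZMod 12) = 2 * j + 1 := by rw [← hj]; push_cast; ring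
  rw [hN] at e
  have a := adj_vert (inner m j 2 h0 (by omega))
  rw [vert_inner _ _ (by decide) h1] at a
  refine fixesCell_of_edge a ?_ ?_
  · rw [sym_apply, e]; exact inner_congr _ _ _ _ (by omega) (by ring)
  · rw [sym_apply, e]; exact inner_congr _ _ _ _ (by omega) (by push_cast; ring)

/-- Every column moves, so no vertex is fixed. Reversing an edge forces `2 * shift = 0`, hence odd
`m`; then there is no middle layer and the edge would be vertical, with both ends in one column. For
a face, the image of the vertical edge at its base would have to lie on its boundary again, which
the labels refute. -/
theorem not_fixesCell {x : SymParam m} (hs : x.swap = true)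
    (hr : x.refl = false) (hx : x.shift ≠ 0) : ¬ (rotation m).FixesCell (sym x) := by
  have hL : ∀ v : Vertex m, (symFun x v).layer = 3 * m + 2 - v.layer := fun v => by
    rw [layer_symFun, hs]; rfl
  have hC : ∀ v : Vertex m, (symFun x v).col = v.col + x.shift := fun v => by
    rw [col_symFun, hr]; simp [signOf]
  have hU : ∀ v : Vertex m, isUp (symFun x v).pos = !isUp v.pos := fun v => by
    rw [isUp_symFun, hs]; simp
  rintro (⟨v, hv⟩ | ⟨e, he, hfe⟩ | ⟨F, hF⟩)
  · rw [sym_apply] at hv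
    have := hC v
    rw [hv] at this
    exact hx (by simpa using this)
  · induction e with | h v w =>
    rw [Sym2.map_mk, Sym2.eq_iff] at hfe
    simp only [sym_apply] at hfe
    rcases hfe with ⟨h1, -⟩ | ⟨h1, h2⟩
    · have := hC v
      rw [h1] at this
      exact hx (by simpa using this)
    have c1 := hC v
    have c2 := hC w
    rw [h1] at c1
    rw [h2] at c2
    obtain ⟨n, hn⟩ := odd_of_two_mul_shift hs (by linear_combination -c1 - c2)
    have l1 := hL v
    rw [h1] at l1
    have lv := v.layer_le
    have he' : w = v.left ∨ w = v.right ∨ w = v.vert := he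
    rcases he' with e | e | e
    · rw [e, layer_left] at l1; omega
    · rw [e, layer_right] at l1; omega
    · rcases v.vert_cases with h | h | h | h
      · refine hx ?_
        rw [e, col, col, h.2.2.1, h.2.2.2.1] at c1
        push_cast at c1
        linear_combination -c1
      · refine hx ?_
        rw [e, col, col, h.2.2.1, h.2.2.2.1] at c1
        push_cast at c1
        linear_combination -c1
      · rw [e, h.2.2.2.1, v.top_iff.1 h.2.1] at l1; omega
      · rw [e, h.2.2.2.1, v.bot_iff.1 h.2.1] at l1; omega
  · obtain ⟨w, hw, rfl⟩ := exists_faceOf_base F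
    have hmem : (dartV (symFun x w)).edge ∈ ((rotation m).faceOf (dartV w)).edges := by
      rw [← hF]
      refine ⟨(dartV w).edge, ⟨dartV w, rfl, rfl⟩, ?_⟩
      change s(symFun x w, symFun x w.vert) = s(symFun x w, (symFun x w).vert)
      rw [symFun_vert]
    obtain ⟨d, hd, hde⟩ := hmem
    have hlab := label_eq_of_faceOf_eq hd
    rw [label_base hw] at hlab
    have hl := hL w
    have hc := hC w
    have hu := hU w
    have lw := w.layer_le
    have hd' : label d = labelVert (symFun x w) ∨ label d = labelVert (symFun x w).vert := by
      rcases (SimpleGraph.dart_edge_eq_iff _ _).1 hde with h | h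
      · left; rw [h, label_dartV]
      · right; rw [h, symm_dartV, label_dartV]
    have conclude : (label d).1 = w.layer ∧ (label d).2 = w.pos := by rw [hlab]; exact ⟨rfl, rfl⟩
    cases hwu : isUp w.pos
    · have hwb : w.bot = true := by
        unfold IsBase at hw
        rw [hwu] at hw
        simp only [Bool.false_or, Bool.and_eq_true] at hw
        exact hw.1
      have w0 := w.bot_iff.1 hwb
      rw [hwu] at hu
      have hv := vert_chord_top hu (by omega)
      have hu' : isUp (symFun x w).vert.pos = true := by rw [hv.2, isUp_two_sub]; exact hu
      rcases hd' with h | h <;> rw [h] at conclude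
      · rw [labelVert_of_up hu] at conclude
        have := conclude.1
        change (symFun x w).layer = _ at this
        omega
      · rw [labelVert_of_up hu'] at conclude
        have := conclude.1
        change (symFun x w).vert.layer = _ at this
        omega
    · rw [hwu] at hu
      have hu : isUp (symFun x w).pos = false := hu
      cases hb : (symFun x w).bot
      · have b0 : (symFun x w).layer ≠ 0 := fun e => by
          rw [(symFun x w).bot_iff.2 e] at hb; simp at hb
        have hv := vert_of_down hu b0
        have hu' : isUp (symFun x w).vert.pos = true := by rw [hv.2, isUp_add_one, hu]; rfl
        rw [col, col] at hc
        -- The layers of `w` and of its image are the two middle ones, so `m` is odd and `2 * shift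
        -- = 0`. The two positions allowed by the label correspond to the shifts -2 and 0.
        have main : (symFun x w).layer = w.layer + 1 →
            (symFun x w).pos + 3 = w.pos ∨ (symFun x w).pos + 1 = w.pos → False := by
          intro e1 e2
          rw [e1] at hc
          push_cast at hc
          rcases e2 with e2 | e2
          · obtain ⟨n, hn⟩ : ∃ n, m = 2 * n + 1 := ⟨(m - 1) / 2, by omega⟩
            have h2 := shift_of_swap hs
            have h12 : (12 : ZMod 12) = 0 := by decide
            have hN : ((3 * m + 3 : ℕ) : ZMod 12) = 6 * (n + 1) := by rw [hn]; push_cast; ring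
            rw [hN] at h2
            have h4 : (4 : ZMod 12) = 0 := by
              linear_combination -h2 - 2 * hc + 2 * e2 - (n + 1 : ZMod 12) * h12
            exact absurd h4 (by decide)
          · exact hx (by linear_combination e2 - hc)
        rcases hd' with h | h <;> rw [h] at conclude
        · rw [labelVert_of_down hu hb] at conclude
          have h1 : (symFun x w).layer - 1 = w.layer := conclude.1
          exact main (by omega) (Or.inl conclude.2)
        · rw [labelVert_of_up hu'] at conclude
          have h1 : (symFun x w).vert.layer = w.layer := conclude.1
          exact main (by omega) (Or.inr (hv.2 ▸ conclude.2))
      · have b0 := (symFun x w).bot_iff.1 hb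
        have hv := vert_chord_bot hu b0
        rcases hd' with h | h <;> rw [h] at conclude
        · rw [labelVert_of_bot hb] at conclude
          have h1 : (symFun x w).layer = w.layer := conclude.1
          omega
        · rw [labelVert_of_bot ((bot_iff _).2 hv.1)] at conclude
          have h1 : (symFun x w).vert.layer = w.layer := conclude.1
          omega

theorem fixesCell_sym_iff (hm : 1 ≤ m) (x : SymParam m) : (rotation m).FixesCell (sym x) ↔
    (x.swap = true → x.refl = false → x.shift = 0) := by
  constructor
  · intro h hs hr
    by_contra hx
    exact not_fixesCell hs hr hx h
  · intro h
    cases hs : x.swap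
    · exact fixesCell_of_not_swap hs
    · cases hr : x.refl
      · exact fixesCell_of_shift_eq_zero hs hr (h hs hr)
      · exact fixesCell_of_swap_refl hm hs hr

end CappedTube

namespace CappedTube

variable {m : ℕ}

open Vertex SymParam

/-! ### The symmetry groups of the long tubes -/

noncomputable def symEquiv (hm : 1 ≤ m) : SymParam m ≃ (graph m ≃g graph m) :=
  Equiv.ofBijective sym ⟨sym_injective, fun f => (sym_surjective hm f).imp fun _ h => h.symm⟩

theorem sym_symEquiv_symm (hm : 1 ≤ m) (f : graph m ≃g graph m) : sym ((symEquiv hm).symm f) = f :=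
  (symEquiv hm).apply_symm_apply f

def symIsometry (x : SymParam m) : Matrix.orthogonalGroup (Fin 3) ℝ := ⟨symMatrix x, symMatrix_mem x⟩

theorem symIsometry_mul (x y : SymParam m) :
    symIsometry (x.mul y) = symIsometry x * symIsometry y := Subtype.ext (symMatrix_mul x y)

/-- The isometry corresponding to an automorphism. -/
noncomputable def isometryHom (hm : 1 ≤ m) :
    (graph m ≃g graph m) →* Matrix.orthogonalGroup (Fin 3) ℝ :=
  MonoidHom.mk' (fun f => symIsometry ((symEquiv hm).symm f)) (fun f g => by
    rw [← symIsometry_mul]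
    congr 1
    rw [Equiv.symm_apply_eq]
    change f * g = sym _
    rw [← sym_mul, sym_symEquiv_symm, sym_symEquiv_symm])

theorem hasPointGroup_range (hm : 1 ≤ m) {P : Subgroup (Matrix.orthogonalGroup (Fin 3) ℝ)}
    (hP : ∀ A, A ∈ P ↔ ∃ x : SymParam m, symIsometry x = A) : (rotation m).HasPointGroup P := by
  refine RotationSystem.hasPointGroup_of_injective (isometryHom hm) ?_ ?_
    not_preserves_and_reverses ?_ ?_
  · intro f g h
    exact (symEquiv hm).symm.injective (symMatrix_injective (congrArg Subtype.val h))
  · ext A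
    rw [hP]
    constructor
    · rintro ⟨f, rfl⟩
      exact ⟨_, rfl⟩
    · rintro ⟨x, rfl⟩
      refine ⟨symEquiv hm x, ?_⟩
      change symIsometry ((symEquiv hm).symm (symEquiv hm x)) = _
      rw [Equiv.symm_apply_apply]
  · intro f
    change _ ∧ (symMatrix ((symEquiv hm).symm f)).det = 1 ∨
      _ ∧ (symMatrix ((symEquiv hm).symm f)).det = -1
    have hf := sym_symEquiv_symm hm f
    generalize (symEquiv hm).symm f = x at *
    subst hf
    rw [det_symMatrix]
    by_cases h : x.swap = x.refl
    · exact Or.inl ⟨preservesOrientation_sym h, if_pos h⟩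
    · refine Or.inr ⟨reversesOrientation_sym ?_, if_neg h⟩
      revert h
      cases x.swap <;> cases x.refl <;> simp
  · intro f
    change _ ↔ ∃ v : Fin 3 → ℝ, v ≠ 0 ∧ Matrix.mulVec (symMatrix ((symEquiv hm).symm f)) v = v
    have hf := sym_symEquiv_symm hm f
    generalize (symEquiv hm).symm f = x at *
    subst hf
    rw [symMatrix_fixes_iff, fixesCell_sym_iff hm]

theorem symIsometry_rot : symIsometry (rotParam m) = PointGroup.rotZ := by
  refine Subtype.ext ?_
  change symMatrix (rotParam m) = !![-1, 0, 0; 0, -1, 0; 0, 0, 1]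
  rw [symMatrix, show (rotParam m).shift = 6 from rfl, show cosTable 6 = -1 from rfl,
    show sinTable 6 = 0 from rfl, show (rotParam m).refl = false from rfl,
    show (rotParam m).swap = false from rfl]
  simp [boolSign]

theorem symIsometry_mirror : symIsometry (mirrorParam m) = PointGroup.mirror := by
  refine Subtype.ext ?_
  change symMatrix (mirrorParam m) = !![1, 0, 0; 0, -1, 0; 0, 0, 1]
  rw [symMatrix, show (mirrorParam m).shift = 0 from rfl, show cosTable 0 = 1 from rfl,
    show sinTable 0 = 0 from rfl, show (mirrorParam m).refl = true from rfl,
    show (mirrorParam m).swap = false from rfl]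
  simp [boolSign]

theorem symIsometry_one : symIsometry (oneParam m) = 1 := by
  have h : (oneParam m).mul (oneParam m) = oneParam m := SymParam.ext rfl rfl (by
    change (0 : ZMod 12) + 1 * 0 = 0; simp)
  have := symIsometry_mul (oneParam m) (oneParam m)
  rw [h] at this
  exact left_eq_mul.1 this

/-- The half-turn and the mirror give the four symmetries that keep the ends. Any other symmetry is
`g` times one of these, because `g` is an involution: it reverses the columns, so its shift cancels.
-/
theorem mem_closure_iff (g : SymParam m) (h1 : g.swap = true) (h2 : g.refl = true)
    (A : Matrix.orthogonalGroup (Fin 3) ℝ) :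
    A ∈ Subgroup.closure {PointGroup.rotZ, PointGroup.mirror, symIsometry g} ↔
      ∃ x : SymParam m, symIsometry x = A := by
  set H := Subgroup.closure {PointGroup.rotZ, PointGroup.mirror, symIsometry g} with hH
  have mr : PointGroup.rotZ ∈ H := Subgroup.subset_closure (by simp)
  have mm : PointGroup.mirror ∈ H := Subgroup.subset_closure (by simp)
  have mg : symIsometry g ∈ H := Subgroup.subset_closure (by simp)
  have key : ∀ c : ZMod 12, 2 * c = 0 → c = 0 ∨ c = 6 := by decide
  have c1 : ∀ x : SymParam m, x.swap = false → x.refl = false → symIsometry x ∈ H := by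
    intro x hs hr
    rcases key _ (shift_of_not_swap hs) with h | h
    · rw [show x = oneParam m from SymParam.ext hs hr h, symIsometry_one]
      exact H.one_mem
    · rw [show x = rotParam m from SymParam.ext hs hr h, symIsometry_rot]
      exact mr
  have c2 : ∀ x : SymParam m, x.swap = false → symIsometry x ∈ H := by
    intro x hs
    cases hr : x.refl
    · exact c1 x hs hr
    · have : x = (mirrorParam m).mul ((mirrorParam m).mul x) := by
        refine SymParam.ext ?_ ?_ ?_
        · change x.swap = xor false (xor false x.swap); simp
        · change x.refl = xor true (xor true x.refl); simp
        · change x.shift = 0 + -1 * (0 + -1 * x.shift); ring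
      rw [this, symIsometry_mul, symIsometry_mirror]
      refine H.mul_mem mm (c1 _ ?_ ?_)
      · change xor false x.swap = false; simp [hs]
      · change xor true x.refl = false; simp [hr]
  constructor
  · intro hA
    induction hA using Subgroup.closure_induction with
    | mem A hA =>
      rcases hA with rfl | rfl | rfl
      exacts [⟨_, symIsometry_rot⟩, ⟨_, symIsometry_mirror⟩, ⟨g, rfl⟩]
    | one => exact ⟨_, symIsometry_one⟩
    | mul A B _ _ h1 h2 =>
      obtain ⟨x, rfl⟩ := h1
      obtain ⟨y, rfl⟩ := h2
      exact ⟨_, symIsometry_mul x y⟩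
    | inv A _ h1 =>
      obtain ⟨x, rfl⟩ := h1
      have : ∃ y : SymParam m, x.mul y = oneParam m := by
        cases hr : x.refl
        · refine ⟨⟨(x.swap, false, -x.shift), ?_⟩, SymParam.ext ?_ ?_ ?_⟩
          · cases hs : x.swap
            · simpa using shift_of_not_swap hs
            · have := shift_of_swap hs
              simp only [if_true]
              linear_combination -this - four_mul_eq_zero m
          · change xor x.swap x.swap = false; simp
          · change xor x.refl false = false; simp [hr]
          · change x.shift + signOf x.refl * (-x.shift) = 0
            rw [hr]; simp [signOf]
        · refine ⟨x, SymParam.ext ?_ ?_ ?_⟩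
          · change xor x.swap x.swap = false; simp
          · change xor x.refl x.refl = false; simp
          · change x.shift + signOf x.refl * x.shift = 0
            rw [hr]; simp [signOf]
      obtain ⟨y, hy⟩ := this
      refine ⟨y, ?_⟩
      rw [eq_comm]
      exact inv_eq_of_mul_eq_one_right (by rw [← symIsometry_mul, hy, symIsometry_one])
  · rintro ⟨x, rfl⟩
    cases hs : x.swap
    · exact c2 x hs
    · have : x = g.mul (g.mul x) := by
        refine SymParam.ext ?_ ?_ ?_
        · change x.swap = xor g.swap (xor g.swap x.swap); simp
        · change x.refl = xor g.refl (xor g.refl x.refl); simp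
        · change x.shift = g.shift + signOf g.refl * (g.shift + signOf g.refl * x.shift)
          rw [h2]; simp [signOf]
      rw [this, symIsometry_mul]
      refine H.mul_mem mg (c2 _ ?_)
      change xor g.swap x.swap = false
      simp [hs, h1]

theorem hasPointGroup_D2h (hm : Odd m) : (rotation m).HasPointGroup PointGroup.D2h := by
  obtain ⟨n, hn⟩ := hm
  refine hasPointGroup_range (by omega) fun A => ?_
  have hg : 2 * ((0 : ZMod 12) - if true = true then ((3 * m + 3 : ℕ) : ZMod 12) else 0) = 0 := by
    have h12 : (12 : ZMod 12) = 0 := by decide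
    rw [hn]; push_cast; simp only [if_true]
    linear_combination (-(n + 1 : ZMod 12)) * h12
  obtain ⟨g, g1, g2, g3⟩ : ∃ g : SymParam m, g.swap = true ∧ g.refl = true ∧ g.shift = 0 :=
    ⟨⟨(true, true, 0), hg⟩, rfl, rfl, rfl⟩
  have e : symIsometry g = PointGroup.rotX := by
    refine Subtype.ext ?_
    change symMatrix g = !![1, 0, 0; 0, -1, 0; 0, 0, -1]
    rw [symMatrix, g1, g2, g3, show cosTable 0 = 1 from rfl, show sinTable 0 = 0 from rfl]
    simp [boolSign]
  rw [PointGroup.D2h, ← e, mem_closure_iff g g1 g2]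

theorem hasPointGroup_D2d (hm : Even m) (h1 : 1 ≤ m) :
    (rotation m).HasPointGroup PointGroup.D2d := by
  obtain ⟨n, hn⟩ := hm
  refine hasPointGroup_range h1 fun A => ?_
  have hg : 2 * ((3 : ZMod 12) - if true = true then ((3 * m + 3 : ℕ) : ZMod 12) else 0) = 0 := by
    have h12 : (12 : ZMod 12) = 0 := by decide
    rw [hn]; push_cast; simp only [if_true]
    linear_combination (-(n : ZMod 12)) * h12
  obtain ⟨g, g1, g2, g3⟩ : ∃ g : SymParam m, g.swap = true ∧ g.refl = true ∧ g.shift = 3 :=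
    ⟨⟨(true, true, 3), hg⟩, rfl, rfl, rfl⟩
  have e : symIsometry g = PointGroup.rotXY := by
    refine Subtype.ext ?_
    change symMatrix g = !![0, 1, 0; 1, 0, 0; 0, 0, -1]
    rw [symMatrix, g1, g2, g3, show cosTable 3 = 0 from rfl, show sinTable 3 = 1 from rfl]
    simp [boolSign]
  rw [PointGroup.D2d, ← e, mem_closure_iff g g1 g2]

end CappedTube

namespace CappedTube

open Vertex SymParam

/-! ### The shortest tube

The tube with three layers has tetrahedral symmetry. Its vertices are indexed by pairs of vertices of
a tetrahedron: `(i, i, false)` are the vertices on three pentagons, `(i, j, false)` with `i ≠ j` are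
their neighbours, and `(i, j, true)` the remaining vertices. -/

abbrev TetraCode : Type := Fin 4 × Fin 4 × Bool

def TetraCode.IsValid (c : TetraCode) : Prop := c.1 = c.2.1 → c.2.2 = false

instance : DecidablePred TetraCode.IsValid := fun c =>
  inferInstanceAs (Decidable (c.1 = c.2.1 → c.2.2 = false))

/-- The diagonal entries of the first table are placeholders for codes that are not valid; likewise
the entries of `codeOfCoord` at missing positions. -/
def coordOfCode (c : TetraCode) : ℕ × ZMod 12 :=
  (if c.2.2 then
    ![![(0, 0), (2, 4), (1, 6), (1, 4)], ![(2, 10), (0, 0), (1, 10), (1, 0)],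
      ![(1, 7), (1, 9), (0, 0), (0, 9)], ![(1, 3), (1, 1), (0, 3), (0, 0)]]
  else
    ![![(0, 0), (1, 11), (0, 10), (0, 2)], ![(1, 5), (0, 6), (0, 8), (0, 4)],
      ![(2, 3), (2, 11), (2, 1), (1, 2)], ![(2, 5), (2, 9), (1, 8), (2, 7)]]) c.1 c.2.1

def codeOfCoord (j : ℕ) (y : ZMod 12) : TetraCode :=
  if j = 0 then
    (![(0, 0, false), (0, 0, false), (0, 3, false), (3, 2, true), (1, 3, false), (0, 0, false),
      (1, 1, false), (0, 0, false), (1, 2, false), (2, 3, true), (0, 2, false), (0, 0, false)] : Fin 12 → TetraCode) y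
  else if j = 1 then
    (![(1, 3, true), (3, 1, true), (2, 3, false), (3, 0, true), (0, 3, true), (1, 0, false),
      (0, 2, true), (2, 0, true), (3, 2, false), (2, 1, true), (1, 2, true), (0, 1, false)] : Fin 12 → TetraCode) y
  else
    (![(0, 0, false), (2, 2, false), (0, 0, false), (2, 0, false), (0, 1, true), (3, 0, false),
      (0, 0, false), (3, 3, false), (0, 0, false), (3, 1, false), (1, 0, true), (2, 1, false)] : Fin 12 → TetraCode) y

theorem present_coordOfCode : ∀ c : TetraCode, (coordOfCode c).1 ≤ 3 * 0 + 2 ∧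
    present ((coordOfCode c).1 == 0) ((coordOfCode c).1 == 3 * 0 + 2) (coordOfCode c).2 = true := by
  decide

def ofCode (c : TetraCode) : Vertex 0 := ⟨coordOfCode c, present_coordOfCode c⟩

def code (v : Vertex 0) : TetraCode := codeOfCoord v.layer v.pos

theorem coordOfCode_codeOfCoord : ∀ j : Fin 3, ∀ y : ZMod 12,
    present (j.1 == 0) (j.1 == 2) y = true →
    coordOfCode (codeOfCoord j.1 y) = (j.1, y) := by decide

theorem isValid_codeOfCoord : ∀ j : Fin 3, ∀ y : ZMod 12, present (j.1 == 0) (j.1 == 2) y = true →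
    (codeOfCoord j.1 y).IsValid := by decide

theorem ofCode_code (v : Vertex 0) : ofCode (code v) = v :=
  Subtype.ext (coordOfCode_codeOfCoord ⟨v.layer, by have := v.layer_le; omega⟩ v.pos v.present_pos)

theorem isValid_code (v : Vertex 0) : (code v).IsValid :=
  isValid_codeOfCoord ⟨v.layer, by have := v.layer_le; omega⟩ v.pos v.present_pos

theorem code_ofCode : ∀ c : TetraCode, c.IsValid → code (ofCode c) = c := by decide

theorem code_injective : Function.Injective code := fun v w h => by
  rw [← ofCode_code v, h, ofCode_code]

theorem forall_vertex {P : Vertex 0 → Prop} (h : ∀ c : TetraCode, P (ofCode c)) (v : Vertex 0) :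
    P v := ofCode_code v ▸ h _

/-- Only equalities between indices occur, so the relation is visibly invariant under all
permutations of `Fin 4`. This is the reason for introducing the codes. -/
def TetraCode.HalfAdj (c d : TetraCode) : Prop :=
  c.2.2 = false ∧ (d.2.2 = false ∧ c.1 = c.2.1 ∧ d.1 = c.1 ∧ d.2.1 ≠ d.1 ∨
    d.2.2 = true ∧ c.1 ≠ c.2.1 ∧ d.1 = c.2.1 ∧ d.2.1 ≠ c.1 ∧ d.1 ≠ d.2.1)

def TetraCode.Adj (c d : TetraCode) : Prop :=
  c.HalfAdj d ∨ d.HalfAdj c ∨ c.2.2 = true ∧ d.2.2 = true ∧ c.1 = d.2.1 ∧ c.2.1 = d.1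

instance (c d : TetraCode) : Decidable (c.HalfAdj d) := by
  unfold TetraCode.HalfAdj; infer_instance

instance (c d : TetraCode) : Decidable (c.Adj d) := by
  unfold TetraCode.Adj; infer_instance

set_option maxRecDepth 4000 in
theorem adj_ofCode : ∀ c d : TetraCode, c.IsValid → d.IsValid →
    ((ofCode d = (ofCode c).left ∨ ofCode d = (ofCode c).right ∨ ofCode d = (ofCode c).vert) ↔
      c.Adj d) := by decide

theorem adj_iff_code {v w : Vertex 0} : (graph 0).Adj v w ↔ (code v).Adj (code w) := by
  rw [← adj_ofCode _ _ (isValid_code v) (isValid_code w), ofCode_code, ofCode_code, adj_iff]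

/-- The action of the permutations of the vertices of the tetrahedron. -/
def TetraCode.act (p : Equiv.Perm (Fin 4)) (c : TetraCode) : TetraCode := (p c.1, p c.2.1, c.2.2)

theorem TetraCode.adj_act (p : Equiv.Perm (Fin 4)) (c d : TetraCode) :
    (c.act p).Adj (d.act p) ↔ c.Adj d := by
  simp [TetraCode.Adj, TetraCode.HalfAdj, TetraCode.act]

theorem TetraCode.isValid_act (p : Equiv.Perm (Fin 4)) {c : TetraCode} (h : c.IsValid) :
    (c.act p).IsValid := by
  simpa [TetraCode.IsValid, TetraCode.act] using h

def permFun (p : Equiv.Perm (Fin 4)) (v : Vertex 0) : Vertex 0 := ofCode ((code v).act p)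

theorem code_permFun (p : Equiv.Perm (Fin 4)) (v : Vertex 0) :
    code (permFun p v) = (code v).act p :=
  code_ofCode _ (TetraCode.isValid_act p (isValid_code v))

theorem permFun_mul (p q : Equiv.Perm (Fin 4)) (v : Vertex 0) :
    permFun (p * q) v = permFun p (permFun q v) :=
  code_injective (by simp only [code_permFun]; rfl)

theorem permFun_one (v : Vertex 0) : permFun 1 v = v :=
  code_injective (by rw [code_permFun]; rfl)

def permAut (p : Equiv.Perm (Fin 4)) : graph 0 ≃g graph 0 where
  toFun := permFun p
  invFun := permFun p⁻¹
  left_inv v := by rw [← permFun_mul, inv_mul_cancel, permFun_one]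
  right_inv v := by rw [← permFun_mul, mul_inv_cancel, permFun_one]
  map_rel_iff' := by
    intro v w
    change (graph 0).Adj (permFun p v) (permFun p w) ↔ _
    rw [adj_iff_code, adj_iff_code, code_permFun, code_permFun, TetraCode.adj_act]

theorem permAut_apply (p : Equiv.Perm (Fin 4)) (v : Vertex 0) : permAut p v = permFun p v := rfl

theorem permAut_mul (p q : Equiv.Perm (Fin 4)) : permAut (p * q) = permAut p * permAut q := by
  ext v; exact permFun_mul p q v

/-- The vertex on three pentagons with the given index. -/
def tip (i : Fin 4) : Vertex 0 := ofCode (i, i, false)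

theorem code_tip (i : Fin 4) : code (tip i) = (i, i, false) := code_ofCode _ fun _ => rfl

theorem permFun_tip (p : Equiv.Perm (Fin 4)) (i : Fin 4) : permFun p (tip i) = tip (p i) :=
  code_injective (by rw [code_permFun, code_tip, code_tip]; rfl)

theorem tip_injective : Function.Injective tip := fun i j h => by
  have := congrArg code h
  rw [code_tip, code_tip] at this
  exact congrArg Prod.fst this

theorem capA_eq_tip : capA 0 = tip 0 := by decide
theorem capB_eq_tip : capB 0 = tip 1 := by decide

theorem onThreePentagons_tip (i : Fin 4) : OnThreePentagons (tip i) := by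
  have := (onThreePentagons_capA (m := 0)).map (permAut (Equiv.swap 0 i))
  rwa [capA_eq_tip, permAut_apply, permFun_tip, Equiv.swap_apply_left] at this

theorem pentagonGap_two : ∀ j : Fin 3, ∀ y : ZMod 12, present (j.1 == 0) (j.1 == 2) y = true →
    pentagonGap 2 (j.1, y) = true ∨ ∃ i, codeOfCoord j y = (i, i, false) := by decide

theorem exists_eq_tip {v : Vertex 0} (h : OnThreePentagons v) : ∃ i, v = tip i := by
  have hl := v.layer_le
  rcases pentagonGap_two ⟨v.layer, by omega⟩ v.pos v.present_pos with e | ⟨i, hi⟩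
  · exact absurd h (not_onThreePentagons_of_gap (s := 0) (t := 2) (Or.inl rfl)
      (fun u _ _ => by omega) e)
  · exact ⟨i, code_injective (by rw [code_tip]; exact hi)⟩

theorem mirror_tip : mirror 0 (tip 2) ≠ tip 2 := by
  intro h
  have := congrArg pos h
  rw [pos_mirror] at this
  revert this
  decide

/-- An automorphism permutes the four tips, and composed with the inverse permutation it fixes all
of them. Fixing two tips leaves the identity and `mirror`, and `mirror` moves a third tip. -/
theorem permAut_surjective (f : graph 0 ≃g graph 0) : ∃ p, f = permAut p := by
  choose g hg using fun i => exists_eq_tip ((onThreePentagons_tip i).map f)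
  have hinj : Function.Injective g := fun i j h =>
    tip_injective (f.injective (by rw [hg, hg, h]))
  let p : Equiv.Perm (Fin 4) := Equiv.ofBijective g (Finite.injective_iff_bijective.1 hinj)
  have hp : ∀ i, p i = g i := fun _ => rfl
  have hfix : ∀ i, (permAut p⁻¹ * f) (tip i) = tip i := by
    intro i
    rw [RelIso.mul_apply, hg, permAut_apply, permFun_tip, ← hp, ← Equiv.Perm.mul_apply, inv_mul_cancel, Equiv.Perm.one_apply]
  have hone : permAut p⁻¹ * f = 1 := by
    rcases eq_one_or_mirror (permAut p⁻¹ * f) (by rw [capA_eq_tip, hfix])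
      (by rw [capB_eq_tip, hfix]) with h | h
    · exact h
    · exact absurd (by rw [← h, hfix]) mirror_tip
  refine ⟨p, ?_⟩
  have h1 : permAut p * permAut p⁻¹ = 1 := by
    rw [← permAut_mul, mul_inv_cancel]; ext v; exact permFun_one v
  calc f = permAut p * (permAut p⁻¹ * f) := by rw [← mul_assoc, h1, one_mul]
    _ = permAut p := by rw [hone, mul_one]

theorem permAut_injective : Function.Injective permAut := fun p q h => by
  ext i : 1
  apply tip_injective
  rw [← permFun_tip, ← permFun_tip, ← permAut_apply, h, permAut_apply]

end CappedTube

/-! ### Orientation of compositions; vertices of fixed faces -/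

namespace RotationSystem

variable {V : Type*} {G : SimpleGraph V} {R : RotationSystem G} {f g : G ≃g G}

theorem PreservesOrientation.mul (hf : R.PreservesOrientation f) (hg : R.PreservesOrientation g) :
    R.PreservesOrientation (f * g) := fun d => by
  change f.toHom.mapDart (g.toHom.mapDart (R.rot d)) = _
  rw [hg, hf]; rfl

theorem PreservesOrientation.mul_reverses (hf : R.PreservesOrientation f)
    (hg : R.ReversesOrientation g) : R.ReversesOrientation (f * g) := fun d => by
  change f.toHom.mapDart (g.toHom.mapDart (R.rot d)) = _
  rw [hg, Equiv.eq_symm_apply, ← hf, Equiv.apply_symm_apply]; rfl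

theorem ReversesOrientation.mul_preserves (hf : R.ReversesOrientation f)
    (hg : R.PreservesOrientation g) : R.ReversesOrientation (f * g) := fun d => by
  change f.toHom.mapDart (g.toHom.mapDart (R.rot d)) = _
  rw [hg, hf]; rfl

theorem ReversesOrientation.mul (hf : R.ReversesOrientation f) (hg : R.ReversesOrientation g) :
    R.PreservesOrientation (f * g) := fun d => by
  change f.toHom.mapDart (g.toHom.mapDart (R.rot d)) = _
  rw [hg, hf.mapDart_rot_symm]; rfl

theorem preservesOrientation_one : R.PreservesOrientation (1 : G ≃g G) := fun _ => rfl

/-- The vertices on the boundary of a face are mapped to such vertices by the automorphisms which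
fix the face. -/
theorem exists_dart_of_edges_image {F : R.Face} (hF : Sym2.map f '' F.edges = F.edges) {d : G.Dart}
    (hd : R.faceOf d = F) : ∃ d', R.faceOf d' = F ∧ d'.fst = f d.fst := by
  have hm : Sym2.map f d.edge ∈ F.edges := by
    rw [← hF]; exact ⟨_, ⟨d, hd, rfl⟩, rfl⟩
  obtain ⟨d', hd', he⟩ := hm
  have he' : s(d'.fst, d'.snd) = s(f d.fst, f d.snd) := he
  rcases Sym2.eq_iff.1 he' with ⟨h, -⟩ | ⟨-, h⟩
  · exact ⟨d', hd', h⟩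
  · refine ⟨R.faceNext d', ?_, ?_⟩
    · rw [← hd']
      refine Quotient.sound (s := Equiv.Perm.SameCycle.setoid R.faceNext) ?_
      exact Equiv.Perm.SameCycle.symm ⟨1, by simp⟩
    · rw [← h]
      have := R.rot_fst (R.rot.symm d'.symm)
      rw [Equiv.apply_symm_apply] at this
      exact this.symm

end RotationSystem

namespace CappedTube

open Vertex SymParam

/-! #### The tetrahedron -/

def tetraVertex (i : Fin 4) : Fin 3 → ℝ :=
  (![![1, 1, 1], ![1, -1, -1], ![-1, 1, -1], ![-1, -1, 1]] : Fin 4 → Fin 3 → ℝ) i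

theorem range_tetraVertex : Set.range tetraVertex = PointGroup.tetrahedron := by
  ext x
  simp only [Set.mem_range, PointGroup.tetrahedron, Fin.exists_fin_succ, tetraVertex]
  simp [eq_comm]

theorem sum_tetraVertex (a : Fin 3) : ∑ i, tetraVertex i a = 0 := by
  fin_cases a <;> simp [Fin.sum_univ_four, tetraVertex]

theorem sum_tetraVertex_mul (a b : Fin 3) :
    ∑ i, tetraVertex i a * tetraVertex i b = if a = b then 4 else 0 := by
  fin_cases a <;> fin_cases b <;> simp [Fin.sum_univ_four, tetraVertex] <;> norm_num

theorem dotProduct_tetraVertex (i j : Fin 4) :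
    dotProduct (tetraVertex i) (tetraVertex j) = if i = j then 3 else -1 := by
  fin_cases i <;> fin_cases j <;> simp [dotProduct, Fin.sum_univ_three, tetraVertex] <;> norm_num

theorem tetraVertex_injective : Function.Injective tetraVertex := fun i j h => by
  by_contra hij
  have h1 := dotProduct_tetraVertex i j
  rw [← h, dotProduct_tetraVertex, if_neg hij, if_pos rfl] at h1
  norm_num at h1

/-- The four vectors form a tight frame: the sum of their outer squares is four times the identity.
-/
theorem eq_sum_dotProduct (x : Fin 3 → ℝ) (a : Fin 3) :
    x a = 1 / 4 * ∑ i, dotProduct x (tetraVertex i) * tetraVertex i a := by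
  simp only [dotProduct, Finset.sum_mul]
  rw [Finset.sum_comm]
  simp only [mul_assoc, ← Finset.mul_sum, sum_tetraVertex_mul]
  simp
  ring

theorem matrix_ext_tetraVertex {A B : Matrix (Fin 3) (Fin 3) ℝ}
    (h : ∀ i, A.mulVec (tetraVertex i) = B.mulVec (tetraVertex i)) : A = B := by
  ext a b
  rw [eq_sum_dotProduct (A a) b, eq_sum_dotProduct (B a) b]
  congr 1
  refine Finset.sum_congr rfl fun i _ => ?_
  congr 1
  exact congrFun (h i) a

/-- The isometry which permutes the vertices of the tetrahedron in the given way. -/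
noncomputable def tetraMatrix (p : Equiv.Perm (Fin 4)) : Matrix (Fin 3) (Fin 3) ℝ :=
  fun a b => 1 / 4 * ∑ i, tetraVertex (p i) a * tetraVertex i b

/-- The inner products of the vertices are 4 δ - 1. The constant part contributes a multiple of the
sum of all vertices, which is zero, so only the term `i = j` is left. -/
theorem tetraMatrix_mulVec (p : Equiv.Perm (Fin 4)) (j : Fin 4) :
    (tetraMatrix p).mulVec (tetraVertex j) = tetraVertex (p j) := by
  ext a
  have h : ∀ i, ∑ b, tetraVertex i b * tetraVertex j b = (if i = j then 4 else 0) - 1 := by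
    intro i
    have := dotProduct_tetraVertex i j
    rw [dotProduct] at this
    rw [this]
    split_ifs <;> norm_num
  have hs : ∑ i, tetraVertex (p i) a = 0 := by
    rw [Equiv.sum_comp p (fun i => tetraVertex i a), sum_tetraVertex]
  simp only [Matrix.mulVec, dotProduct, tetraMatrix, mul_assoc, Finset.sum_mul, ← Finset.mul_sum]
  rw [Finset.sum_comm]
  simp only [← Finset.mul_sum, h, mul_sub, Finset.sum_sub_distrib, mul_one, hs]
  simp
  ring

theorem tetraMatrix_mul (p q : Equiv.Perm (Fin 4)) :
    tetraMatrix (p * q) = tetraMatrix p * tetraMatrix q :=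
  matrix_ext_tetraVertex fun i => by
    rw [← Matrix.mulVec_mulVec, tetraMatrix_mulVec, tetraMatrix_mulVec, tetraMatrix_mulVec]; rfl

theorem tetraMatrix_one : tetraMatrix 1 = 1 :=
  matrix_ext_tetraVertex fun i => by rw [tetraMatrix_mulVec, Matrix.one_mulVec]; rfl

theorem tetraMatrix_transpose (p : Equiv.Perm (Fin 4)) :
    (tetraMatrix p).transpose = tetraMatrix p⁻¹ := by
  ext a b
  simp only [Matrix.transpose_apply, tetraMatrix]
  congr 1
  rw [← Equiv.sum_comp p⁻¹]
  refine Finset.sum_congr rfl fun i _ => ?_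
  rw [← Equiv.Perm.mul_apply, mul_inv_cancel, Equiv.Perm.one_apply, mul_comm]

theorem tetraMatrix_mem (p : Equiv.Perm (Fin 4)) :
    tetraMatrix p ∈ Matrix.orthogonalGroup (Fin 3) ℝ := by
  rw [Matrix.mem_orthogonalGroup_iff]
  change tetraMatrix p * (tetraMatrix p).transpose = 1
  rw [tetraMatrix_transpose, ← tetraMatrix_mul, mul_inv_cancel, tetraMatrix_one]

theorem det_tetraMatrix_swap (i : Fin 3) :
    (tetraMatrix (Equiv.swap i.castSucc i.succ)).det = -1 := by
  have h : ∀ (p : Equiv.Perm (Fin 4)) (A : Matrix (Fin 3) (Fin 3) ℝ), A.det = -1 →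
      (∀ j, tetraVertex (p j) = A.mulVec (tetraVertex j)) → (tetraMatrix p).det = -1 := by
    intro p A hA hp
    rw [show tetraMatrix p = A from
      matrix_ext_tetraVertex fun j => by rw [tetraMatrix_mulVec, hp], hA]
  -- The isometry that exchanges two vertices of this tetrahedron is a reflection exchanging two
  -- coordinates, possibly with signs.
  fin_cases i
  · refine h _ !![1, 0, 0; 0, 0, -1; 0, -1, 0] (by simp [Matrix.det_fin_three]) fun j => ?_
    fin_cases j <;> [change tetraVertex 1 = _; change tetraVertex 0 = _; change tetraVertex 2 = _;
      change tetraVertex 3 = _] <;> ext a <;> fin_cases a <;>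
      simp [tetraVertex, Matrix.mulVec, dotProduct, Fin.sum_univ_three]
  · refine h _ !![0, 1, 0; 1, 0, 0; 0, 0, 1] (by simp [Matrix.det_fin_three]) fun j => ?_
    fin_cases j <;> [change tetraVertex 0 = _; change tetraVertex 2 = _; change tetraVertex 1 = _;
      change tetraVertex 3 = _] <;> ext a <;> fin_cases a <;>
      simp [tetraVertex, Matrix.mulVec, dotProduct, Fin.sum_univ_three]
  · refine h _ !![1, 0, 0; 0, 0, 1; 0, 1, 0] (by simp [Matrix.det_fin_three]) fun j => ?_
    fin_cases j <;> [change tetraVertex 0 = _; change tetraVertex 1 = _; change tetraVertex 3 = _;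
      change tetraVertex 2 = _] <;> ext a <;> fin_cases a <;>
      simp [tetraVertex, Matrix.mulVec, dotProduct, Fin.sum_univ_three]

theorem mem_Td_iff (A : Matrix.orthogonalGroup (Fin 3) ℝ) :
    A ∈ PointGroup.Td ↔ ∃ p, tetraMatrix p = A.1 := by
  change Matrix.mulVec A.1 '' PointGroup.tetrahedron = PointGroup.tetrahedron ↔ _
  rw [← range_tetraVertex, ← Set.range_comp]
  constructor
  · intro h
    have h1 : ∀ i, ∃ j, tetraVertex j = A.1.mulVec (tetraVertex i) := fun i => by
      have : A.1.mulVec (tetraVertex i) ∈ Set.range tetraVertex := h ▸ ⟨i, rfl⟩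
      exact this
    choose g hg using h1
    have hA : Matrix.transpose A.1 * A.1 = 1 := (Matrix.mem_orthogonalGroup_iff' (Fin 3) ℝ).1 A.2
    have hinj : Function.Injective g := fun i j e => by
      apply tetraVertex_injective
      have e1 : A.1.mulVec (tetraVertex i) = A.1.mulVec (tetraVertex j) := by rw [← hg, ← hg, e]
      have := congrArg (Matrix.mulVec (Matrix.transpose A.1)) e1
      rwa [Matrix.mulVec_mulVec, Matrix.mulVec_mulVec, hA, Matrix.one_mulVec,
        Matrix.one_mulVec] at this
    refine ⟨Equiv.ofBijective g (Finite.injective_iff_bijective.1 hinj), ?_⟩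
    exact matrix_ext_tetraVertex fun i => by rw [tetraMatrix_mulVec, ← hg]; rfl
  · rintro ⟨p, hp⟩
    have : Matrix.mulVec A.1 ∘ tetraVertex = tetraVertex ∘ p := by
      ext1 i
      change A.1.mulVec (tetraVertex i) = tetraVertex (p i)
      rw [← hp, tetraMatrix_mulVec]
    rw [this, Set.range_comp, Set.range_eq_univ.2 p.surjective, Set.image_univ]

/-- The permutations of four points with neither property are the 4-cycles. -/
theorem orbit_of_derangement : ∀ p : Equiv.Perm (Fin 4), (∃ i, p i = i) ∨ p * p = 1 ∨
    ∀ i, i = 0 ∨ i = p 0 ∨ i = p (p 0) ∨ i = p (p (p 0)) := by decide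

/-- A fixed index gives a fixed vertex, and an involution fixes the sum of two vertices that it
exchanges. For a 4-cycle, a fixed vector has equal inner products with all vertices; as the vertices
sum to zero, it vanishes. -/
theorem tetraMatrix_fixes_iff (p : Equiv.Perm (Fin 4)) :
    (∃ x : Fin 3 → ℝ, x ≠ 0 ∧ (tetraMatrix p).mulVec x = x) ↔ (∃ i, p i = i) ∨ p * p = 1 := by
  constructor
  · rintro ⟨x, hx, h⟩
    rcases orbit_of_derangement p with h1 | h1 | h1
    · exact Or.inl h1
    · exact Or.inr h1
    · exfalso
      have hA : Matrix.transpose (tetraMatrix p) * tetraMatrix p = 1 :=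
        (Matrix.mem_orthogonalGroup_iff' (Fin 3) ℝ).1 (tetraMatrix_mem p)
      have hd : ∀ i, dotProduct x (tetraVertex (p i)) = dotProduct x (tetraVertex i) := by
        intro i
        conv_lhs => rw [← h, ← tetraMatrix_mulVec]
        rw [Matrix.dotProduct_mulVec, ← Matrix.mulVec_transpose, Matrix.mulVec_mulVec, hA,
          Matrix.one_mulVec]
      have hc : ∀ i, dotProduct x (tetraVertex i) = dotProduct x (tetraVertex 0) := by
        intro i
        rcases h1 i with e | e | e | e <;> rw [e] <;> simp only [hd]
      apply hx
      ext a
      rw [eq_sum_dotProduct x a]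
      simp only [hc]
      rw [← Finset.mul_sum, sum_tetraVertex]
      simp
  · have key : ∀ j, dotProduct (tetraVertex 0 + tetraVertex j) (tetraVertex 0) ≠ 0 := by
      intro j
      rw [add_dotProduct, dotProduct_tetraVertex, dotProduct_tetraVertex, if_pos rfl]
      split_ifs <;> norm_num
    rintro (⟨i, hi⟩ | h)
    · refine ⟨tetraVertex i, fun e => ?_, by rw [tetraMatrix_mulVec, hi]⟩
      have := dotProduct_tetraVertex i i
      rw [e, zero_dotProduct, if_pos rfl] at this
      norm_num at this
    · refine ⟨tetraVertex 0 + tetraVertex (p 0), fun e => key (p 0) (by rw [e, zero_dotProduct]), ?_⟩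
      rw [Matrix.mulVec_add, tetraMatrix_mulVec, tetraMatrix_mulVec, ← Equiv.Perm.mul_apply, h,
        add_comm]
      rfl

end CappedTube

/-! ### Orientation and fixed cells for the shortest tube -/

namespace CappedTube

open Vertex SymParam

set_option maxHeartbeats 4000000 in
theorem reverses_swap_vertex : ∀ i : Fin 3, ∀ c : TetraCode,
    permFun (Equiv.swap i.castSucc i.succ) ((ofCode c).next (ofCode c).left) =
      (permFun (Equiv.swap i.castSucc i.succ) (ofCode c)).prev
        (permFun (Equiv.swap i.castSucc i.succ) (ofCode c).left) ∧
    permFun (Equiv.swap i.castSucc i.succ) ((ofCode c).next (ofCode c).right) =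
      (permFun (Equiv.swap i.castSucc i.succ) (ofCode c)).prev
        (permFun (Equiv.swap i.castSucc i.succ) (ofCode c).right) ∧
    permFun (Equiv.swap i.castSucc i.succ) ((ofCode c).next (ofCode c).vert) =
      (permFun (Equiv.swap i.castSucc i.succ) (ofCode c)).prev
        (permFun (Equiv.swap i.castSucc i.succ) (ofCode c).vert) := by decide

theorem reversesOrientation_swap (i : Fin 3) :
    (rotation 0).ReversesOrientation (permAut (Equiv.swap i.castSucc i.succ)) := by
  rintro ⟨⟨v, w⟩, hw : (graph 0).Adj v w⟩
  refine dart_eq_iff.2 ⟨rfl, ?_⟩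
  have h := reverses_swap_vertex i (code v)
  rw [ofCode_code] at h
  rcases adj_iff.1 hw with rfl | rfl | rfl
  exacts [h.1, h.2.1, h.2.2]

/-- Orientation character and determinant are both multiplicative, so it is enough to compare them
on the three adjacent transpositions, which generate the symmetric group. -/
theorem orientation_permAut (p : Equiv.Perm (Fin 4)) :
    (rotation 0).PreservesOrientation (permAut p) ∧ (tetraMatrix p).det = 1 ∨
      (rotation 0).ReversesOrientation (permAut p) ∧ (tetraMatrix p).det = -1 := by
  have hp : p ∈ Submonoid.closure
      (Set.range fun i : Fin 3 => Equiv.swap i.castSucc i.succ) := by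
    rw [Equiv.Perm.mclosure_swap_castSucc_succ]; trivial
  induction hp using Submonoid.closure_induction with
  | mem p hp =>
    obtain ⟨i, rfl⟩ := hp
    exact Or.inr ⟨reversesOrientation_swap i, det_tetraMatrix_swap i⟩
  | one =>
    left
    rw [tetraMatrix_one, Matrix.det_one]
    refine ⟨?_, rfl⟩
    rw [show permAut 1 = 1 by ext v; exact permFun_one v]
    exact RotationSystem.preservesOrientation_one
  | mul p q _ _ hp hq =>
    rw [permAut_mul, tetraMatrix_mul, Matrix.det_mul]
    rcases hp with ⟨h1, h2⟩ | ⟨h1, h2⟩ <;> rcases hq with ⟨h3, h4⟩ | ⟨h3, h4⟩ <;> rw [h2, h4]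
    · exact Or.inl ⟨h1.mul h3, by norm_num⟩
    · exact Or.inr ⟨h1.mul_reverses h3, by norm_num⟩
    · exact Or.inr ⟨h1.mul_preserves h3, by norm_num⟩
    · exact Or.inl ⟨h1.mul h3, by norm_num⟩

/-! #### Fixed cells

Every hexagon contains exactly the vertices `(i, k, false)` with `i ≠ k` for one `k`, and every
pentagon exactly one vertex `(k, k, false)`. -/

def hexLabel (l : ℕ × ZMod 12) : Bool :=
  l == (0, 4) || l == (0, 10) || l == (1, 0) || l == (1, 6)

/-- The codes of the vertices which determine the index of the face with the given label. -/
def Marks (l : ℕ × ZMod 12) (c : TetraCode) : Prop :=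
  c.2.2 = false ∧ (hexLabel l = true ↔ c.1 ≠ c.2.1)

instance (l : ℕ × ZMod 12) (c : TetraCode) : Decidable (Marks l c) := by
  unfold Marks; infer_instance

theorem marks_act {l : ℕ × ZMod 12} {c : TetraCode} (h : Marks l c) (p : Equiv.Perm (Fin 4)) :
    Marks l (c.act p) := by
  simpa [Marks, TetraCode.act] using h

/-- The index of the face with the given label. -/
def labelIndex (l : ℕ × ZMod 12) : Fin 4 :=
  if l.1 = 0 then (![0, 0, 0, 1, 3, 0, 1, 0, 1, 0, 2, 0] : Fin 12 → Fin 4) l.2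
  else if l.1 = 1 then (![1, 0, 2, 0, 2, 0, 0, 0, 3, 0, 3, 0] : Fin 12 → Fin 4) l.2
  else (![0, 0, 0, 0, 2, 0, 0, 0, 0, 0, 3, 0] : Fin 12 → Fin 4) l.2

theorem labelIndex_of_marks : ∀ c : TetraCode,
    (Marks (labelLeft (ofCode c)) (code (ofCode c)) →
      (code (ofCode c)).2.1 = labelIndex (labelLeft (ofCode c))) ∧
    (Marks (labelRight (ofCode c)) (code (ofCode c)) →
      (code (ofCode c)).2.1 = labelIndex (labelRight (ofCode c))) ∧
    (Marks (labelVert (ofCode c)) (code (ofCode c)) →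
      (code (ofCode c)).2.1 = labelIndex (labelVert (ofCode c))) := by decide

theorem labelIndex_of_marks_dart {d : (graph 0).Dart} (h : Marks (label d) (code d.fst)) :
    (code d.fst).2.1 = labelIndex (label d) := by
  obtain ⟨v, rfl | rfl | rfl⟩ := dart_cases d
  · rw [label_dartL] at h ⊢
    exact forall_vertex (P := fun v => Marks (labelLeft v) (code v) →
      (code v).2.1 = labelIndex (labelLeft v)) (fun c => (labelIndex_of_marks c).1) v h
  · rw [label_dartR] at h ⊢
    exact forall_vertex (P := fun v => Marks (labelRight v) (code v) →
      (code v).2.1 = labelIndex (labelRight v)) (fun c => (labelIndex_of_marks c).2.1) v h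
  · rw [label_dartV] at h ⊢
    exact forall_vertex (P := fun v => Marks (labelVert v) (code v) →
      (code v).2.1 = labelIndex (labelVert v)) (fun c => (labelIndex_of_marks c).2.2) v h

theorem exists_marks : ∀ j : Fin 3, ∀ y : ZMod 12, present (j.1 == 0) (j.1 == 2) y = true →
    (isUp y || j.1 == 0 && (y == 3 || y == 9)) = true →
    ∃ c : TetraCode, Marks (j.1, y) (code (ofCode c)) ∧ (labelLeft (ofCode c) = (j.1, y) ∨
      labelRight (ofCode c) = (j.1, y) ∨ labelVert (ofCode c) = (j.1, y)) := by decide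

theorem exists_marks_dart (F : (rotation 0).Face) :
    ∃ d, (rotation 0).faceOf d = F ∧ Marks (label d) (code d.fst) := by
  obtain ⟨w, hw, rfl⟩ := exists_faceOf_base F
  have hl := w.layer_le
  obtain ⟨c, h1, h2⟩ := exists_marks ⟨w.layer, by omega⟩ w.pos w.present_pos hw
  have fin : ∀ d : (graph 0).Dart, d.fst = ofCode c → label d = (w.layer, w.pos) →
      ∃ d, (rotation 0).faceOf d = (rotation 0).faceOf (dartV w) ∧
        Marks (label d) (code d.fst) := fun d hd hd' =>
    ⟨d, faceOf_eq_iff_label.2 (by rw [hd', label_base hw]), by rw [hd, hd']; exact h1⟩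
  rcases h2 with h | h | h
  · exact fin (dartL (ofCode c)) rfl (by rw [label_dartL]; exact h)
  · exact fin (dartR (ofCode c)) rfl (by rw [label_dartR]; exact h)
  · exact fin (dartV (ofCode c)) rfl (by rw [label_dartV]; exact h)

/-- A permutation of four points without fixed points that exchanges two of them must exchange the
other two as well. -/
theorem sq_eq_one_of_apply_apply : ∀ (p : Equiv.Perm (Fin 4)) (i : Fin 4), p (p i) = i →
    (∃ k, p k = k) ∨ p * p = 1 := by decide

/-- A fixed vertex or face yields a fixed index, and a reversed edge yields an index of period at
most two. Conversely a fixed index fixes a tip, and an involution without fixed points reverses the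
edge between the codes `(0, p 0, true)` and `(p 0, 0, true)`. -/
theorem fixesCell_permAut_iff (p : Equiv.Perm (Fin 4)) :
    (rotation 0).FixesCell (permAut p) ↔ (∃ i, p i = i) ∨ p * p = 1 := by
  constructor
  · rintro (⟨v, hv⟩ | ⟨e, he, hfe⟩ | ⟨F, hF⟩)
    · rw [permAut_apply] at hv
      have := code_permFun p v
      rw [hv] at this
      exact Or.inl ⟨_, (congrArg Prod.fst this).symm⟩
    · induction e with | h v w =>
      rw [Sym2.map_mk, Sym2.eq_iff] at hfe
      simp only [permAut_apply] at hfe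
      have hv := code_permFun p v
      have hw := code_permFun p w
      rcases hfe with ⟨h1, -⟩ | ⟨h1, h2⟩
      · rw [h1] at hv
        exact Or.inl ⟨_, (congrArg Prod.fst hv).symm⟩
      · rw [h1] at hv
        rw [h2, hv] at hw
        exact sq_eq_one_of_apply_apply p _ (congrArg Prod.fst hw).symm
    · obtain ⟨d, hd, hm⟩ := exists_marks_dart F
      obtain ⟨d', hd', he⟩ := RotationSystem.exists_dart_of_edges_image hF hd
      have hl : label d' = label d := label_eq_of_faceOf_eq (hd'.trans hd.symm)
      have hc : code d'.fst = (code d.fst).act p := by rw [he]; exact code_permFun p _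
      have h1 := labelIndex_of_marks_dart hm
      have h2 := labelIndex_of_marks_dart (d := d') (by rw [hl, hc]; exact marks_act hm p)
      rw [hl, ← h1, hc] at h2
      exact Or.inl ⟨_, h2⟩
  · intro h
    by_cases h0 : ∃ i, p i = i
    · obtain ⟨i, hi⟩ := h0
      exact Or.inl ⟨tip i, by rw [permAut_apply, permFun_tip, hi]⟩
    · have h1 := h.resolve_left h0
      have hne : p 0 ≠ 0 := fun e => h0 ⟨0, e⟩
      have h2 : p (p 0) = 0 := by rw [← Equiv.Perm.mul_apply, h1]; rfl
      have c1 : code (ofCode (0, p 0, true)) = (0, p 0, true) :=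
        code_ofCode _ fun e => absurd e.symm hne
      have c2 : code (ofCode (p 0, 0, true)) = (p 0, 0, true) :=
        code_ofCode _ fun e => absurd e hne
      refine fixesCell_of_edge (v := ofCode (0, p 0, true)) (w := ofCode (p 0, 0, true)) ?_ ?_ ?_
      · rw [adj_iff_code, c1, c2]
        exact Or.inr (Or.inr ⟨rfl, rfl, rfl, rfl⟩)
      · rw [permAut_apply, permFun, c1]
        change ofCode (p 0, p (p 0), true) = _
        rw [h2]
      · rw [permAut_apply, permFun, c2]
        change ofCode (p (p 0), p 0, true) = _
        rw [h2]

noncomputable def permEquiv : Equiv.Perm (Fin 4) ≃ (graph 0 ≃g graph 0) :=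
  Equiv.ofBijective permAut
    ⟨permAut_injective, fun f => (permAut_surjective f).imp fun _ h => h.symm⟩

theorem permAut_permEquiv_symm (f : graph 0 ≃g graph 0) : permAut (permEquiv.symm f) = f :=
  permEquiv.apply_symm_apply f

/-- The isometry corresponding to an automorphism of the shortest tube. -/
noncomputable def tetraHom : (graph 0 ≃g graph 0) →* Matrix.orthogonalGroup (Fin 3) ℝ :=
  MonoidHom.mk' (fun f => ⟨tetraMatrix (permEquiv.symm f), tetraMatrix_mem _⟩) (fun f g => by
    refine Subtype.ext ?_
    change tetraMatrix _ = tetraMatrix _ * tetraMatrix _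
    rw [← tetraMatrix_mul]
    congr 1
    rw [Equiv.symm_apply_eq]
    change f * g = permAut _
    rw [permAut_mul, permAut_permEquiv_symm, permAut_permEquiv_symm])

theorem tetraMatrix_injective : Function.Injective tetraMatrix := fun p q h => by
  ext i : 1
  apply tetraVertex_injective
  rw [← tetraMatrix_mulVec, h, tetraMatrix_mulVec]

theorem hasPointGroup_Td : (rotation 0).HasPointGroup PointGroup.Td := by
  refine RotationSystem.hasPointGroup_of_injective tetraHom ?_ ?_
    not_preserves_and_reverses ?_ ?_
  · intro f g h
    exact permEquiv.symm.injective (tetraMatrix_injective (congrArg Subtype.val h))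
  · ext A
    rw [mem_Td_iff]
    constructor
    · rintro ⟨f, rfl⟩
      exact ⟨_, rfl⟩
    · rintro ⟨p, hp⟩
      refine ⟨permEquiv p, Subtype.ext ?_⟩
      change tetraMatrix (permEquiv.symm (permEquiv p)) = _
      rw [Equiv.symm_apply_apply, hp]
  · intro f
    have h := orientation_permAut (permEquiv.symm f)
    rw [permAut_permEquiv_symm] at h
    exact h
  · intro f
    have h := fixesCell_permAut_iff (permEquiv.symm f)
    rw [permAut_permEquiv_symm, ← tetraMatrix_fixes_iff] at h
    exact h

end CappedTube

/-! ### The theorem -/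

theorem theorem7p1 (h : ℕ) (hh : 2 ≤ h) (heven : Even h) :
    ∃ (V : Type) (G : SimpleGraph V) (R : RotationSystem G),
      R.IsFullerene ∧ Nat.card V = 18 * h - 8 ∧
      (∃ Z₁ Z₂ : R.Zigzag, Z₁ ≠ Z₂ ∧ Z₁.IsSimple ∧ Z₂.IsSimple ∧
        (Z₁.edges ∩ Z₂.edges).ncard = h) ∧
      (h = 2 → R.HasPointGroup PointGroup.Td) ∧
      (h ≠ 2 → Even (h / 2) → R.HasPointGroup PointGroup.D2h) ∧
      (h ≠ 2 → Odd (h / 2) → R.HasPointGroup PointGroup.D2d) := by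
  obtain ⟨m, rfl⟩ : ∃ m, h = 2 * m + 2 := by
    obtain ⟨k, rfl⟩ := heven
    exact ⟨k - 1, by omega⟩
  -- So `h / 2` and `m` have opposite parities: even `h / 2` belongs to odd `m`, where the caps are
  -- aligned.
  have e : (2 * m + 2) / 2 = m + 1 := by omega
  refine ⟨CappedTube.Vertex m, CappedTube.graph m, CappedTube.rotation m,
    CappedTube.isFullerene m, ?_, CappedTube.exists_zigzags m, fun h2 => ?_, fun _ h2 => ?_,
    fun h1 h2 => ?_⟩
  · rw [CappedTube.card_vertex]; omega
  · obtain rfl : m = 0 := by omega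
    exact CappedTube.hasPointGroup_Td
  · rw [e, Nat.even_add_one, Nat.not_even_iff_odd] at h2
    exact CappedTube.hasPointGroup_D2h h2
  · rw [e, Nat.odd_add_one, Nat.not_odd_iff_even] at h2
    exact CappedTube.hasPointGroup_D2d h2 (by omega)
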